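/- Let $d \ge 1$. A *functional* is a real-valued measurable function $H$ on the finite subsets of $\mathbb{R}^d$ (measurable for the $\sigma$-algebra generated by the counting maps $s \mapsto \#(s \cap A)$, $A$ Borel); it is *translation-invariant* if $H(y+\mathfrak{X}) = H(\mathfrak{X})$ for all $y$ and all finite $\mathfrak{X}$. Write $D_x(\mathfrak{X}) = H(\mathfrak{X} \cup \{x\}) - H(\mathfrak{X})$. A *cube* is a set $z + [0,a)^d$ with $a>0$, and $B_r(0)$ is the closed Euclidean ball. $\mathcal{P}(g)$ denotes a Poisson point process with intensity function $g$; for a constant $\lambda \ge 0$, $\mathcal{P}(\lambda)$ is the homogeneous one with density $\lambda$. Let $f : \mathbb{R}^d \to [0,\infty)$ be a bounded measurable function with compact support, let $\Lambda = \sup f$, and for integers $n \ge 1$ let $\tilde{\mathcal{P}}_n = n^{1/d}\mathcal{P}(nf)$, a Poisson point process with intensity function $f(x/n^{1/d})$. Let $H$ be a translation-invariant functional such that: (a) for every $\lambda \in [0,\Lambda]$, $H$ is *strongly stabilizing* on $\mathcal{P}(\lambda)$: there are finite random variables $\tau(\lambda)$ and $\Delta(\lambda)$ such that almost surely $D_0\big((\mathcal{P}(\lambda)|_{B_{\tau(\lambda)}(0)})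 \cup \mathcal{A}\big) = \Delta(\lambda)$ for all finite $\mathcal{A} \subset \mathbb{R}^d$ with $\mathcal{A} \cap B_{\tau(\lambda)}(0) = \emptyset$; (b) (*Poisson bounded moments*) for some $p > 2$, $\displaystyle \sup_{n \ge 1} \sup_{y \in \mathbb{R}^d} \sup_{W \ni y \text{ cube}} \mathbb{E}\big[|D_y(\tilde{\mathcal{P}}_n|_W)|^p\big] < \infty$; (c) (*locally bounded moments*) for every cube $W$ there is $\delta > 0$ with $\displaystyle \sup_{n \ge 1} \sup_{y \in \mathbb{R}^d} \mathbb{E}\big[|H(\tilde{\mathcal{P}}_n|_{y+W})|^{2+\delta}\big] < \infty$. Then for almost every $x \in \mathbb{R}^d$, with $\lambda = f(x)$, the random variables $H(\mathcal{P}(\lambda)|_{[0,t^{1/d})^d})$, $t>0$, are square integrable and the limit $$\hat\sigma^2(\lambda) = \lim_{t \to \infty} \frac{\mathrm{Var}\big[H(\mathcal{P}(\lambda)|_{[0,t^{1/d})^d})\big]}{t}$$ exists ($t$ real) and is finite; the function $x \mapsto \hat\sigma^2(f(x))$ is integrable; $H(\tilde{\mathcal{P}}_n)$ is square integrable for every $n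 \ge 1$; and with $\sigma^2 = \int_{\mathbb{R}^d} \hat\sigma^2(f(x))\,dx$, as $n \to \infty$, $$\frac{\mathrm{Var}[H(\tilde{\mathcal{P}}_n)]}{n} \to \sigma^2, \qquad \frac{H(\tilde{\mathcal{P}}_n) - \mathbb{E}[H(\tilde{\mathcal{P}}_n)]}{\sqrt{n}} \to \mathcal{N}(0,\sigma^2) \text{ in distribution.}$$ -/

import Mathlib

open MeasureTheory ProbabilityTheory Filter Topology
open scoped NNReal ENNReal Pointwise

namespace PoissonCLT

/-- The space `ℝ^d` with the Euclidean norm, its Borel sets and Lebesgue measure. -/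
abbrev E (d : ℕ) : Type := EuclideanSpace ℝ (Fin d)

/-- The cube `y + [0, a)^d`. -/
def cube {d : ℕ} (y : E d) (a : ℝ) : Set (E d) :=
  {x | ∀ i, y i ≤ x i ∧ x i < y i + a}

/-- The standard σ-algebra on the finite subsets of `ℝ^d`: it is generated by the counting maps
`s ↦ #(s ∩ A)`, for `A` Borel. (It is not the Mathlib instance on `Finset`, which is generated by
the membership of single points only, and it is always passed explicitly.) -/
@[reducible] noncomputable def countingSigma (d : ℕ) : MeasurableSpace (Finset (E d)) :=
  ⨆ (A : Set (E d)) (_ : MeasurableSet A),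
    MeasurableSpace.comap (fun s : Finset (E d) => ((s : Set (E d)) ∩ A).ncard) ⊤

/-- A functional: a real-valued measurable function on the finite subsets of `ℝ^d`. -/
def IsFunctional {d : ℕ} (H : Finset (E d) → ℝ) : Prop :=
  Measurable[countingSigma d] H

/-- `H (y + s) = H s` for all finite `s` and all `y`. -/
def TranslationInvariant {d : ℕ} (H : Finset (E d) → ℝ) : Prop :=
  ∀ (y : E d) (s : Finset (E d)), H (s.map (Equiv.addLeft y).toEmbedding) = H s

open Classical in
/-- The value of a functional at a set which is finite. The value at an infinite set is a
convention; it is only ever met with probability zero. -/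
noncomputable def val {d : ℕ} (H : Finset (E d) → ℝ) (s : Set (E d)) : ℝ :=
  if h : s.Finite then H h.toFinset else 0

/-- The add one cost `D_x(s) = H (s ∪ {x}) - H s`. -/
noncomputable def addOneCost {d : ℕ} (H : Finset (E d) → ℝ) (x : E d) (s : Set (E d)) : ℝ :=
  val H (s ∪ {x}) - val H s

/-- `P` is a Poisson point process on `ℝ^d` with (locally integrable) intensity function `f`:
a random locally finite set such that the number of points in a bounded Borel set `A` is a
Poisson random variable with parameter `∫_A f`, and such that the numbers of points in disjoint
(bounded) Borel sets are independent. -/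
structure IsPoissonProcess {d : ℕ} {Ω : Type*} [MeasurableSpace Ω]
    (P : Ω → Set (E d)) (f : E d → ℝ≥0) (μ : Measure Ω) : Prop where
  locallyFinite : ∀ ω, ∀ A : Set (E d), Bornology.IsBounded A → (P ω ∩ A).Finite
  measurable_count : ∀ A : Set (E d), MeasurableSet A → Bornology.IsBounded A →
    Measurable fun ω => (P ω ∩ A).ncard
  intensity_ne_top : ∀ A : Set (E d), Bornology.IsBounded A → ∫⁻ x in A, (f x : ℝ≥0∞) ≠ ∞
  map_count : ∀ A : Set (E d), MeasurableSet A → Bornology.IsBounded A →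
    μ.map (fun ω => (P ω ∩ A).ncard) = poissonMeasure (∫⁻ x in A, (f x : ℝ≥0∞)).toNNReal
  indep_count : ∀ (k : ℕ) (A : Fin k → Set (E d)), (∀ i, MeasurableSet (A i)) →
    (∀ i, Bornology.IsBounded (A i)) → Pairwise (fun i j => Disjoint (A i) (A j)) →
    iIndepFun (fun i ω => (P ω ∩ A i).ncard) μ

/-- `H` is strongly stabilizing on the point process `P`: there are random variables `τ` (the
radius of stabilization) and `Δ` (the limiting add one cost) such that almost surely
`D_0 ((P ∩ B_τ(0)) ∪ A) = Δ` for all finite `A` disjoint from the closed ball `B_τ(0)`. -/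
def StronglyStabilizing {d : ℕ} {Ω : Type*} [MeasurableSpace Ω]
    (H : Finset (E d) → ℝ) (P : Ω → Set (E d)) (μ : Measure Ω) : Prop :=
  ∃ τ Δ : Ω → ℝ, Measurable τ ∧ Measurable Δ ∧
    ∀ᵐ ω ∂μ, ∀ A : Finset (E d), Disjoint (A : Set (E d)) (Metric.closedBall 0 (τ ω)) →
      addOneCost H 0 ((P ω ∩ Metric.closedBall 0 (τ ω)) ∪ (A : Set (E d))) = Δ ω

/-- The Poisson bounded moments condition on the sequence `(P n)`, `n ≥ 1`: for some `p > 2`,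
`E |D_y (P n ∩ W)|^p` is bounded uniformly in `n ≥ 1`, the point `y` and the cube `W ∋ y`. -/
def PoissonBoundedMoments {d : ℕ} {Ω : ℕ → Type*} [∀ n, MeasurableSpace (Ω n)]
    (H : Finset (E d) → ℝ) (P : ∀ n, Ω n → Set (E d)) (μ : ∀ n, Measure (Ω n)) : Prop :=
  ∃ p : ℝ, 2 < p ∧ ∃ C : ℝ≥0, ∀ n : ℕ, 1 ≤ n → ∀ (y z : E d) (a : ℝ), y ∈ cube z a →
    ∫⁻ ω, ‖addOneCost H y (P n ω ∩ cube z a)‖ₑ ^ p ∂(μ n) ≤ C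

/-- The locally bounded moments condition on the sequence `(P n)`, `n ≥ 1`: for every cube `W`
there is `δ > 0` such that `E |H (P n ∩ (y + W))|^(2 + δ)` is bounded uniformly in `n ≥ 1`
and `y`. -/
def LocallyBoundedMoments {d : ℕ} {Ω : ℕ → Type*} [∀ n, MeasurableSpace (Ω n)]
    (H : Finset (E d) → ℝ) (P : ∀ n, Ω n → Set (E d)) (μ : ∀ n, Measure (Ω n)) : Prop :=
  ∀ (z : E d) (a : ℝ), 0 < a → ∃ δ : ℝ, 0 < δ ∧ ∃ C : ℝ≥0, ∀ n : ℕ, 1 ≤ n → ∀ y : E d,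
    ∫⁻ ω, ‖val H (P n ω ∩ (y +ᵥ cube z a))‖ₑ ^ (2 + δ) ∂(μ n) ≤ C

/-- The scaled process `n^{1/d} P`. -/
noncomputable def scaled {d : ℕ} {Ω : Type*} (n : ℕ) (P : Ω → Set (E d)) : Ω → Set (E d) :=
  fun ω => (n : ℝ) ^ ((1 : ℝ) / d) • P ω

/-- The random variable `H (P ∩ [0, t^{1/d})^d)`, for real `t > 0`. -/
noncomputable def boxVal {d : ℕ} {Ω : Type*} (H : Finset (E d) → ℝ) (P : Ω → Set (E d))
    (t : ℝ) : Ω → ℝ :=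
  fun ω => val H (P ω ∩ cube 0 (t ^ ((1 : ℝ) / d)))

/-- The limiting variance `lim_{t → ∞} Var[H (P ∩ [0, t^{1/d})^d)] / t` (a convention if the
limit does not exist). -/
noncomputable def limitingVariance {d : ℕ} {Ω : Type*} [MeasurableSpace Ω]
    (H : Finset (E d) → ℝ) (P : Ω → Set (E d)) (μ : Measure Ω) : ℝ :=
  limUnder atTop fun t : ℝ => Var[boxVal H P t; μ] / t

end PoissonCLT

/-!
The value of `H` on a large window is a sum of values on cells of a large fixed side `L`, which are
independent, up to an error with a small variance. The theorem follows by letting first `n` and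
then `L` tend to infinity.

*Laws.* Everything is computed with laws on finite configurations: `poissonLaw ν` is defined by an
explicit series (a Poisson number of independent points), and `law g W` is the law of the process
with intensity function `g` in the window `W`. A law on configurations is determined by its
characteristic functional (`ext_of_integral_expSum`), whence independence on disjoint sets, the
effect of restrictions and translations, and the fact that a Poisson process, given by its
counts, has this law in every bounded window (`map_window`).

*The Poincaré inequality* `evariance_le_energy`: the variance of a functional is at most the
integral of its mean square add one cost with respect to the intensity measure. For a measure of
small mass `m` it holds, up to an error quadratic in `m`, by an expansion in the number of points.
The process is the superposition of `2 ^ k` independent processes with intensity `2 ^ (-k) ν`, and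
the variance is subadditive over independent components (`evariance_prod_le`); so the error
disappears as `k → ∞`.

*The error.* The difference between `H` and the sum over the cells, `blockSum`, has an add one cost
at `y` that is the difference between the costs in the window and in the cell of `y`. If `y` is at
a distance at least `√L` from the boundary of its cell, strong stabilization says that the two
costs agree with a probability close to one (`law_cost_ne_restr_le`), for the homogeneous process
with density `f x`, and then also for the `n`-th process around `n ^ (1 / d) x`, if `x` is a
Lebesgue point of `f`: there the two processes are close in total variation. The bounded moments of
order `p > 2` turn this into a bound for the mean square cost (`errCost_le_of_inner`). The
remaining points fill a negligible part of the volume. Together with the reverse Fatou lemma, this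
gives a variance of the error of at most `η n`, for large `L` and then large `n`
(`Regular.eventually_evariance_error_le`).

*Conclusion.* The same comparison for the homogeneous process shows that its normalized standard
deviations in cubes form a Cauchy family (`exists_tendsto_cubeVariance`). For a fixed `L`, the
variances over the cells converge around Lebesgue points, so their normalized sum converges to an
integral (`Regular.tendsto_sum_variance_div`), and the Lyapunov expansion of characteristic
functions gives the central limit theorem for the sum over the cells
(`Regular.tendsto_charFun_blockSum`). Letting `L → ∞` yields the variance
(`Regular.tendsto_variance_div`) and the characteristic function (`Regular.tendsto_charFun`) of `H`.
-/

namespace PoissonCLT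

open scoped Classical

variable {d : ℕ}

/-! ### Finite configurations -/

/-- Finite configurations carry the counting σ-algebra throughout; this instance takes precedence
over the coarser Mathlib one. -/
noncomputable instance instMeasurableSpaceConfig : MeasurableSpace (Finset (E d)) :=
  countingSigma d

/-- The number of points of the configuration `s` in `A`. -/
noncomputable def count (A : Set (E d)) (s : Finset (E d)) : ℕ := ((s : Set (E d)) ∩ A).ncard

/-- The configuration `s ∩ A`. -/
noncomputable def restr (A : Set (E d)) (s : Finset (E d)) : Finset (E d) := s.filter (· ∈ A)

@[simp] lemma mem_restr {A : Set (E d)} {s : Finset (E d)} {x : E d} :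
    x ∈ restr A s ↔ x ∈ s ∧ x ∈ A := by simp [restr]

lemma coe_restr (A : Set (E d)) (s : Finset (E d)) :
    (restr A s : Set (E d)) = (s : Set (E d)) ∩ A := by ext; simp

lemma count_eq_card (A : Set (E d)) (s : Finset (E d)) : count A s = (restr A s).card := by
  rw [count, ← coe_restr, Set.ncard_coe_finset]

lemma count_eq_sum (A : Set (E d)) (s : Finset (E d)) :
    count A s = ∑ x ∈ s, if x ∈ A then 1 else 0 := by
  rw [count_eq_card, restr, Finset.card_filter]

lemma measurable_count {A : Set (E d)} (hA : MeasurableSet A) : Measurable (count A) := by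
  refine Measurable.mono (comap_measurable (count A)) ?_ le_rfl
  exact le_iSup₂_of_le (f := fun (A : Set (E d)) (_ : MeasurableSet A) =>
    MeasurableSpace.comap (fun s : Finset (E d) => ((s : Set (E d)) ∩ A).ncard) ⊤) A hA le_rfl

lemma measurable_config_iff {X : Type*} [MeasurableSpace X] {φ : X → Finset (E d)} :
    Measurable φ ↔ ∀ A, MeasurableSet A → Measurable fun x => count A (φ x) := by
  refine ⟨fun h A hA => (measurable_count hA).comp h, fun h => ?_⟩
  rw [measurable_iff_comap_le]
  change MeasurableSpace.comap φ (⨆ (A : Set (E d)) (_ : MeasurableSet A),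
    MeasurableSpace.comap (fun s : Finset (E d) => ((s : Set (E d)) ∩ A).ncard) ⊤) ≤ _
  simp only [MeasurableSpace.comap_iSup, MeasurableSpace.comap_comp]
  exact iSup₂_le fun A hA => (h A hA).comap_le

lemma count_restr (A B : Set (E d)) (s : Finset (E d)) :
    count A (restr B s) = count (B ∩ A) s := by
  simp only [count, coe_restr, Set.inter_assoc]

lemma measurable_restr {A : Set (E d)} (hA : MeasurableSet A) : Measurable (restr A) :=
  measurable_config_iff.2 fun B hB => by
    simpa only [count_restr] using measurable_count (hA.inter hB)

lemma measurable_singleton_config : Measurable fun x : E d => ({x} : Finset (E d)) :=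
  measurable_config_iff.2 fun A hA => by
    simp only [count_eq_sum, Finset.sum_singleton]
    exact Measurable.ite hA measurable_const measurable_const

/-- The first `n` bits of an injective measurable binary coding of the points of `ℝ^d`. -/
noncomputable def code (n : ℕ) (x : E d) : Fin n → Bool :=
  fun i => MeasurableSpace.mapNatBool (E d) x i

lemma measurable_code (n : ℕ) : Measurable (code (d := d) n) :=
  measurable_pi_lambda _ fun i =>
    (measurable_pi_apply (i : ℕ)).comp (MeasurableSpace.measurable_mapNatBool (E d))

lemma eventually_injOn_code (s : Finset (E d)) :
    ∀ᶠ n in atTop, Set.InjOn (code n) (s : Set (E d)) := by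
  have h : ∀ x ∈ s, ∀ y ∈ s, ∀ᶠ n in atTop, code n x = code n y → x = y := by
    intro x _ y _
    by_cases hxy : x = y
    · exact Eventually.of_forall fun _ _ => hxy
    have := (MeasurableSpace.injective_mapNatBool (E d)).ne hxy
    obtain ⟨i, hi⟩ := Function.ne_iff.1 this
    filter_upwards [eventually_gt_atTop i] with n hn h
    exact absurd (congrFun h ⟨i, hn⟩) hi
  have h' := (Filter.eventually_all_finset s).2 fun x hx =>
    (Filter.eventually_all_finset s).2 fun y hy => h x hx y hy
  filter_upwards [h'] with n hn x hx y hy hxy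
  exact hn x hx y hy hxy

lemma count_eq_sum_code {n : ℕ} {s : Finset (E d)} (hs : Set.InjOn (code n) (s : Set (E d)))
    (A : Set (E d)) : count A s =
      ∑ q : Fin n → Bool, if count (A ∩ code n ⁻¹' {q}) s = 0 then 0 else 1 := by
  have hz : ∀ q, count (A ∩ code n ⁻¹' {q}) s = 0 ↔ q ∉ (restr A s).image (code n) := by
    intro q
    rw [count_eq_card, Finset.card_eq_zero, Finset.eq_empty_iff_forall_notMem]
    simp only [mem_restr, Finset.mem_image, Set.mem_inter_iff, Set.mem_preimage,
      Set.mem_singleton_iff]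
    grind
  simp only [hz]
  rw [count_eq_card, ← Finset.card_image_of_injOn (f := code n) (s := restr A s)
    (hs.mono fun x hx => (mem_restr.1 hx).1)]
  simp only [ite_not, Finset.sum_boole, Finset.filter_univ_mem, Nat.cast_id]

lemma measurable_union_config :
    Measurable fun p : Finset (E d) × Finset (E d) => p.1 ∪ p.2 := by
  refine measurable_config_iff.2 fun A hA => ?_
  -- once the cells of the coding separate the points, the points are counted by occupied cells
  let F : ℕ → Finset (E d) × Finset (E d) → ℕ := fun n p => ∑ q : Fin n → Bool,
    if count (A ∩ code n ⁻¹' {q}) p.1 + count (A ∩ code n ⁻¹' {q}) p.2 = 0 then 0 else 1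
  have hF : ∀ n, Measurable (F n) := by
    intro n
    refine Finset.measurable_sum _ fun q _ => ?_
    have hm : MeasurableSet (A ∩ code (d := d) n ⁻¹' {q}) :=
      hA.inter (measurable_code n (measurableSet_singleton q))
    refine Measurable.ite ?_ measurable_const measurable_const
    exact (((measurable_count hm).comp measurable_fst).add
      ((measurable_count hm).comp measurable_snd)) (measurableSet_singleton 0)
  refine measurable_of_tendsto_metrizable hF (tendsto_pi_nhds.2 fun p => ?_)
  refine tendsto_const_nhds.congr' ?_
  filter_upwards [eventually_injOn_code (p.1 ∪ p.2)] with n hn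
  rw [count_eq_sum_code hn]
  refine Finset.sum_congr rfl fun q _ => ?_
  refine if_congr ?_ rfl rfl
  simp only [count_eq_card, Nat.add_eq_zero_iff]
  simp only [Finset.card_eq_zero, Finset.eq_empty_iff_forall_notMem, mem_restr, Finset.mem_union]
  grind

lemma measurable_insert_config : Measurable fun p : E d × Finset (E d) => insert p.1 p.2 := by
  simp only [Finset.insert_eq]
  exact measurable_union_config.comp
    ((measurable_singleton_config.comp measurable_fst).prodMk measurable_snd)

lemma measurable_image_config {ι : Type*} (J : Finset ι) :
    Measurable fun x : ι → E d => J.image x := by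
  induction J using Finset.induction_on with
  | empty => simp
  | insert a J _ ih =>
    simp only [Finset.image_insert]
    exact measurable_insert_config.comp ((measurable_pi_apply a).prodMk ih)

/-- The translate `y + s` of a configuration. -/
noncomputable def translate (y : E d) (s : Finset (E d)) : Finset (E d) :=
  s.map (Equiv.addLeft y).toEmbedding

lemma mem_translate {y : E d} {s : Finset (E d)} {x : E d} :
    x ∈ translate y s ↔ x - y ∈ s := by
  simp only [translate, Finset.mem_map_equiv]
  simp [neg_add_eq_sub]

lemma measurable_translate (y : E d) : Measurable (translate y) := by
  refine measurable_config_iff.2 fun A hA => ?_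
  have : (fun s => count A (translate y s)) = count ((fun x => y + x) ⁻¹' A) := by
    ext s
    rw [count_eq_sum, count_eq_sum, translate, Finset.sum_map]
    rfl
  rw [this]
  exact measurable_count (measurable_const_add y hA)

/-! ### The Poisson law on finite configurations -/

/-- The weight of the configurations with `k` points in the law of a Poisson process. -/
noncomputable def poissonWeight (ν : Measure (E d)) (k : ℕ) : ℝ≥0∞ :=
  ENNReal.ofReal (Real.exp (-ν.real Set.univ) / k.factorial)

/-- The law of the Poisson process with finite intensity measure `ν`, as a measure on finite
configurations, given by its Janossy densities: the configurations with `k` points have the law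
`e^{-m} / k! • ν^k`, with `m` the mass of `ν`. -/
noncomputable def poissonLaw (ν : Measure (E d)) : Measure (Finset (E d)) :=
  Measure.sum fun k : ℕ => poissonWeight ν k •
    (Measure.pi fun _ : Fin k => ν).map fun x => Finset.univ.image x

lemma lintegral_poissonLaw (ν : Measure (E d)) {Φ : Finset (E d) → ℝ≥0∞} (hΦ : Measurable Φ) :
    ∫⁻ s, Φ s ∂poissonLaw ν = ∑' k, poissonWeight ν k *
      ∫⁻ x, Φ (Finset.univ.image x) ∂(Measure.pi fun _ : Fin k => ν) := by
  rw [poissonLaw, lintegral_sum_measure]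
  refine tsum_congr fun k => ?_
  rw [lintegral_smul_measure, lintegral_map hΦ (measurable_image_config _), smul_eq_mul]

section
variable (ν : Measure (E d))

lemma tsum_poissonWeight [IsFiniteMeasure ν] : ∑' k, poissonWeight ν k * (ν Set.univ) ^ k = 1 := by
  have h := hasSum_one_poissonMeasure (ν Set.univ).toNNReal
  have h2 : ∀ k : ℕ, poissonWeight ν k * (ν Set.univ) ^ k = ENNReal.ofReal
      (Real.exp (-((ν Set.univ).toNNReal : ℝ)) * ((ν Set.univ).toNNReal : ℝ) ^ k / k.factorial) := by
    intro k
    have : ν Set.univ = ENNReal.ofReal ((ν Set.univ).toNNReal : ℝ) := by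
      rw [ENNReal.ofReal_coe_nnreal, ENNReal.coe_toNNReal (measure_ne_top ν _)]
    rw [poissonWeight, this, ← ENNReal.ofReal_pow (by positivity), ← ENNReal.ofReal_mul (by positivity)]
    simp only [ENNReal.ofReal_coe_nnreal, ENNReal.toNNReal_coe]
    congr 1
    simp only [Measure.real, ENNReal.coe_toNNReal_eq_toReal]
    ring
  simp_rw [h2]
  rw [← ENNReal.ofReal_tsum_of_nonneg (fun k => by positivity) h.summable, h.tsum_eq]
  simp

instance [IsFiniteMeasure ν] : IsProbabilityMeasure (poissonLaw ν) := by
  constructor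
  rw [← lintegral_one, lintegral_poissonLaw ν measurable_const]
  simpa [Measure.pi_univ] using tsum_poissonWeight ν

lemma ae_poissonLaw_of_forall {p : Finset (E d) → Prop} (hp : MeasurableSet {s | p s})
    (h : ∀ k : ℕ, ∀ᵐ x ∂(Measure.pi fun _ : Fin k => ν), p (Finset.univ.image x)) :
    ∀ᵐ s ∂poissonLaw ν, p s := by
  rw [poissonLaw, Measure.ae_sum_iff' hp]
  intro k
  refine Measure.ae_smul_measure ?_ _
  exact (ae_map_iff (measurable_image_config _).aemeasurable hp).2 (h k)

lemma measurableSet_count_eq {A : Set (E d)} (hA : MeasurableSet A) (n : ℕ) :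
    MeasurableSet {s | count A s = n} :=
  measurable_count hA (measurableSet_singleton n)

lemma count_eq_zero {A : Set (E d)} {s : Finset (E d)} :
    count A s = 0 ↔ ∀ x ∈ s, x ∉ A := by
  simp [count_eq_card, Finset.eq_empty_iff_forall_notMem]

/-- Almost surely, the Poisson process has no point in a null set of its intensity. -/
lemma ae_poissonLaw_notMem [IsFiniteMeasure ν] {A : Set (E d)} (hA : MeasurableSet A) (h0 : ν A = 0) :
    ∀ᵐ s ∂poissonLaw ν, ∀ x ∈ s, x ∉ A := by
  simp only [← count_eq_zero]
  refine ae_poissonLaw_of_forall ν (measurableSet_count_eq hA 0) fun k => ?_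
  simp only [count_eq_zero, Finset.mem_image, Finset.mem_univ, true_and, forall_exists_index,
    forall_apply_eq_imp_iff]
  refine ae_all_iff.2 fun i => ?_
  have : ∀ᵐ x ∂ν, x ∉ A := measure_eq_zero_iff_ae_notMem.1 h0
  exact (Measure.tendsto_eval_ae_ae (μ := fun _ : Fin k => ν) (i := i)).eventually this

lemma poissonLaw_empty_ge : ENNReal.ofReal (Real.exp (-ν.real Set.univ)) ≤ poissonLaw ν {∅} := by
  have hm : MeasurableSet ({∅} : Set (Finset (E d))) := by
    convert measurableSet_count_eq (d := d) MeasurableSet.univ 0 using 1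
    ext s
    simp [count_eq_zero, Finset.eq_empty_iff_forall_notMem]
  rw [poissonLaw, Measure.sum_apply _ hm]
  refine le_trans (le_of_eq ?_) (ENNReal.le_tsum 0)
  rw [Measure.smul_apply, Measure.map_apply (measurable_image_config _) hm]
  simp [poissonWeight]

lemma poissonLaw_ne_empty_le [IsFiniteMeasure ν] : poissonLaw ν {∅}ᶜ ≤ ν Set.univ := by
  have hm : MeasurableSet ({∅} : Set (Finset (E d))) := by
    convert measurableSet_count_eq (d := d) MeasurableSet.univ 0 using 1
    ext s
    simp [count_eq_zero, Finset.eq_empty_iff_forall_notMem]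
  rw [prob_compl_eq_one_sub hm]
  refine (tsub_le_tsub_left (poissonLaw_empty_ge ν) 1).trans ?_
  rw [← ENNReal.ofReal_one, ← ENNReal.ofReal_sub _ (by positivity),
    ← ENNReal.ofReal_toReal (measure_ne_top ν Set.univ)]
  refine ENNReal.ofReal_le_ofReal ?_
  have := Real.add_one_le_exp (-ν.real Set.univ)
  simp only [Measure.real] at *
  linarith

lemma ae_pi_injective [IsFiniteMeasure ν] [NullSingletonClass ν] (k : ℕ) :
    ∀ᵐ x ∂(Measure.pi fun _ : Fin k => ν), Function.Injective x := by
  have h : ∀ i j : Fin k, i ≠ j → ∀ᵐ x ∂(Measure.pi fun _ : Fin k => ν), x i ≠ x j := by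
    intro i j hij
    obtain _ | k := k
    · exact i.elim0
    obtain ⟨j', rfl⟩ := Fin.exists_succAbove_eq hij.symm
    have hmp := measurePreserving_piFinSuccAbove (fun _ : Fin (k + 1) => ν) i
    have hT : MeasurableSet {p : E d × (Fin k → E d) | p.1 = p.2 j'} :=
      measurableSet_eq_fun measurable_fst ((measurable_pi_apply j').comp measurable_snd)
    have h0 : (ν.prod (Measure.pi fun _ : Fin k => ν)) {p | p.1 = p.2 j'} = 0 := by
      rw [Measure.prod_apply_symm hT]
      simp
    have h1 := hmp.quasiMeasurePreserving.preimage_null h0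
    rw [measure_eq_zero_iff_ae_notMem] at h1
    filter_upwards [h1] with x hx
    exact hx
  have h' : ∀ᵐ x ∂(Measure.pi fun _ : Fin k => ν), ∀ i j : Fin k, i ≠ j → x i ≠ x j := by
    simp only [ae_all_iff]
    exact h
  filter_upwards [h'] with x hx i j hij
  by_contra hne
  exact hx i j hne hij

end

lemma sum_eq_sum_count {g : E d → ℝ} (hfin : (Set.range g).Finite) (s : Finset (E d)) :
    ∑ x ∈ s, g x = ∑ c ∈ hfin.toFinset, c * (count (g ⁻¹' {c}) s : ℝ) := by
  simp only [count_eq_sum, Nat.cast_sum, Finset.mul_sum]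
  rw [Finset.sum_comm]
  refine Finset.sum_congr rfl fun x _ => ?_
  rw [Finset.sum_eq_single (g x)]
  · simp
  · intro c _ hc
    simp [Ne.symm hc]
  · simp

lemma measurable_sum_config {g : E d → ℝ} (hg : Measurable g) (hfin : (Set.range g).Finite) :
    Measurable fun s : Finset (E d) => ∑ x ∈ s, g x := by
  simp only [sum_eq_sum_count hfin]
  refine Finset.measurable_sum _ fun c _ => ?_
  exact (measurable_from_top.comp
    (measurable_count (hg (measurableSet_singleton c)))).const_mul c

/-- The exponential `exp(i ∑_{x ∈ s} g x)` whose expectation is the characteristic functional. -/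
noncomputable def expSum (g : E d → ℝ) (s : Finset (E d)) : ℂ :=
  Complex.exp (((∑ x ∈ s, g x : ℝ) : ℂ) * Complex.I)

lemma measurable_expSum {g : E d → ℝ} (hg : Measurable g) (hfin : (Set.range g).Finite) :
    Measurable (expSum g) :=
  Complex.measurable_exp.comp
    ((Complex.measurable_ofReal.comp (measurable_sum_config hg hfin)).mul_const _)

lemma norm_expSum (g : E d → ℝ) (s : Finset (E d)) : ‖expSum g s‖ = 1 :=
  Complex.norm_exp_ofReal_mul_I _

lemma integrable_expSum {g : E d → ℝ} (hg : Measurable g) (hfin : (Set.range g).Finite)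
    (μ : Measure (Finset (E d))) [IsFiniteMeasure μ] : Integrable (expSum g) μ :=
  Integrable.of_bound (measurable_expSum hg hfin).aestronglyMeasurable 1
    (Eventually.of_forall fun s => (norm_expSum g s).le)

/-- The law of a random finite configuration is determined by its characteristic functional. -/
theorem ext_of_integral_expSum {μ ν : Measure (Finset (E d))} [IsFiniteMeasure μ]
    [IsFiniteMeasure ν]
    (h : ∀ g : E d → ℝ, Measurable g → (Set.range g).Finite →
      ∫ s, expSum g s ∂μ = ∫ s, expSum g s ∂ν) : μ = ν := by
  let I := {A : Set (E d) // MeasurableSet A}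
  let m : I → MeasurableSpace (Finset (E d)) := fun A => MeasurableSpace.comap (count A.1) ⊤
  have key : ∀ t : Finset I, μ.map (fun s (A : t) => (count A.1.1 s : ℝ)) =
      ν.map (fun s (A : t) => (count A.1.1 s : ℝ)) := by
    intro t
    have hN : Measurable fun (s : Finset (E d)) (A : t) => (count A.1.1 s : ℝ) :=
      measurable_pi_lambda _ fun A => measurable_from_top.comp (measurable_count A.1.2)
    refine Measure.ext_of_charFunDual (funext fun L => ?_)
    rw [charFunDual_apply, charFunDual_apply]
    rw [integral_map hN.aemeasurable (by fun_prop), integral_map hN.aemeasurable (by fun_prop)]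
    let g : E d → ℝ := fun x => L fun A : t => if x ∈ A.1.1 then 1 else 0
    have hg0 : Measurable fun (x : E d) (A : t) => if x ∈ A.1.1 then (1 : ℝ) else 0 :=
      measurable_pi_lambda _ fun A => Measurable.ite A.1.2 measurable_const measurable_const
    have hfin0 : (Set.range fun (x : E d) (A : t) => if x ∈ A.1.1 then (1 : ℝ) else 0).Finite := by
      refine (Set.Finite.pi' (t := fun _ : t => ({0, 1} : Set ℝ)) fun _ => by simp).subset ?_
      rintro _ ⟨x, rfl⟩ A
      simp only
      split_ifs <;> simp
    have hfin : (Set.range g).Finite := by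
      refine (hfin0.image L).subset ?_
      rintro _ ⟨x, rfl⟩
      exact ⟨_, ⟨x, rfl⟩, rfl⟩
    have := h g (L.continuous.measurable.comp hg0) hfin
    have he : ∀ s : Finset (E d), L (fun A : t => (count A.1.1 s : ℝ)) = ∑ x ∈ s, g x := by
      intro s
      simp only [g, ← map_sum]
      congr 1
      ext A
      simp [count_eq_sum]
    simpa only [he, expSum] using this
  have huniv : μ Set.univ = ν Set.univ := by
    have := h (fun _ => 0) measurable_const (Set.finite_range_const)
    simpa [expSum, Measure.real, measure_ne_top, ENNReal.toReal_eq_toReal_iff'] using this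
  refine ext_of_generate_finite (piiUnionInter (fun A => {s | MeasurableSet[m A] s}) Set.univ)
    ?_ (isPiSystem_piiUnionInter _ (fun A => @MeasurableSpace.isPiSystem_measurableSet _ (m A)) _)
    ?_ huniv
  · rw [generateFrom_piiUnionInter_measurableSet m]
    change (⨆ (A : Set (E d)) (_ : MeasurableSet A),
      MeasurableSpace.comap (fun s : Finset (E d) => ((s : Set (E d)) ∩ A).ncard) ⊤) = _
    simp only [Set.mem_univ, iSup_pos, m, I, iSup_subtype]
    rfl
  · rintro _ ⟨t, -, f, hf, rfl⟩
    have hf' : ∀ A : I, ∃ B : Set ℕ, A ∈ t → count A.1 ⁻¹' B = f A := by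
      intro A
      by_cases hA : A ∈ t
      · obtain ⟨B, -, hB⟩ := hf A hA
        exact ⟨B, fun _ => hB⟩
      · exact ⟨∅, fun h => absurd h hA⟩
    choose B hB using hf'
    have hN : Measurable fun (s : Finset (E d)) (A : t) => (count A.1.1 s : ℝ) :=
      measurable_pi_lambda _ fun A => measurable_from_top.comp (measurable_count A.1.2)
    have hS : MeasurableSet (Set.univ.pi fun A : t => ((↑) : ℕ → ℝ) '' B A.1) :=
      MeasurableSet.univ_pi fun A => ((B A.1).to_countable.image _).measurableSet
    have heq : (⋂ A ∈ t, f A) = (fun (s : Finset (E d)) (A : t) => (count A.1.1 s : ℝ)) ⁻¹'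
        (Set.univ.pi fun A : t => ((↑) : ℕ → ℝ) '' B A.1) := by
      ext s
      simp only [Set.mem_iInter, Set.mem_preimage, Set.mem_univ_pi, Set.mem_image, Nat.cast_inj,
        exists_eq_right, Subtype.forall]
      refine forall₂_congr fun A hA => ?_
      rw [← hB A hA]
      rfl
    rw [heq, ← Measure.map_apply hN hS, ← Measure.map_apply hN hS, key t]

/-! ### Independence, superposition and thinning -/

lemma norm_cexp_mul_I (r : ℝ) : ‖Complex.exp (r * Complex.I)‖ = 1 :=
  Complex.norm_exp_ofReal_mul_I r

lemma integrable_cexp {g : E d → ℝ} (hg : Measurable g) (ν : Measure (E d)) [IsFiniteMeasure ν] :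
    Integrable (fun x => Complex.exp (g x * Complex.I)) ν :=
  Integrable.of_bound (by fun_prop) 1 (Eventually.of_forall fun x => (norm_cexp_mul_I _).le)

/-- The characteristic functional of the law of a Poisson process. -/
theorem integral_expSum_poissonLaw (ν : Measure (E d)) [IsFiniteMeasure ν] [NullSingletonClass ν]
    {g : E d → ℝ} (hg : Measurable g) (hfin : (Set.range g).Finite) :
    ∫ s, expSum g s ∂poissonLaw ν =
      Complex.exp (∫ x, (Complex.exp (g x * Complex.I) - 1) ∂ν) := by
  have h := hasSum_integral_measure (μ := fun k : ℕ => poissonWeight ν k •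
    (Measure.pi fun _ : Fin k => ν).map fun x => Finset.univ.image x)
    (integrable_expSum hg hfin (poissonLaw ν))
  rw [← poissonLaw] at h
  refine h.unique ?_
  set z : ℂ := ∫ x, Complex.exp (g x * Complex.I) ∂ν with hz
  have hk : ∀ k : ℕ, ∫ s, expSum g s ∂(poissonWeight ν k •
      (Measure.pi fun _ : Fin k => ν).map fun x => Finset.univ.image x) =
      Complex.exp (-(ν.real Set.univ : ℂ)) * (z ^ k / k.factorial) := by
    intro k
    rw [integral_smul_measure, integral_map (measurable_image_config _).aemeasurable
      (measurable_expSum hg hfin).aestronglyMeasurable]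
    have : ∫ x, expSum g (Finset.univ.image x) ∂(Measure.pi fun _ : Fin k => ν) = z ^ k := by
      rw [hz, ← Fintype.card_fin k, ← integral_fintype_prod_eq_pow, Fintype.card_fin]
      refine integral_congr_ae ?_
      filter_upwards [ae_pi_injective ν k] with x hx
      rw [expSum, Finset.sum_image hx.injOn, ← Complex.exp_sum, Complex.ofReal_sum,
        Finset.sum_mul]
    rw [this, poissonWeight, ENNReal.toReal_ofReal (by positivity), Complex.real_smul]
    push_cast
    ring
  simp only [hk]
  have hint : ∫ x, (Complex.exp (g x * Complex.I) - 1) ∂ν = z - ν.real Set.univ := by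
    rw [integral_sub (integrable_cexp hg ν) (integrable_const _)]
    simp [hz]
  rw [hint, sub_eq_add_neg, add_comm, Complex.exp_add]
  have := NormedSpace.expSeries_div_hasSum_exp z
  rw [← Complex.exp_eq_exp_ℂ] at this
  exact this.mul_left _

lemma integrable_cexp_sub_one {g : E d → ℝ} (hg : Measurable g) (ν : Measure (E d))
    [IsFiniteMeasure ν] : Integrable (fun x => Complex.exp (g x * Complex.I) - 1) ν :=
  (integrable_cexp hg ν).sub (integrable_const _)

lemma ae_poissonLaw_disjoint (ν : Measure (E d)) [IsFiniteMeasure ν] [NullSingletonClass ν]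
    (s : Finset (E d)) : ∀ᵐ t ∂poissonLaw ν, Disjoint s t := by
  filter_upwards [ae_poissonLaw_notMem ν s.measurableSet (s.finite_toSet.measure_zero ν)] with t ht
  exact Finset.disjoint_right.2 fun x hx hs => ht x hx hs

lemma measurable_expSum_union {g : E d → ℝ} (hg : Measurable g) (hfin : (Set.range g).Finite) :
    Measurable fun p : Finset (E d) × Finset (E d) => expSum g (p.1 ∪ p.2) :=
  (measurable_expSum hg hfin).comp measurable_union_config

/-- The superposition of independent Poisson processes is a Poisson process. -/
theorem map_union_poissonLaw (α β : Measure (E d)) [IsFiniteMeasure α] [IsFiniteMeasure β]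
    [NullSingletonClass α] [NullSingletonClass β] :
    ((poissonLaw α).prod (poissonLaw β)).map (fun p => p.1 ∪ p.2) = poissonLaw (α + β) := by
  have : NullSingletonClass (α + β) := ⟨fun x => by simp⟩
  have : IsProbabilityMeasure (((poissonLaw α).prod (poissonLaw β)).map (fun p => p.1 ∪ p.2)) :=
    Measure.isProbabilityMeasure_map measurable_union_config.aemeasurable
  refine ext_of_integral_expSum fun g hg hfin => ?_
  rw [integral_map measurable_union_config.aemeasurable
    (measurable_expSum hg hfin).aestronglyMeasurable, integral_expSum_poissonLaw _ hg hfin,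
    integral_add_measure (integrable_cexp_sub_one hg α) (integrable_cexp_sub_one hg β),
    Complex.exp_add, ← integral_expSum_poissonLaw α hg hfin,
    ← integral_expSum_poissonLaw β hg hfin, ← integral_prod_mul,
    integral_prod _ (Integrable.of_bound (measurable_expSum_union hg hfin).aestronglyMeasurable 1
      (Eventually.of_forall fun p => (norm_expSum _ _).le)), integral_prod]
  · refine integral_congr_ae (Eventually.of_forall fun s => integral_congr_ae ?_)
    filter_upwards [ae_poissonLaw_disjoint β s] with t ht
    simp only [expSum, Finset.sum_union ht, ← Complex.exp_add, ← add_mul]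
    push_cast
    rfl
  · exact (integrable_expSum hg hfin _).mul_prod (integrable_expSum hg hfin _)

lemma sum_restr (A : Set (E d)) (g : E d → ℝ) (s : Finset (E d)) :
    ∑ x ∈ restr A s, g x = ∑ x ∈ s, A.indicator g x := by
  rw [restr, Finset.sum_filter]
  exact Finset.sum_congr rfl fun x _ => by simp [Set.indicator_apply]

lemma finite_range_indicator {g : E d → ℝ} (hfin : (Set.range g).Finite) (A : Set (E d)) :
    (Set.range (A.indicator g)).Finite :=
  (hfin.insert 0).subset (by
    rintro _ ⟨x, rfl⟩
    by_cases hx : x ∈ A <;> simp [hx])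

/-- The restriction of a Poisson process is a Poisson process. -/
theorem map_restr_poissonLaw (ν : Measure (E d)) [IsFiniteMeasure ν] [NullSingletonClass ν]
    {A : Set (E d)} (hA : MeasurableSet A) :
    (poissonLaw ν).map (restr A) = poissonLaw (ν.restrict A) := by
  have : IsProbabilityMeasure ((poissonLaw ν).map (restr A)) :=
    Measure.isProbabilityMeasure_map (measurable_restr hA).aemeasurable
  refine ext_of_integral_expSum fun g hg hfin => ?_
  rw [integral_map (measurable_restr hA).aemeasurable
    (measurable_expSum hg hfin).aestronglyMeasurable, integral_expSum_poissonLaw _ hg hfin]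
  have : ∀ s, expSum g (restr A s) = expSum (A.indicator g) s := by
    intro s
    rw [expSum, sum_restr, expSum]
  simp only [this]
  rw [integral_expSum_poissonLaw _ (hg.indicator hA) (finite_range_indicator hfin A),
    ← integral_indicator hA]
  congr 2
  ext x
  by_cases hx : x ∈ A
  · simp [hx]
  · rw [Set.indicator_of_notMem hx, Set.indicator_of_notMem hx]
    simp

lemma ae_poissonLaw_restrict_mem (ν : Measure (E d)) [IsFiniteMeasure ν]
    {A : Set (E d)} (hA : MeasurableSet A) :
    ∀ᵐ s ∂poissonLaw (ν.restrict A), ∀ x ∈ s, x ∈ A := by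
  filter_upwards [ae_poissonLaw_notMem (ν.restrict A) hA.compl
    (by rw [Measure.restrict_apply hA.compl, Set.compl_inter_self, measure_empty])] with s hs x hx
  simpa using hs x hx

/-- The restrictions of a Poisson process to `A` and to its complement are independent. -/
theorem map_restr_prod_poissonLaw (ν : Measure (E d)) [IsFiniteMeasure ν] [NullSingletonClass ν]
    {A : Set (E d)} (hA : MeasurableSet A) :
    (poissonLaw ν).map (fun s => (restr A s, restr Aᶜ s)) =
      (poissonLaw (ν.restrict A)).prod (poissonLaw (ν.restrict Aᶜ)) := by
  have hm : Measurable fun s : Finset (E d) => (restr A s, restr Aᶜ s) :=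
    (measurable_restr hA).prodMk (measurable_restr hA.compl)
  nth_rw 1 [← Measure.restrict_add_restrict_compl (μ := ν) hA]
  rw [← map_union_poissonLaw, Measure.map_map hm measurable_union_config]
  conv_rhs => rw [← Measure.map_id (μ := (poissonLaw (ν.restrict A)).prod _)]
  refine Measure.map_congr ?_
  have h1 := Measure.quasiMeasurePreserving_fst (μ := poissonLaw (ν.restrict A))
    (ν := poissonLaw (ν.restrict Aᶜ)) |>.ae (ae_poissonLaw_restrict_mem ν hA)
  have h2 := Measure.quasiMeasurePreserving_snd (μ := poissonLaw (ν.restrict A))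
    (ν := poissonLaw (ν.restrict Aᶜ)) |>.ae (ae_poissonLaw_restrict_mem ν hA.compl)
  filter_upwards [h1, h2] with p hp1 hp2
  ext x
  · simp only [Function.comp_apply, mem_restr, Finset.mem_union, id]
    exact ⟨fun h => h.1.resolve_right fun h' => hp2 x h' h.2, fun h => ⟨Or.inl h, hp1 x h⟩⟩
  · simp only [Function.comp_apply, mem_restr, Finset.mem_union, id]
    exact ⟨fun h => h.1.resolve_left fun h' => h.2 (hp1 x h'), fun h => ⟨Or.inr h, hp2 x h⟩⟩

/-- The restrictions of a Poisson process to disjoint sets are independent. -/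
theorem indepFun_restr (ν : Measure (E d)) [IsFiniteMeasure ν] [NullSingletonClass ν]
    {A B : Set (E d)} (hA : MeasurableSet A) (hB : MeasurableSet B) (hAB : Disjoint A B) :
    IndepFun (restr A) (restr B) (poissonLaw ν) := by
  have h : IndepFun (restr A) (restr Aᶜ) (poissonLaw ν) := by
    rw [indepFun_iff_map_prod_eq_prod_map_map (measurable_restr hA).aemeasurable
      (measurable_restr hA.compl).aemeasurable, map_restr_prod_poissonLaw ν hA,
      map_restr_poissonLaw ν hA, map_restr_poissonLaw ν hA.compl]
  have h2 := h.comp measurable_id (measurable_restr hB)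
  have e : restr B ∘ restr Aᶜ = restr B := by
    ext s x
    simp only [mem_restr, Function.comp_apply, Set.mem_compl_iff]
    exact ⟨fun h => ⟨h.1.1, h.2⟩, fun h => ⟨⟨h.1, fun h' => hAB.le_bot ⟨h', h.2⟩⟩, h.2⟩⟩
  rwa [e] at h2

/-- The translate of a Poisson process is a Poisson process. -/
theorem map_translate_poissonLaw (ν : Measure (E d)) [IsFiniteMeasure ν] [NullSingletonClass ν]
    (y : E d) : (poissonLaw ν).map (translate y) = poissonLaw (ν.map (y + ·)) := by
  have : IsProbabilityMeasure ((poissonLaw ν).map (translate y)) :=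
    Measure.isProbabilityMeasure_map (measurable_translate y).aemeasurable
  have : NullSingletonClass (ν.map (y + ·)) := ⟨fun x => by
    rw [Measure.map_apply (measurable_const_add y) (measurableSet_singleton x)]
    have : (fun z => y + z) ⁻¹' {x} = {x - y} := by
      ext z; simp only [Set.mem_preimage, Set.mem_singleton_iff, eq_sub_iff_add_eq, add_comm]
    rw [this, measure_singleton]⟩
  refine ext_of_integral_expSum fun g hg hfin => ?_
  rw [integral_map (measurable_translate y).aemeasurable
    (measurable_expSum hg hfin).aestronglyMeasurable, integral_expSum_poissonLaw _ hg hfin,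
    integral_map (by fun_prop) (by fun_prop)]
  have : ∀ s, expSum g (translate y s) = expSum (fun x => g (y + x)) s := by
    intro s
    rw [expSum, translate, Finset.sum_map, expSum]
    rfl
  simp only [this]
  rw [integral_expSum_poissonLaw _ (by fun_prop)]
  exact hfin.subset (by rintro _ ⟨x, rfl⟩; exact ⟨_, rfl⟩)

section TotalVariation

lemma measurableSet_singleton_empty : MeasurableSet ({∅} : Set (Finset (E d))) := by
  convert measurableSet_count_eq (d := d) MeasurableSet.univ 0 using 1
  ext s
  simp [count_eq_zero, Finset.eq_empty_iff_forall_notMem]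

lemma lintegral_const_indicator_le (β : Measure (E d)) [IsFiniteMeasure β] (M : ℝ≥0∞) :
    ∫⁻ t, ({∅}ᶜ : Set (Finset (E d))).indicator (fun _ => M) t ∂poissonLaw β ≤
      M * β Set.univ := by
  rw [lintegral_indicator_const measurableSet_singleton_empty.compl]
  gcongr
  exact poissonLaw_ne_empty_le β

variable (α β : Measure (E d)) [IsFiniteMeasure α] [IsFiniteMeasure β]
    [NullSingletonClass α] [NullSingletonClass β]

lemma lintegral_poissonLaw_add {Φ : Finset (E d) → ℝ≥0∞} (hΦ : Measurable Φ) :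
    ∫⁻ s, Φ s ∂poissonLaw (α + β) =
      ∫⁻ s, ∫⁻ t, Φ (s ∪ t) ∂poissonLaw β ∂poissonLaw α := by
  rw [← map_union_poissonLaw, lintegral_map hΦ measurable_union_config,
    lintegral_prod (fun p : Finset (E d) × Finset (E d) => Φ (p.1 ∪ p.2))
      (hΦ.comp measurable_union_config).aemeasurable]

lemma lintegral_poissonLaw_add_le {Φ : Finset (E d) → ℝ≥0∞} (hΦ : Measurable Φ) {M : ℝ≥0∞}
    (hM : ∀ s, Φ s ≤ M) :
    ∫⁻ s, Φ s ∂poissonLaw (α + β) ≤ ∫⁻ s, Φ s ∂poissonLaw α + M * β Set.univ := by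
  rw [lintegral_poissonLaw_add α β hΦ]
  calc _ ≤ ∫⁻ s, (Φ s + M * β Set.univ) ∂poissonLaw α := by
        refine lintegral_mono fun s => ?_
        calc _ ≤ ∫⁻ t, (Φ s + ({∅}ᶜ : Set (Finset (E d))).indicator (fun _ => M) t)
              ∂poissonLaw β := by
              refine lintegral_mono fun t => ?_
              by_cases ht : t = ∅
              · simp [ht]
              · simpa [ht] using le_add_left (hM _)
          _ ≤ _ := by
              rw [lintegral_add_left measurable_const]
              rw [lintegral_const, measure_univ, mul_one]
              gcongr
              exact lintegral_const_indicator_le β M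
    _ = _ := by rw [lintegral_add_left hΦ]; simp

lemma lintegral_poissonLaw_le_add {Φ : Finset (E d) → ℝ≥0∞} (hΦ : Measurable Φ) {M : ℝ≥0∞}
    (hM : ∀ s, Φ s ≤ M) :
    ∫⁻ s, Φ s ∂poissonLaw α ≤ ∫⁻ s, Φ s ∂poissonLaw (α + β) + M * β Set.univ := by
  have hmi : Measurable (({∅}ᶜ : Set (Finset (E d))).indicator (fun _ => M)) :=
    measurable_const.indicator measurableSet_singleton_empty.compl
  rw [lintegral_poissonLaw_add α β hΦ]
  calc ∫⁻ s, Φ s ∂poissonLaw α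
      = ∫⁻ s, ∫⁻ _, Φ s ∂poissonLaw β ∂poissonLaw α := by simp
    _ ≤ ∫⁻ s, ((∫⁻ t, Φ (s ∪ t) ∂poissonLaw β) + M * β Set.univ) ∂poissonLaw α := by
        refine lintegral_mono fun s => ?_
        calc _ ≤ ∫⁻ t, (Φ (s ∪ t) + ({∅}ᶜ : Set (Finset (E d))).indicator (fun _ => M) t)
              ∂poissonLaw β := by
              refine lintegral_mono fun t => ?_
              by_cases ht : t = ∅
              · simp [ht]
              · simpa [ht] using le_add_left (hM _)
          _ ≤ _ := by
              rw [lintegral_add_right _ hmi]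
              gcongr
              exact lintegral_const_indicator_le β M
    _ = _ := by rw [lintegral_add_right _ measurable_const]; simp

end TotalVariation

/-- The measure with density `g`. -/
noncomputable abbrev intensity (g : E d → ℝ≥0) : Measure (E d) :=
  volume.withDensity fun x => (g x : ℝ≥0∞)

/-- Two Poisson processes on `A` whose intensity functions are close in `L^1(A)` have laws that
are close in total variation: split off the process whose intensity is the minimum of both. -/
theorem lintegral_poissonLaw_le_of_density [NullSingletonClass (volume : Measure (E d))]
    {g₁ g₂ : E d → ℝ≥0} (hg₁ : Measurable g₁)
    (hg₂ : Measurable g₂) {A : Set (E d)} (hA : MeasurableSet A)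
    [IsFiniteMeasure ((intensity g₁).restrict A)] [IsFiniteMeasure ((intensity g₂).restrict A)]
    {Φ : Finset (E d) → ℝ≥0∞} (hΦ : Measurable Φ) {M : ℝ≥0∞} (hM : ∀ s, Φ s ≤ M) :
    ∫⁻ s, Φ s ∂poissonLaw ((intensity g₁).restrict A) ≤
      ∫⁻ s, Φ s ∂poissonLaw ((intensity g₂).restrict A) + M * ∫⁻ x in A, edist (g₁ x) (g₂ x) := by
  have split : ∀ {h₁ h₂ : E d → ℝ≥0}, Measurable h₁ → Measurable h₂ →
      (intensity h₁).restrict A = (intensity fun x => min (h₁ x) (h₂ x)).restrict A +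
        (intensity fun x => h₁ x - h₂ x).restrict A := by
    intro h₁ h₂ m₁ m₂
    rw [← Measure.restrict_add, ← withDensity_add_left (by fun_prop)]
    congr 2
    ext x
    refine congrArg _ ?_
    simp only
    rcases le_total (h₁ x) (h₂ x) with h | h
    · simp [h, tsub_eq_zero_of_le h]
    · simp [h]
  have s1 := split hg₁ hg₂
  have s2 := split hg₂ hg₁
  simp only [min_comm (g₂ _)] at s2
  set γ := (intensity fun x => min (g₁ x) (g₂ x)).restrict A with hγ
  set δ₁ := (intensity fun x => g₁ x - g₂ x).restrict A with hδ₁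
  set δ₂ := (intensity fun x => g₂ x - g₁ x).restrict A with hδ₂
  have : IsFiniteMeasure γ := isFiniteMeasure_of_le _ (s1 ▸ Measure.le_add_right le_rfl)
  have : IsFiniteMeasure δ₁ := isFiniteMeasure_of_le _ (s1 ▸ Measure.le_add_left le_rfl)
  have : IsFiniteMeasure δ₂ := isFiniteMeasure_of_le _ (s2 ▸ Measure.le_add_left le_rfl)
  have e : ∫⁻ x in A, edist (g₁ x) (g₂ x) = δ₂ Set.univ + δ₁ Set.univ := by
    rw [hδ₁, hδ₂, Measure.restrict_apply_univ, Measure.restrict_apply_univ, withDensity_apply _ hA,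
      withDensity_apply _ hA, ← lintegral_add_left (by fun_prop)]
    refine lintegral_congr fun x => ?_
    rw [edist_nndist, ← ENNReal.coe_add, NNReal.nndist_eq]
    congr 1
    rcases le_total (g₁ x) (g₂ x) with h | h
    · simp [tsub_eq_zero_of_le h]
    · simp [tsub_eq_zero_of_le h]
  calc _ ≤ ∫⁻ s, Φ s ∂poissonLaw γ + M * δ₁ Set.univ := by
        rw [s1]; exact lintegral_poissonLaw_add_le γ δ₁ hΦ hM
    _ ≤ (∫⁻ s, Φ s ∂poissonLaw ((intensity g₂).restrict A) + M * δ₂ Set.univ) +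
        M * δ₁ Set.univ := by
        rw [s2]; gcongr; exact lintegral_poissonLaw_le_add γ δ₂ hΦ hM
    _ = _ := by rw [e, mul_add, add_assoc]

/-! ### From point processes to Poisson laws -/

instance [NeZero d] : NullSingletonClass (volume : Measure (E d)) := by
  have : Nontrivial (E d) := inferInstance
  infer_instance

section
variable {Ω : Type*} [MeasurableSpace Ω] {P : Ω → Set (E d)} {f : E d → ℝ≥0} {μ : Measure Ω}

lemma IsPoissonProcess.isFiniteMeasure (hP : IsPoissonProcess P f μ) {B : Set (E d)}
    (hB : Bornology.IsBounded B) (hBm : MeasurableSet B) :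
    IsFiniteMeasure ((intensity f).restrict B) :=
  ⟨by
    rw [Measure.restrict_apply_univ, withDensity_apply _ hBm]
    exact (hP.intensity_ne_top B hB).lt_top⟩

/-- The finite configuration of the points of a Poisson process in a bounded set. -/
noncomputable def window (hP : IsPoissonProcess P f μ) {B : Set (E d)}
    (hB : Bornology.IsBounded B) (ω : Ω) : Finset (E d) :=
  (hP.locallyFinite ω B hB).toFinset

lemma coe_window (hP : IsPoissonProcess P f μ) {B : Set (E d)}
    (hB : Bornology.IsBounded B) (ω : Ω) : (window hP hB ω : Set (E d)) = P ω ∩ B := by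
  simp [window]

lemma count_window (hP : IsPoissonProcess P f μ) {B : Set (E d)}
    (hB : Bornology.IsBounded B) (A : Set (E d)) (ω : Ω) :
    count A (window hP hB ω) = (P ω ∩ (B ∩ A)).ncard := by
  rw [count, coe_window, Set.inter_assoc]

lemma measurable_window (hP : IsPoissonProcess P f μ) {B : Set (E d)}
    (hB : Bornology.IsBounded B) (hBm : MeasurableSet B) : Measurable (window hP hB) :=
  measurable_config_iff.2 fun A hA => by
    simp only [count_window]
    exact hP.measurable_count _ (hBm.inter hA) (hB.subset Set.inter_subset_left)

lemma integral_cexp_sub_one_eq_sum {g : E d → ℝ} (hg : Measurable g)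
    (hfin : (Set.range g).Finite) (ν : Measure (E d)) [IsFiniteMeasure ν] :
    ∫ x, (Complex.exp (g x * Complex.I) - 1) ∂ν =
      ∑ c ∈ hfin.toFinset, (ν.real (g ⁻¹' {c}) : ℂ) * (Complex.exp (c * Complex.I) - 1) := by
  have h : ∀ x, Complex.exp (g x * Complex.I) - 1 = ∑ c ∈ hfin.toFinset,
      (g ⁻¹' {c}).indicator (fun _ => Complex.exp (c * Complex.I) - 1) x := by
    intro x
    rw [Finset.sum_eq_single (g x)]
    · simp
    · intro c _ hc
      simp [Ne.symm hc]
    · simp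
  simp only [h]
  rw [integral_finsetSum _ fun c _ => (integrable_const _).indicator
    (hg (measurableSet_singleton c))]
  refine Finset.sum_congr rfl fun c _ => ?_
  rw [integral_indicator_const _ (hg (measurableSet_singleton c)), Complex.real_smul]

/-- The law of a Poisson process in a bounded window. -/
theorem map_window [NeZero d] [IsProbabilityMeasure μ] (hP : IsPoissonProcess P f μ) {B : Set (E d)}
    (hB : Bornology.IsBounded B) (hBm : MeasurableSet B) :
    μ.map (window hP hB) = poissonLaw ((intensity f).restrict B) := by
  have := hP.isFiniteMeasure hB hBm
  have : IsProbabilityMeasure (μ.map (window hP hB)) :=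
    Measure.isProbabilityMeasure_map (measurable_window hP hB hBm).aemeasurable
  refine ext_of_integral_expSum fun g hg hfin => ?_
  rw [integral_map (measurable_window hP hB hBm).aemeasurable
    (measurable_expSum hg hfin).aestronglyMeasurable, integral_expSum_poissonLaw _ hg hfin,
    integral_cexp_sub_one_eq_sum hg hfin, Complex.exp_sum]
  let e := hfin.toFinset.equivFin
  have hbd : ∀ c : ℝ, Bornology.IsBounded (B ∩ g ⁻¹' {c}) := fun c => hB.subset Set.inter_subset_left
  have hms : ∀ c : ℝ, MeasurableSet (B ∩ g ⁻¹' {c}) := fun c => hBm.inter (hg (measurableSet_singleton c))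
  have hind := hP.indep_count hfin.toFinset.card (fun i => B ∩ g ⁻¹' {(e.symm i : ℝ)})
    (fun i => hms _) (fun i => hbd _) (by
      intro i j hij
      refine Set.disjoint_left.2 fun x hx hx' => hij ?_
      have h : (e.symm i : ℝ) = e.symm j := hx.2.symm.trans hx'.2
      exact e.symm.injective (Subtype.ext h))
  have hprod := hind.integral_fun_prod_comp (𝕜 := ℂ)
    (f := fun i (n : ℕ) => Complex.exp ((((e.symm i : ℝ) * n : ℝ) : ℂ) * Complex.I))
    (fun i => (hP.measurable_count _ (hms _) (hbd _)).aemeasurable)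
    (fun i => (measurable_from_top).aestronglyMeasurable)
  calc ∫ ω, expSum g (window hP hB ω) ∂μ
      = ∫ ω, ∏ i, Complex.exp ((((e.symm i : ℝ) *
          ((P ω ∩ (B ∩ g ⁻¹' {(e.symm i : ℝ)})).ncard : ℕ) : ℝ) : ℂ) * Complex.I) ∂μ := by
        refine integral_congr_ae (Eventually.of_forall fun ω => ?_)
        simp only
        rw [expSum, sum_eq_sum_count hfin, ← Complex.exp_sum, Complex.ofReal_sum, Finset.sum_mul]
        congr 1
        rw [← Finset.sum_coe_sort hfin.toFinset (fun c =>
          ((c * (count (g ⁻¹' {c}) (window hP hB ω) : ℝ) : ℝ) : ℂ) * Complex.I),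
          ← e.symm.sum_comp]
        simp only [count_window]
    _ = _ := by
        rw [hprod, ← Finset.prod_coe_sort hfin.toFinset (fun c => Complex.exp
          ((((intensity f).restrict B).real (g ⁻¹' {c}) : ℂ) * (Complex.exp (c * Complex.I) - 1))),
          ← e.symm.prod_comp]
        refine Finset.prod_congr rfl fun i _ => ?_
        set c : ℝ := (e.symm i : ℝ)
        have hc := charFun_map_cast_poissonMeasure (∫⁻ x in B ∩ g ⁻¹' {c}, (f x : ℝ≥0∞)).toNNReal c
        rw [← hP.map_count _ (hms c) (hbd c), Measure.map_map measurable_from_top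
          (hP.measurable_count _ (hms c) (hbd c)), charFun_apply_real, integral_map
          (measurable_from_top.comp (hP.measurable_count _ (hms c) (hbd c))).aemeasurable
          (by fun_prop)] at hc
        have hr : ((intensity f).restrict B).real (g ⁻¹' {c}) =
            ((∫⁻ x in B ∩ g ⁻¹' {c}, (f x : ℝ≥0∞)).toNNReal : ℝ) := by
          rw [Measure.real, Measure.restrict_apply (hg (measurableSet_singleton c)),
            withDensity_apply _ ((hg (measurableSet_singleton c)).inter hBm), Set.inter_comm]
          rfl
        rw [hr, ← hc]
        simp

lemma val_coe (H : Finset (E d) → ℝ) (s : Finset (E d)) : val H (s : Set (E d)) = H s := by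
  simp [val]

lemma val_inter (hP : IsPoissonProcess P f μ) {B : Set (E d)}
    (hB : Bornology.IsBounded B) (H : Finset (E d) → ℝ) (ω : Ω) :
    val H (P ω ∩ B) = H (window hP hB ω) := by
  rw [← coe_window hP hB, val_coe]

/-- The add one cost on finite configurations. -/
noncomputable def cost (H : Finset (E d) → ℝ) (y : E d) (s : Finset (E d)) : ℝ :=
  H (insert y s) - H s

lemma addOneCost_coe (H : Finset (E d) → ℝ) (y : E d) (s : Finset (E d)) :
    addOneCost H y (s : Set (E d)) = cost H y s := by
  have : (s : Set (E d)) ∪ {y} = ((insert y s : Finset (E d)) : Set (E d)) := by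
    ext; simp
  rw [addOneCost, this, val_coe, val_coe, cost]

lemma addOneCost_inter (hP : IsPoissonProcess P f μ) {B : Set (E d)}
    (hB : Bornology.IsBounded B) (H : Finset (E d) → ℝ) (y : E d) (ω : Ω) :
    addOneCost H y (P ω ∩ B) = cost H y (window hP hB ω) := by
  rw [← coe_window hP hB, addOneCost_coe]

end

/-- The change of variables formula for a dilation. -/
lemma lintegral_comp_inv_smul {c : ℝ} (hc : 0 < c) {φ : E d → ℝ≥0∞} (hφ : Measurable φ) :
    ∫⁻ x, φ (c⁻¹ • x) = ENNReal.ofReal (c ^ d) * ∫⁻ x, φ x := by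
  rw [← lintegral_map hφ (measurable_const_smul c⁻¹),
    Measure.map_addHaar_smul volume (inv_ne_zero hc.ne'), lintegral_smul_measure,
    finrank_euclideanSpace_fin, inv_pow, inv_inv, abs_of_pos (by positivity), smul_eq_mul]

/-- The image of a Poisson process under a dilation is a Poisson process. -/
theorem isPoissonProcess_scaled (hd : d ≠ 0) {Ω : Type*} [MeasurableSpace Ω] {Q : Ω → Set (E d)}
    {f : E d → ℝ≥0} {μ : Measure Ω} {n : ℕ} (hn : 1 ≤ n) (hf : Measurable f)
    (hQ : IsPoissonProcess Q (fun x => (n : ℝ≥0) * f x) μ) :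
    IsPoissonProcess (scaled n Q) (fun x => f (((n : ℝ) ^ ((1 : ℝ) / d))⁻¹ • x)) μ := by
  set c : ℝ := (n : ℝ) ^ ((1 : ℝ) / d) with hc
  have hc0 : 0 < c := Real.rpow_pos_of_pos (by exact_mod_cast hn) _
  have hcd : c ^ d = n := by
    rw [hc, one_div, Real.rpow_inv_natCast_pow (by positivity) hd]
  have hset : ∀ (ω : Ω) (A : Set (E d)), scaled n Q ω ∩ A = c • (Q ω ∩ c⁻¹ • A) := by
    intro ω A
    rw [Set.smul_set_inter₀ hc0.ne', smul_inv_smul₀ hc0.ne']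
    rfl
  have hcard : ∀ (ω : Ω) (A : Set (E d)),
      (scaled n Q ω ∩ A).ncard = (Q ω ∩ c⁻¹ • A).ncard := by
    intro ω A
    rw [hset]
    exact Set.ncard_image_of_injective _ (smul_right_injective _ hc0.ne')
  have hbd : ∀ A : Set (E d), Bornology.IsBounded A → Bornology.IsBounded (c⁻¹ • A) :=
    fun A hA => hA.smul₀ _
  have hms : ∀ A : Set (E d), MeasurableSet A → MeasurableSet (c⁻¹ • A) :=
    fun A hA => hA.const_smul₀ _
  have hint : ∀ A : Set (E d), MeasurableSet A → ∫⁻ x in A, (f (c⁻¹ • x) : ℝ≥0∞) =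
      ∫⁻ x in c⁻¹ • A, (((n : ℝ≥0) * f x : ℝ≥0) : ℝ≥0∞) := by
    intro A hA
    have e1 : ∫⁻ x in A, (f (c⁻¹ • x) : ℝ≥0∞) =
        ∫⁻ x, (c⁻¹ • A).indicator (fun x => (f x : ℝ≥0∞)) (c⁻¹ • x) := by
      rw [← lintegral_indicator hA]
      refine lintegral_congr fun x => ?_
      by_cases hx : x ∈ A
      · rw [Set.indicator_of_mem hx, Set.indicator_of_mem (Set.smul_mem_smul_set hx)]
      · rw [Set.indicator_of_notMem hx, Set.indicator_of_notMem]
        rwa [Set.smul_mem_smul_set_iff₀ (inv_ne_zero hc0.ne')]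
    rw [e1, lintegral_comp_inv_smul hc0 (hf.coe_nnreal_ennreal.indicator (hms A hA)),
      lintegral_indicator (hms A hA)]
    simp only [ENNReal.coe_mul]
    rw [lintegral_const_mul _ hf.coe_nnreal_ennreal, hcd]
    simp
  refine ⟨?_, ?_, ?_, ?_, ?_⟩
  · intro ω A hA
    rw [hset]
    exact (hQ.locallyFinite ω _ (hbd A hA)).smul_set
  · intro A hA hAb
    simp only [hcard]
    exact hQ.measurable_count _ (hms A hA) (hbd A hAb)
  · intro A hA
    obtain ⟨r, hr⟩ := hA.subset_closedBall 0
    refine ne_top_of_le_ne_top ?_ (lintegral_mono_set hr)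
    rw [hint _ Metric.isClosed_closedBall.measurableSet]
    exact hQ.intensity_ne_top _ (hbd _ Metric.isBounded_closedBall)
  · intro A hA hAb
    simp only [hcard]
    rw [hQ.map_count _ (hms A hA) (hbd A hAb), hint A hA]
  · intro k A hA hAb hdis
    simp only [hcard]
    refine hQ.indep_count k _ (fun i => hms _ (hA i)) (fun i => hbd _ (hAb i)) ?_
    intro i j hij
    exact (Set.disjoint_image_iff (smul_right_injective _ (inv_ne_zero hc0.ne'))).2 (hdis hij)

/-! ### The Poincaré inequality -/

section Variance

variable {X : Type*} [MeasurableSpace X] {μ : Measure X} [IsProbabilityMeasure μ]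

lemma lintegral_enorm_sub_sq {F : X → ℝ} (hF : MemLp F 2 μ) (c : ℝ) :
    ∫⁻ x, ‖F x - c‖ₑ ^ 2 ∂μ = evariance F μ + ‖(∫ x, F x ∂μ) - c‖ₑ ^ 2 := by
  have hFc : MemLp (fun x => F x - c) 2 μ := hF.sub (memLp_const c)
  have hi : Integrable F μ := hF.integrable (by norm_num)
  have h1 : Var[fun x => F x - c; μ] = Var[F; μ] := variance_sub_const hF.1 c
  rw [variance_eq_sub hFc, integral_sub hi (integrable_const c), integral_const] at h1
  have e : ∀ r : ℝ, ‖r‖ₑ ^ 2 = ENNReal.ofReal (r ^ 2) := by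
    intro r
    rw [Real.enorm_eq_ofReal_abs, ← ENNReal.ofReal_pow (abs_nonneg r), sq_abs]
  simp only [e]
  rw [← ofReal_variance hF, ← ENNReal.ofReal_add (variance_nonneg _ _) (sq_nonneg _),
    ← ofReal_integral_eq_lintegral_ofReal hFc.integrable_sq
      (Eventually.of_forall fun x => sq_nonneg _)]
  congr 1
  simp only [probReal_univ, one_smul] at h1
  rw [← h1]
  simp only [Pi.pow_apply]
  ring

lemma evariance_le_lintegral_sub_sq {F : X → ℝ} (hF : MemLp F 2 μ) (c : ℝ) :
    evariance F μ ≤ ∫⁻ x, ‖F x - c‖ₑ ^ 2 ∂μ := by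
  rw [lintegral_enorm_sub_sq hF c]
  exact le_self_add

lemma enorm_integral_sq_le {F : X → ℝ} (hF : MemLp F 2 μ) :
    ‖∫ x, F x ∂μ‖ₑ ^ 2 ≤ ∫⁻ x, ‖F x‖ₑ ^ 2 ∂μ := by
  have := lintegral_enorm_sub_sq hF 0
  simp only [sub_zero] at this
  rw [this]
  exact le_add_self

/-- Tensorization of the variance (the Efron-Stein inequality for two variables). -/
theorem evariance_prod_le {Y : Type*} [MeasurableSpace Y] {ν : Measure Y} [IsProbabilityMeasure ν]
    {G : X × Y → ℝ} (hG : Measurable G) {B : ℝ} (hB : ∀ p, ‖G p‖ ≤ B) :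
    evariance G (μ.prod ν) ≤
      (∫⁻ y, evariance (fun x => G (x, y)) μ ∂ν) + ∫⁻ x, evariance (fun y => G (x, y)) ν ∂μ := by
  have hx : ∀ y, MemLp (fun x => G (x, y)) 2 μ := fun y =>
    MemLp.of_bound (hG.comp measurable_prodMk_right).aestronglyMeasurable B
      (Eventually.of_forall fun x => hB _)
  have hint : Integrable G (μ.prod ν) :=
    Integrable.of_bound hG.aestronglyMeasurable B (Eventually.of_forall hB)
  set m := ∫ p, G p ∂(μ.prod ν) with hm
  let h : X → ℝ := fun x => ∫ y, G (x, y) ∂ν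
  have hhm : StronglyMeasurable h := hG.stronglyMeasurable.integral_prod_right'
  have hhB : ∀ x, ‖h x‖ ≤ B := fun x => by
    have := norm_integral_le_of_norm_le_const (μ := ν) (f := fun y => G (x, y))
      (Eventually.of_forall fun y => hB (x, y))
    simpa using this
  have hh : MemLp h 2 μ := MemLp.of_bound hhm.aestronglyMeasurable B (Eventually.of_forall hhB)
  have hmh : m = ∫ x, h x ∂μ := integral_prod _ hint
  have hmeas : Measurable fun p : X × Y => ‖G p - h p.1‖ₑ ^ 2 :=
    ((hG.sub (hhm.measurable.comp measurable_fst)).enorm).pow_const 2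
  have key : ∀ y, ∫⁻ x, ‖G (x, y) - m‖ₑ ^ 2 ∂μ ≤
      evariance (fun x => G (x, y)) μ + ∫⁻ x, ‖G (x, y) - h x‖ₑ ^ 2 ∂μ := by
    intro y
    rw [lintegral_enorm_sub_sq (hx y) m, hmh, ← integral_sub ((hx y).integrable (by norm_num))
      (hh.integrable (by norm_num))]
    gcongr
    exact enorm_integral_sq_le ((hx y).sub hh)
  calc evariance G (μ.prod ν) = ∫⁻ y, ∫⁻ x, ‖G (x, y) - m‖ₑ ^ 2 ∂μ ∂ν := by
        rw [evariance, lintegral_prod_symm' _ ((hG.sub_const m).enorm.pow_const 2)]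
    _ ≤ ∫⁻ y, (evariance (fun x => G (x, y)) μ + ∫⁻ x, ‖G (x, y) - h x‖ₑ ^ 2 ∂μ) ∂ν :=
        lintegral_mono key
    _ = _ := by
        rw [lintegral_add_right _ hmeas.lintegral_prod_left']
        congr 1
        rw [lintegral_lintegral_swap]
        · rfl
        · exact (hmeas.comp measurable_swap).aemeasurable

end Variance

lemma measurable_cost {F : Finset (E d) → ℝ} (hF : Measurable F) :
    Measurable fun p : E d × Finset (E d) => cost F p.1 p.2 :=
  (hF.comp measurable_insert_config).sub (hF.comp measurable_snd)

lemma measurable_cost_apply {F : Finset (E d) → ℝ} (hF : Measurable F) (y : E d) :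
    Measurable (cost F y) :=
  (measurable_cost hF).comp measurable_prodMk_left

/-- The Dirichlet energy of a functional of the Poisson process with intensity `ν`. -/
noncomputable def energy (F : Finset (E d) → ℝ) (ν : Measure (E d)) : ℝ≥0∞ :=
  ∫⁻ x, ∫⁻ s, ‖cost F x s‖ₑ ^ 2 ∂poissonLaw ν ∂ν

lemma tsum_poissonWeight_add_two_le (ν : Measure (E d)) [IsFiniteMeasure ν] :
    ∑' k, poissonWeight ν (k + 2) * (ν Set.univ) ^ (k + 2) ≤ (ν Set.univ) ^ 2 := by
  calc _ ≤ ∑' k, (poissonWeight ν k * (ν Set.univ) ^ k) * (ν Set.univ) ^ 2 := by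
        refine ENNReal.tsum_le_tsum fun k => ?_
        rw [pow_add, mul_assoc]
        gcongr
        refine ENNReal.ofReal_le_ofReal ?_
        gcongr
        omega
    _ = _ := by rw [ENNReal.tsum_mul_right, tsum_poissonWeight, one_mul]

/-- A crude form of the Poincaré inequality, sharp to first order in the mass of the intensity. -/
lemma evariance_le_energy_add_sq (ν : Measure (E d)) [IsFiniteMeasure ν]
    {F : Finset (E d) → ℝ} (hF : Measurable F) {B : ℝ≥0} (hB : ∀ s, ‖F s‖₊ ≤ B) :
    evariance F (poissonLaw ν) ≤ energy F ν + (2 * B) ^ 2 * (ν Set.univ) ^ 2 := by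
  have hL : MemLp F 2 (poissonLaw ν) :=
    MemLp.of_bound hF.aestronglyMeasurable B (Eventually.of_forall fun s => hB s)
  have hΦ : Measurable fun s => ‖F s - F ∅‖ₑ ^ 2 := ((hF.sub_const _).enorm).pow_const 2
  have hbd : ∀ s, ‖F s - F ∅‖ₑ ^ 2 ≤ ((2 * B) ^ 2 : ℝ≥0∞) := by
    intro s
    gcongr
    calc ‖F s - F ∅‖ₑ ≤ ‖F s‖ₑ + ‖F ∅‖ₑ := enorm_sub_le
      _ ≤ B + B := add_le_add (ENNReal.coe_le_coe.2 (hB s)) (ENNReal.coe_le_coe.2 (hB ∅))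
      _ = 2 * B := (two_mul _).symm
  refine (evariance_le_lintegral_sub_sq hL (F ∅)).trans ?_
  rw [lintegral_poissonLaw ν hΦ, tsum_eq_zero_add' ENNReal.summable,
    tsum_eq_zero_add' ENNReal.summable]
  have h0 : ∫⁻ x, ‖F (Finset.univ.image x) - F ∅‖ₑ ^ 2 ∂(Measure.pi fun _ : Fin 0 => ν) = 0 := by
    simp
  have h1 : ∫⁻ x, ‖F (Finset.univ.image x) - F ∅‖ₑ ^ 2 ∂(Measure.pi fun _ : Fin 1 => ν) =
      ∫⁻ x, ‖F {x} - F ∅‖ₑ ^ 2 ∂ν := by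
    rw [← (measurePreserving_funUnique ν (Fin 1)).lintegral_comp
      (f := fun x => ‖F {x} - F ∅‖ₑ ^ 2) (hΦ.comp measurable_singleton_config)]
    refine lintegral_congr fun x => ?_
    simp
  rw [h0, mul_zero, zero_add]
  refine add_le_add ?_ ?_
  · have hm : Measurable fun x : E d => ‖F {x} - F ∅‖ₑ ^ 2 :=
      hΦ.comp measurable_singleton_config
    rw [zero_add, h1, energy, ← lintegral_const_mul _ hm]
    refine lintegral_mono fun x => ?_
    have hw : poissonWeight ν 1 ≤ poissonLaw ν {∅} := by
      simpa [poissonWeight] using poissonLaw_empty_ge ν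
    calc _ ≤ poissonLaw ν {∅} * ‖F {x} - F ∅‖ₑ ^ 2 := by gcongr
      _ = ∫⁻ s in {∅}, ‖cost F x s‖ₑ ^ 2 ∂poissonLaw ν := by
          rw [mul_comm, ← setLIntegral_const]
          refine setLIntegral_congr_fun measurableSet_singleton_empty fun s hs => ?_
          obtain rfl : s = ∅ := hs
          simp [cost]
      _ ≤ _ := setLIntegral_le_lintegral _ _
  · calc _ ≤ ∑' k, (2 * B : ℝ≥0∞) ^ 2 * (poissonWeight ν (k + 2) * (ν Set.univ) ^ (k + 2)) := by
          refine ENNReal.tsum_le_tsum fun k => ?_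
          rw [mul_left_comm]
          gcongr
          calc _ ≤ ∫⁻ _, (2 * B : ℝ≥0∞) ^ 2 ∂(Measure.pi fun _ : Fin (k + 1 + 1) => ν) :=
                lintegral_mono fun x => hbd _
            _ = _ := by simp [Measure.pi_univ]
      _ ≤ _ := by
          rw [ENNReal.tsum_mul_left]
          gcongr
          exact tsum_poissonWeight_add_two_le ν

lemma cost_union (F : Finset (E d) → ℝ) (x : E d) (s t : Finset (E d)) :
    cost (fun s => F (s ∪ t)) x s = cost F x (s ∪ t) := by
  simp only [cost, Finset.insert_union]

/-- Splitting the process into `2^k` independent copies improves the error term of the crude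
Poincaré inequality by the factor `2^{-k}`. -/
lemma evariance_le_energy_add (k : ℕ) (ν : Measure (E d)) [IsFiniteMeasure ν]
    [NullSingletonClass ν] {F : Finset (E d) → ℝ} (hF : Measurable F) {B : ℝ≥0}
    (hB : ∀ s, ‖F s‖₊ ≤ B) :
    evariance F (poissonLaw ν) ≤
      energy F ν + (2 * B) ^ 2 * (ν Set.univ) ^ 2 * (2⁻¹ : ℝ≥0∞) ^ k := by
  induction k generalizing ν F with
  | zero => simpa using evariance_le_energy_add_sq ν hF hB
  | succ k ih =>
    set α : Measure (E d) := (2⁻¹ : ℝ≥0∞) • ν with hα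
    have : IsFiniteMeasure α := ν.smul_finite (by simp)
    have : NullSingletonClass α := ⟨fun x => by simp [hα]⟩
    have hνα : ν = α + α := by
      rw [hα, ← add_smul, ENNReal.inv_two_add_inv_two, one_smul]
    have hG : Measurable fun p : Finset (E d) × Finset (E d) => F (p.1 ∪ p.2) :=
      hF.comp measurable_union_config
    have hcm := measurable_cost hF
    have e1 : evariance F (poissonLaw ν) =
        evariance (fun p : Finset (E d) × Finset (E d) => F (p.1 ∪ p.2))
          ((poissonLaw α).prod (poissonLaw α)) := by
      conv_lhs => rw [hνα, ← map_union_poissonLaw]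
      rw [evariance, evariance, lintegral_map ((hF.sub_const _).enorm.pow_const 2)
        measurable_union_config, integral_map measurable_union_config.aemeasurable
        hF.aestronglyMeasurable]
    set K : ℝ≥0∞ := (2 * B) ^ 2 * (α Set.univ) ^ 2 * (2⁻¹ : ℝ≥0∞) ^ k with hK
    have half : ∫⁻ t, evariance (fun s => F (s ∪ t)) (poissonLaw α) ∂poissonLaw α ≤
        2⁻¹ * energy F ν + K := by
      calc _ ≤ ∫⁻ t, (energy (fun s => F (s ∪ t)) α + K) ∂poissonLaw α :=
            lintegral_mono fun t => ih α
              (hF.comp (measurable_union_config.comp measurable_prodMk_right)) fun s => hB _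
        _ = (∫⁻ t, energy (fun s => F (s ∪ t)) α ∂poissonLaw α) + K := by
            rw [lintegral_add_right _ measurable_const]; simp
        _ = _ := by
            congr 1
            have hm3 : Measurable fun q : (Finset (E d) × E d) × Finset (E d) =>
                ‖cost F q.1.2 (q.2 ∪ q.1.1)‖ₑ ^ 2 :=
              (hcm.comp ((measurable_snd.comp measurable_fst).prodMk
                (measurable_union_config.comp (measurable_snd.prodMk
                  (measurable_fst.comp measurable_fst))))).enorm.pow_const 2
            simp only [energy, cost_union]
            rw [lintegral_lintegral_swap hm3.lintegral_prod_right'.aemeasurable]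
            have : ∀ x, ∫⁻ t, ∫⁻ s, ‖cost F x (s ∪ t)‖ₑ ^ 2 ∂poissonLaw α ∂poissonLaw α =
                ∫⁻ s, ‖cost F x s‖ₑ ^ 2 ∂poissonLaw ν := by
              intro x
              have hx : Measurable fun s => ‖cost F x s‖ₑ ^ 2 :=
                (measurable_cost_apply hF x).enorm.pow_const 2
              rw [hνα, lintegral_poissonLaw_add α α hx]
              simp only [Finset.union_comm]
            simp only [this]
            rw [hα, lintegral_smul_measure, smul_eq_mul]
    have half' : ∫⁻ s, evariance (fun t => F (s ∪ t)) (poissonLaw α) ∂poissonLaw α ≤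
        2⁻¹ * energy F ν + K := by
      simpa only [Finset.union_comm] using half
    rw [e1]
    refine (evariance_prod_le hG (B := B) fun p => hB _).trans ((add_le_add half half').trans ?_)
    have hαm : α Set.univ = 2⁻¹ * ν Set.univ := by simp [hα]
    have two : (2⁻¹ : ℝ≥0∞) + 2⁻¹ = 1 := ENNReal.inv_two_add_inv_two
    have : 2⁻¹ * energy F ν + K + (2⁻¹ * energy F ν + K) =
        (2⁻¹ + 2⁻¹) * energy F ν +
          (2⁻¹ + 2⁻¹) * ((2 * B) ^ 2 * (ν Set.univ) ^ 2 * (2⁻¹ : ℝ≥0∞) ^ (k + 1)) := by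
      rw [hK, hαm]
      ring
    rw [this, two, one_mul, one_mul]

/-- The **Poincaré inequality** for functionals of a Poisson process. -/
theorem evariance_le_energy (ν : Measure (E d)) [IsFiniteMeasure ν]
    [NullSingletonClass ν] {F : Finset (E d) → ℝ} (hF : Measurable F)
    (hL : MemLp F 2 (poissonLaw ν)) : evariance F (poissonLaw ν) ≤ energy F ν := by
  have bdd : ∀ {G : Finset (E d) → ℝ} (B : ℝ≥0), Measurable G → (∀ s, ‖G s‖₊ ≤ B) →
      evariance G (poissonLaw ν) ≤ energy G ν := by
    intro G B hG hB
    have ht : Tendsto (fun k : ℕ => energy G ν +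
        (2 * B) ^ 2 * (ν Set.univ) ^ 2 * (2⁻¹ : ℝ≥0∞) ^ k) atTop (𝓝 (energy G ν + 0)) := by
      refine tendsto_const_nhds.add ?_
      have := ENNReal.Tendsto.const_mul (a := (2 * B : ℝ≥0∞) ^ 2 * (ν Set.univ) ^ 2)
        (ENNReal.tendsto_pow_atTop_nhds_zero_of_lt_one (r := 2⁻¹) (by simp))
        (Or.inr (ENNReal.mul_ne_top (by finiteness) (by finiteness)))
      simpa using this
    rw [add_zero] at ht
    exact ge_of_tendsto ht (Eventually.of_forall fun k => evariance_le_energy_add k ν hG hB)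
  -- truncation at level `N` does not increase the energy
  let T : ℕ → Finset (E d) → ℝ := fun N s => max (-(N : ℝ)) (min (F s) N)
  have hT : ∀ N, Measurable (T N) := fun N => measurable_const.max (hF.min measurable_const)
  have hTB : ∀ N s, ‖T N s‖₊ ≤ (N : ℝ≥0) := by
    intro N s
    rw [← NNReal.coe_le_coe, coe_nnnorm, Real.norm_eq_abs, abs_le]
    simp only [T, NNReal.coe_natCast]
    constructor
    · exact le_max_left _ _
    · exact max_le (by linarith [Nat.cast_nonneg (α := ℝ) N]) (min_le_right _ _)
  have hTE : ∀ N, energy (T N) ν ≤ energy F ν := by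
    intro N
    refine lintegral_mono fun x => lintegral_mono fun s => ?_
    gcongr
    rw [enorm_le_iff_norm_le, Real.norm_eq_abs, Real.norm_eq_abs]
    simp only [cost, T]
    refine (abs_max_sub_max_le_max _ _ _ _).trans (max_le (by simp) ?_)
    exact (abs_min_sub_min_le_max _ _ _ _).trans (max_le le_rfl (by simp))
  have hTlim : ∀ s, Tendsto (fun N => T N s) atTop (𝓝 (F s)) := by
    intro s
    refine tendsto_const_nhds.congr' ?_
    obtain ⟨N₀, hN₀⟩ := exists_nat_ge |F s|
    filter_upwards [eventually_ge_atTop N₀] with N hN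
    have h1 : |F s| ≤ N := hN₀.trans (by exact_mod_cast hN)
    simp only [T]
    rw [min_eq_left (abs_le.1 h1).2, max_eq_right (abs_le.1 h1).1]
  have hTF : ∀ N s, ‖T N s‖ ≤ ‖F s‖ := by
    intro N s
    rw [Real.norm_eq_abs, Real.norm_eq_abs, abs_le]
    have hN : (0 : ℝ) ≤ N := Nat.cast_nonneg N
    have h0 := abs_nonneg (F s)
    refine ⟨le_max_of_le_right (le_min (neg_abs_le _) (by linarith)),
      max_le (by linarith) ((min_le_left _ _).trans (le_abs_self _))⟩
  have hmean : Tendsto (fun N => ∫ s, T N s ∂poissonLaw ν) atTop (𝓝 (∫ s, F s ∂poissonLaw ν)) :=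
    tendsto_integral_of_dominated_convergence (fun s => ‖F s‖)
      (fun N => (hT N).aestronglyMeasurable) (hL.integrable (by norm_num)).norm
      (fun N => Eventually.of_forall (hTF N)) (Eventually.of_forall hTlim)
  calc evariance F (poissonLaw ν)
      = ∫⁻ s, liminf (fun N => ‖T N s - ∫ s, T N s ∂poissonLaw ν‖ₑ ^ 2) atTop ∂poissonLaw ν := by
        refine lintegral_congr fun s => ?_
        refine (Tendsto.liminf_eq ?_).symm
        exact ((ENNReal.continuous_pow 2).tendsto _).comp
          ((continuous_enorm.tendsto _).comp ((hTlim s).sub hmean))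
    _ ≤ liminf (fun N => evariance (T N) (poissonLaw ν)) atTop :=
        lintegral_liminf_le fun N => ((hT N).sub_const _).enorm.pow_const 2
    _ ≤ liminf (fun _ : ℕ => energy F ν) atTop :=
        liminf_le_liminf (Eventually.of_forall fun N =>
          (bdd N (hT N) (hTB N)).trans (hTE N))
    _ = _ := liminf_const _

/-! ### Windows, dilations and the tail of the radius of stabilization -/

section Cubes

lemma cube_eq_preimage (z : E d) (a : ℝ) :
    cube z a = (WithLp.ofLp : E d → (Fin d → ℝ)) ⁻¹'
      (Set.univ.pi fun i => Set.Ico (z i) (z i + a)) := by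
  ext x
  simp [cube]

lemma measurableSet_cube (z : E d) (a : ℝ) : MeasurableSet (cube z a) := by
  rw [cube_eq_preimage]
  exact (PiLp.volume_preserving_ofLp (Fin d)).measurable
    (MeasurableSet.univ_pi fun i => measurableSet_Ico)

lemma volume_cube (z : E d) (a : ℝ) : volume (cube z a) = ENNReal.ofReal a ^ d := by
  rw [cube_eq_preimage, (PiLp.volume_preserving_ofLp (Fin d)).measure_preimage
    (MeasurableSet.univ_pi fun i => measurableSet_Ico).nullMeasurableSet, Real.volume_pi_Ico]
  simp

lemma dist_le_of_mem_cube {z x y : E d} {a : ℝ} (hx : x ∈ cube z a) (hy : y ∈ cube z a) :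
    dist x y ≤ √d * a := by
  rcases Nat.eq_zero_or_pos d with rfl | hd
  · simp [Subsingleton.elim x y]
  have ha : 0 ≤ a := by
    have := hx ⟨0, hd⟩
    linarith
  rw [EuclideanSpace.dist_eq, ← Real.sqrt_sq ha, ← Real.sqrt_mul (by positivity)]
  refine Real.sqrt_le_sqrt ?_
  calc ∑ i, dist (x i) (y i) ^ 2 ≤ ∑ _i : Fin d, a ^ 2 := by
        refine Finset.sum_le_sum fun i _ => ?_
        have h1 := hx i
        have h2 := hy i
        rw [Real.dist_eq, sq_abs]
        exact sq_le_sq' (by linarith) (by linarith)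
    _ = d * a ^ 2 := by simp

lemma isBounded_cube (z : E d) (a : ℝ) : Bornology.IsBounded (cube z a) := by
  rw [Metric.isBounded_iff]
  exact ⟨√d * a, fun x hx y hy => dist_le_of_mem_cube hx hy⟩

lemma vadd_cube (y z : E d) (a : ℝ) : y +ᵥ cube z a = cube (y + z) a := by
  ext x
  rw [Set.mem_vadd_set_iff_neg_vadd_mem]
  simp only [cube, Set.mem_ofPred_eq, vadd_eq_add, PiLp.add_apply, PiLp.neg_apply]
  refine forall_congr' fun i => ?_
  constructor <;> rintro ⟨h1, h2⟩ <;> constructor <;> linarith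

end Cubes

section Laws

/-- The law of the restriction to `A` of the Poisson process with intensity function `g`. -/
noncomputable def law (g : E d → ℝ≥0) (A : Set (E d)) : Measure (Finset (E d)) :=
  poissonLaw ((intensity g).restrict A)

lemma intensity_le {g : E d → ℝ≥0} {b : ℝ≥0} (hb : ∀ x, g x ≤ b) :
    intensity g ≤ (b : ℝ≥0∞) • volume := by
  rw [← withDensity_const]
  exact withDensity_mono (Eventually.of_forall fun x => ENNReal.coe_le_coe.2 (hb x))

lemma isFiniteMeasure_intensity {g : E d → ℝ≥0} {b : ℝ≥0} (hb : ∀ x, g x ≤ b) {A : Set (E d)}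
    (hA : Bornology.IsBounded A) : IsFiniteMeasure ((intensity g).restrict A) :=
  ⟨by
    rw [Measure.restrict_apply_univ]
    refine (intensity_le hb A).trans_lt ?_
    exact ENNReal.mul_lt_top ENNReal.coe_lt_top hA.measure_lt_top⟩

lemma law_of_process [NeZero d] {Ω : Type*} [MeasurableSpace Ω] {P : Ω → Set (E d)}
    {g : E d → ℝ≥0} {μ : Measure Ω} [IsProbabilityMeasure μ] (hP : IsPoissonProcess P g μ)
    {B : Set (E d)} (hB : Bornology.IsBounded B) (hBm : MeasurableSet B) :
    μ.map (window hP hB) = law g B := map_window hP hB hBm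

lemma translate_neg_translate (y : E d) (s : Finset (E d)) : translate (-y) (translate y s) = s := by
  ext x; simp [mem_translate]

lemma translate_insert (v y : E d) (s : Finset (E d)) :
    translate v (insert y s) = insert (v + y) (translate v s) := by
  ext x
  simp [mem_translate, sub_eq_iff_eq_add, add_comm]

lemma cost_translate {H : Finset (E d) → ℝ} (hH : TranslationInvariant H) (v y : E d)
    (s : Finset (E d)) : cost H (v + y) (translate v s) = cost H y s := by
  have h : ∀ s, H (translate v s) = H s := fun s => hH v s
  rw [cost, ← translate_insert, h, h, cost]

/-- Translating a homogeneous process translates the window. -/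
lemma map_translate_law [NeZero d] (l : ℝ≥0) {A : Set (E d)} (hA : Bornology.IsBounded A)
    (v : E d) : (law (fun _ => l) A).map (translate v) = law (fun _ => l) (v +ᵥ A) := by
  have := isFiniteMeasure_intensity (g := fun _ : E d => l) (b := l) (fun _ => le_rfl) hA
  rw [law, map_translate_poissonLaw, law]
  congr 1
  have hmp : MeasurePreserving (fun x : E d => v + x) volume volume :=
    measurePreserving_add_left volume v
  have he : MeasurableEmbedding (fun x : E d => v + x) := measurableEmbedding_addLeft v
  have h2 : v +ᵥ A = (fun x : E d => v + x) '' A := rfl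
  rw [intensity, withDensity_const, Measure.restrict_smul, Measure.restrict_smul, Measure.map_smul,
    h2, ← (hmp.restrict_image_emb he A).map_eq]

lemma lintegral_translate_law [NeZero d] (l : ℝ≥0) {A : Set (E d)} (hA : Bornology.IsBounded A)
    (v : E d) {Φ : Finset (E d) → ℝ≥0∞} (hΦ : Measurable Φ) :
    ∫⁻ s, Φ s ∂law (fun _ => l) (v +ᵥ A) = ∫⁻ s, Φ (translate v s) ∂law (fun _ => l) A := by
  rw [← map_translate_law l hA, lintegral_map hΦ (measurable_translate v)]

lemma map_restr_law [NeZero d] {g : E d → ℝ≥0} {b : ℝ≥0} (hb : ∀ x, g x ≤ b) {A V : Set (E d)}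
    (hA : Bornology.IsBounded A) (hV : MeasurableSet V) (hVA : V ⊆ A) :
    (law g A).map (restr V) = law g V := by
  have := isFiniteMeasure_intensity hb hA
  rw [law, map_restr_poissonLaw _ hV, Measure.restrict_restrict hV, Set.inter_eq_left.2 hVA, law]

lemma isProbabilityMeasure_law {g : E d → ℝ≥0} {b : ℝ≥0} (hb : ∀ x, g x ≤ b) {A : Set (E d)}
    (hA : Bornology.IsBounded A) : IsProbabilityMeasure (law g A) := by
  have := isFiniteMeasure_intensity hb hA
  rw [law]
  infer_instance

lemma lintegral_law_le_of_density [NeZero d] {g₁ g₂ : E d → ℝ≥0} (hg₁ : Measurable g₁)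
    (hg₂ : Measurable g₂) {b : ℝ≥0} (hb₁ : ∀ x, g₁ x ≤ b) (hb₂ : ∀ x, g₂ x ≤ b)
    {A : Set (E d)} (hA : MeasurableSet A) (hAb : Bornology.IsBounded A)
    {Φ : Finset (E d) → ℝ≥0∞} (hΦ : Measurable Φ) {M : ℝ≥0∞} (hM : ∀ s, Φ s ≤ M) :
    ∫⁻ s, Φ s ∂law g₁ A ≤ ∫⁻ s, Φ s ∂law g₂ A + M * ∫⁻ x in A, edist (g₁ x) (g₂ x) := by
  have := isFiniteMeasure_intensity hb₁ hAb
  have := isFiniteMeasure_intensity hb₂ hAb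
  exact lintegral_poissonLaw_le_of_density hg₁ hg₂ hA hΦ hM

end Laws

/-- `ρ` bounds the tail of the radius of stabilization of `H` on the homogeneous Poisson process
with density `l`, in terms of laws only: with probability at least `1 - ρ r`, the points outside of
the ball of radius `r` do not change the add one cost at the origin. The exceptional event may
depend on these points. -/
def StabilizationTail (H : Finset (E d) → ℝ) (l : ℝ≥0) (ρ : ℝ → ℝ≥0∞) : Prop :=
  ∀ (r : ℝ) (t : Finset (E d)), Disjoint (t : Set (E d)) (Metric.closedBall 0 r) →
    law (fun _ => l) (Metric.closedBall 0 r) {s | cost H 0 (s ∪ t) ≠ cost H 0 s} ≤ ρ r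

lemma exists_stabilizationTail [NeZero d] {H : Finset (E d) → ℝ} (hH : Measurable H) {l : ℝ≥0}
    {Ω : Type*} [MeasurableSpace Ω] {P : Ω → Set (E d)} {μ : Measure Ω} [IsProbabilityMeasure μ]
    (hP : IsPoissonProcess P (fun _ => l) μ) (hs : StronglyStabilizing H P μ) :
    ∃ ρ : ℝ → ℝ≥0∞, Tendsto ρ atTop (𝓝 0) ∧ StabilizationTail H l ρ := by
  obtain ⟨τ, Δ, hτ, -, hst⟩ := hs
  refine ⟨fun r => μ {ω | r < τ ω}, ?_, ?_⟩
  · have hanti : Antitone fun r : ℝ => {ω | r < τ ω} := fun r r' h ω hω => lt_of_le_of_lt h hω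
    have := tendsto_measure_iInter_atTop (μ := μ) (s := fun r : ℝ => {ω | r < τ ω})
      (fun r => (measurableSet_lt measurable_const hτ).nullMeasurableSet) hanti
      ⟨0, measure_ne_top _ _⟩
    have he : (⋂ r : ℝ, {ω | r < τ ω}) = ∅ := by
      ext ω
      simp only [Set.mem_iInter, Set.mem_ofPred_eq, Set.mem_empty_iff_false, iff_false, not_forall,
        not_lt]
      exact ⟨τ ω, le_rfl⟩
    rwa [he, measure_empty] at this
  · intro r t ht
    have hB : Bornology.IsBounded (Metric.closedBall (0 : E d) r) := Metric.isBounded_closedBall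
    have hBm : MeasurableSet (Metric.closedBall (0 : E d) r) := Metric.isClosed_closedBall.measurableSet
    have hc : Measurable (cost H 0) := measurable_cost_apply hH 0
    have hm : MeasurableSet {s | cost H 0 (s ∪ t) ≠ cost H 0 s} :=
      (measurableSet_eq_fun (hc.comp (measurable_union_config.comp measurable_prodMk_right))
        hc).compl
    rw [← law_of_process hP hB hBm, Measure.map_apply (measurable_window hP hB hBm) hm]
    refine measure_mono_ae ?_
    filter_upwards [hst] with ω hω hne
    by_contra hr
    have hr' : τ ω ≤ r := not_lt.1 hr
    have key : ∀ t' : Finset (E d), Disjoint (t' : Set (E d)) (Metric.closedBall 0 r) →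
        cost H 0 (window hP hB ω ∪ t') = Δ ω := by
      intro t' ht'
      let A : Finset (E d) := restr (Metric.closedBall 0 (τ ω))ᶜ (window hP hB ω) ∪ t'
      have hA : Disjoint (A : Set (E d)) (Metric.closedBall 0 (τ ω)) := by
        rw [Set.disjoint_left]
        intro x hx hxτ
        rcases Finset.mem_union.1 (Finset.mem_coe.1 hx) with h | h
        · exact (mem_restr.1 h).2 hxτ
        · exact Set.disjoint_left.1 ht' h (Metric.closedBall_subset_closedBall hr' hxτ)
      rw [← hω A hA, ← addOneCost_coe]
      congr 1
      ext x
      simp only [A, Finset.coe_union, coe_window, coe_restr, Set.mem_union, Set.mem_inter_iff,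
        Set.mem_compl_iff]
      have hsub : x ∈ Metric.closedBall 0 (τ ω) → x ∈ Metric.closedBall (0 : E d) r :=
        fun h => Metric.closedBall_subset_closedBall hr' h
      tauto
    refine hne ?_
    have h0 := key ∅ (by simp)
    rw [Finset.union_empty] at h0
    rw [key t ht, h0]

/-- The factor `n^{1/d}` of the dilation. -/
noncomputable def dil (d n : ℕ) : ℝ := (n : ℝ) ^ ((1 : ℝ) / d)

/-- The intensity function of the scaled process. -/
noncomputable def dilated (f : E d → ℝ≥0) (n : ℕ) (x : E d) : ℝ≥0 := f ((dil d n)⁻¹ • x)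

lemma one_le_dil {n : ℕ} (hn : 1 ≤ n) : 1 ≤ dil d n :=
  Real.one_le_rpow (by exact_mod_cast hn) (by positivity)

lemma dil_pos {n : ℕ} (hn : 1 ≤ n) : 0 < dil d n := zero_lt_one.trans_le (one_le_dil hn)

lemma dil_pow [NeZero d] (n : ℕ) : dil d n ^ d = n := by
  rw [dil, one_div, Real.rpow_inv_natCast_pow (by positivity) (NeZero.ne d)]

lemma tendsto_dil [NeZero d] : Tendsto (dil d) atTop atTop :=
  (tendsto_rpow_atTop (by have := NeZero.pos d; positivity)).comp tendsto_natCast_atTop_atTop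

lemma measurable_dilated {f : E d → ℝ≥0} (hf : Measurable f) (n : ℕ) : Measurable (dilated f n) :=
  hf.comp (measurable_const_smul _)

lemma isPoissonProcess_dilated [NeZero d] {Ω : Type*} [MeasurableSpace Ω] {Q : Ω → Set (E d)}
    {f : E d → ℝ≥0} {μ : Measure Ω} {n : ℕ} (hn : 1 ≤ n) (hf : Measurable f)
    (hQ : IsPoissonProcess Q (fun x => (n : ℝ≥0) * f x) μ) :
    IsPoissonProcess (scaled n Q) (dilated f n) μ :=
  isPoissonProcess_scaled (NeZero.ne d) hn hf hQ

/-! ### Lebesgue points and moments -/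

section Hypotheses

variable {H : Finset (E d) → ℝ} {f : E d → ℝ≥0} {Ω' : ℕ → Type*} [∀ n, MeasurableSpace (Ω' n)]
  {ν : ∀ n, Measure (Ω' n)} [∀ n, IsProbabilityMeasure (ν n)] {Q : ∀ n, Ω' n → Set (E d)}

lemma exists_cost_moment_bound [NeZero d] (hH : Measurable H) (hf : Measurable f)
    (hQ : ∀ n : ℕ, 1 ≤ n → IsPoissonProcess (Q n) (fun x => (n : ℝ≥0) * f x) (ν n))
    (h : PoissonBoundedMoments H (fun n => scaled n (Q n)) ν) :
    ∃ p : ℝ, 2 < p ∧ ∃ C : ℝ≥0, ∀ n : ℕ, 1 ≤ n → ∀ (y z : E d) (a : ℝ), y ∈ cube z a →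
      ∫⁻ s, ‖cost H y s‖ₑ ^ p ∂law (dilated f n) (cube z a) ≤ C := by
  obtain ⟨p, hp, C, hC⟩ := h
  refine ⟨p, hp, C, fun n hn y z a hy => ?_⟩
  have hP := isPoissonProcess_dilated hn hf (hQ n hn)
  rw [← law_of_process hP (isBounded_cube z a) (measurableSet_cube z a), lintegral_map
    ((measurable_cost_apply hH y).enorm.pow_const p)
    (measurable_window hP _ (measurableSet_cube z a))]
  simpa only [addOneCost_inter hP (isBounded_cube z a)] using hC n hn y z a hy

lemma exists_moment_bound [NeZero d] (hH : Measurable H) (hf : Measurable f)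
    (hQ : ∀ n : ℕ, 1 ≤ n → IsPoissonProcess (Q n) (fun x => (n : ℝ≥0) * f x) (ν n))
    (h : LocallyBoundedMoments H (fun n => scaled n (Q n)) ν) {a : ℝ} (ha : 0 < a) :
    ∃ q : ℝ, 2 < q ∧ ∃ C : ℝ≥0, ∀ n : ℕ, 1 ≤ n → ∀ z : E d,
      ∫⁻ s, ‖H s‖ₑ ^ q ∂law (dilated f n) (cube z a) ≤ C := by
  obtain ⟨δ, hδ, C, hC⟩ := h 0 a ha
  refine ⟨2 + δ, by linarith, C, fun n hn z => ?_⟩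
  have hP := isPoissonProcess_dilated hn hf (hQ n hn)
  rw [← law_of_process hP (isBounded_cube z a) (measurableSet_cube z a), lintegral_map
    (hH.enorm.pow_const _) (measurable_window hP _ (measurableSet_cube z a))]
  have := hC n hn z
  simpa only [vadd_cube, add_zero, val_inter hP (isBounded_cube z a)] using this

end Hypotheses

/-- At `x`, the dilates of `f` around `x` converge to the constant `f x` locally in `L^1`. -/
def LebesguePoint (f : E d → ℝ≥0) (x : E d) : Prop :=
  ∀ R : ℝ, 0 < R → Tendsto (fun n : ℕ => ∫⁻ z in Metric.closedBall (dil d n • x) R,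
    edist (dilated f n z) (f x)) atTop (𝓝 0)

/-- By the Lebesgue differentiation theorem, almost every point is a Lebesgue point. -/
theorem ae_lebesguePoint [NeZero d] {f : E d → ℝ≥0} (hf : Measurable f) {b : ℝ≥0}
    (hb : ∀ x, f x ≤ b) : ∀ᵐ x, LebesguePoint f x := by
  let F : E d → ℝ := fun x => f x
  have hF : Measurable F := hf.coe_nnreal_real
  have hloc : LocallyIntegrable F volume := by
    refine (locallyIntegrable_const (b : ℝ)).mono hF.aestronglyMeasurable
      (Eventually.of_forall fun x => ?_)
    simpa [F] using hb x
  filter_upwards [IsUnifLocDoublingMeasure.ae_tendsto_average_norm_sub volume hloc 1] with x hx R hR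
  have hδ : Tendsto (fun n : ℕ => R * (dil d n)⁻¹) atTop (𝓝[>] 0) := by
    refine tendsto_nhdsWithin_iff.2 ⟨?_, ?_⟩
    · simpa using (tendsto_inv_atTop_zero.comp (tendsto_dil (d := d))).const_mul R
    · filter_upwards [eventually_ge_atTop 1] with n hn
      exact mul_pos hR (inv_pos.2 (dil_pos hn))
  have h := hx (fun _ => x) _ hδ (by
    filter_upwards [eventually_ge_atTop 1] with n hn
    exact Metric.mem_closedBall_self (by have := dil_pos (d := d) hn; positivity))
  have h2 : Tendsto (fun n : ℕ => ENNReal.ofReal (R ^ d * volume.real (Metric.closedBall (0 : E d) 1) *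
      ⨍ y in Metric.closedBall x (R * (dil d n)⁻¹), ‖F y - F x‖)) atTop (𝓝 0) := by
    rw [← ENNReal.ofReal_zero]
    refine (ENNReal.continuous_ofReal.tendsto 0).comp ?_
    simpa using h.const_mul (R ^ d * volume.real (Metric.closedBall (0 : E d) 1))
  refine h2.congr' ?_
  filter_upwards [eventually_ge_atTop 1] with n hn
  have hc := dil_pos (d := d) hn
  set c := dil d n
  have hφ : Measurable fun w => edist (f w) (f x) := hf.edist measurable_const
  have e1 : ∫⁻ z in Metric.closedBall (c • x) R, edist (dilated f n z) (f x) =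
      ENNReal.ofReal (c ^ d) * ∫⁻ w in Metric.closedBall x (R * c⁻¹), edist (f w) (f x) := by
    rw [← lintegral_indicator Metric.isClosed_closedBall.measurableSet,
      ← lintegral_indicator Metric.isClosed_closedBall.measurableSet,
      ← lintegral_comp_inv_smul hc (hφ.indicator Metric.isClosed_closedBall.measurableSet)]
    refine lintegral_congr fun z => ?_
    have hmem : c⁻¹ • z ∈ Metric.closedBall x (R * c⁻¹) ↔ z ∈ Metric.closedBall (c • x) R := by
      rw [Metric.mem_closedBall, Metric.mem_closedBall, ← inv_smul_smul₀ hc.ne' x,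
        dist_smul₀, smul_inv_smul₀ hc.ne', Real.norm_eq_abs, abs_of_pos (inv_pos.2 hc), mul_comm]
      exact mul_le_mul_iff_left₀ (inv_pos.2 hc)
    by_cases hz : z ∈ Metric.closedBall (c • x) R
    · rw [Set.indicator_of_mem hz, Set.indicator_of_mem (hmem.2 hz)]
      rfl
    · rw [Set.indicator_of_notMem hz, Set.indicator_of_notMem (fun h => hz (hmem.1 h))]
  have e2 : ∀ w, edist (f w) (f x) = ENNReal.ofReal ‖F w - F x‖ := by
    intro w
    rw [edist_dist, NNReal.dist_eq, Real.norm_eq_abs]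
  have hint : IntegrableOn (fun w => ‖F w - F x‖) (Metric.closedBall x (R * c⁻¹)) :=
    ((hloc.integrableOn_isCompact (isCompact_closedBall _ _)).sub
      (integrableOn_const (by exact (isCompact_closedBall _ _).measure_lt_top.ne))).norm
  rw [e1]
  simp only [e2]
  rw [← ofReal_integral_eq_lintegral_ofReal hint (Eventually.of_forall fun _ => norm_nonneg _),
    ← ENNReal.ofReal_mul (by positivity), setAverage_eq, smul_eq_mul,
    Measure.addHaar_real_closedBall' volume x (by positivity), finrank_euclideanSpace_fin]
  congr 1
  have hV : volume.real (Metric.closedBall (0 : E d) 1) ≠ 0 :=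
    (ENNReal.toReal_pos (Metric.measure_closedBall_pos volume _ one_pos).ne'
      (isCompact_closedBall _ _).measure_lt_top.ne).ne'
  rw [mul_pow, inv_pow]
  have hcd : c ^ d ≠ 0 := by positivity
  generalize (∫ y in Metric.closedBall x (R * c⁻¹), ‖F y - F x‖) = I
  field_simp

section Transfer

variable [NeZero d] {f : E d → ℝ≥0} {b : ℝ≥0} {x : E d}

lemma cube_subset_closedBall (v z : E d) (a : ℝ) :
    cube (v + z) a ⊆ Metric.closedBall v (‖z‖ + √d * |a| + 1) := by
  intro w hw
  have ha : 0 < a := by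
    have := hw ⟨0, NeZero.pos d⟩
    linarith
  have hz : v + z ∈ cube (v + z) a := fun i => ⟨le_rfl, by linarith⟩
  have h1 := dist_le_of_mem_cube hw hz
  rw [Metric.mem_closedBall, abs_of_pos ha]
  have h2 : dist (v + z) v = ‖z‖ := by simp [dist_eq_norm]
  linarith [dist_triangle w (v + z) v]

/-- Around a Lebesgue point, bounds for the dilated processes pass to the homogeneous process. -/
theorem lintegral_law_le_of_lebesguePoint (hf : Measurable f) (hb : ∀ x, f x ≤ b)
    (hx : LebesguePoint f x) {Φ : Finset (E d) → ℝ≥0∞} (hΦ : Measurable Φ) {C : ℝ≥0∞}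
    {z : E d} {a : ℝ} (h : ∀ n : ℕ, 1 ≤ n →
      ∫⁻ s, Φ (translate (-(dil d n • x)) s) ∂law (dilated f n) (cube (dil d n • x + z) a) ≤ C) :
    ∫⁻ s, Φ s ∂law (fun _ => f x) (cube z a) ≤ C := by
  have hmin : ∀ M : ℕ, ∫⁻ s, min (Φ s) M ∂law (fun _ => f x) (cube z a) ≤ C := by
    intro M
    have ht : Tendsto (fun n : ℕ => C + M * ∫⁻ w in Metric.closedBall (dil d n • x)
        (‖z‖ + √d * |a| + 1), edist (dilated f n w) (f x)) atTop (𝓝 (C + M * 0)) :=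
      tendsto_const_nhds.add (ENNReal.Tendsto.const_mul (hx _ (by positivity))
        (Or.inr (ENNReal.natCast_ne_top M)))
    rw [mul_zero, add_zero] at ht
    refine ge_of_tendsto ht ?_
    filter_upwards [eventually_ge_atTop 1] with n hn
    set v := dil d n • x
    have hmm : Measurable fun s => min (Φ (translate (-v) s)) (M : ℝ≥0∞) :=
      (hΦ.comp (measurable_translate _)).min measurable_const
    have e1 : ∫⁻ s, min (Φ s) M ∂law (fun _ => f x) (cube z a) =
        ∫⁻ s, min (Φ (translate (-v) s)) M ∂law (fun _ => f x) (cube (v + z) a) := by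
      rw [← vadd_cube, lintegral_translate_law _ (isBounded_cube z a) v hmm]
      refine lintegral_congr fun s => ?_
      rw [translate_neg_translate]
    rw [e1]
    refine (lintegral_law_le_of_density (g₂ := dilated f n) (b := b) measurable_const
      (measurable_dilated hf n) (fun _ => hb x) (fun _ => hb _) (measurableSet_cube _ _)
      (isBounded_cube _ _) hmm (fun s => min_le_right _ _)).trans ?_
    refine add_le_add ((lintegral_mono fun s => min_le_left _ _).trans (h n hn)) ?_
    refine mul_le_mul_right ?_ _
    calc _ = ∫⁻ w in cube (v + z) a, edist (dilated f n w) (f x) :=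
          lintegral_congr fun w => edist_comm _ _
      _ ≤ _ := lintegral_mono_set (cube_subset_closedBall v z a)
  have hsup : ∀ s, Φ s = ⨆ M : ℕ, min (Φ s) M := by
    intro s
    rw [← inf_iSup_eq (Φ s), ENNReal.iSup_natCast, inf_top_eq]
  calc _ = ∫⁻ s, ⨆ M : ℕ, min (Φ s) M ∂law (fun _ => f x) (cube z a) :=
        lintegral_congr hsup
    _ = ⨆ M : ℕ, ∫⁻ s, min (Φ s) M ∂law (fun _ => f x) (cube z a) :=
        lintegral_iSup (fun M => hΦ.min measurable_const) (fun M N hMN s =>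
          min_le_min_left _ (by exact_mod_cast hMN))
    _ ≤ C := iSup_le hmin

lemma cost_moment_of_lebesguePoint (hf : Measurable f) (hb : ∀ x, f x ≤ b)
    (hx : LebesguePoint f x) {H : Finset (E d) → ℝ} (hH : Measurable H)
    (hinv : TranslationInvariant H) {p : ℝ} {C : ℝ≥0}
    (hC : ∀ n : ℕ, 1 ≤ n → ∀ (y z : E d) (a : ℝ), y ∈ cube z a →
      ∫⁻ s, ‖cost H y s‖ₑ ^ p ∂law (dilated f n) (cube z a) ≤ C)
    {y z : E d} {a : ℝ} (hy : y ∈ cube z a) :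
    ∫⁻ s, ‖cost H y s‖ₑ ^ p ∂law (fun _ => f x) (cube z a) ≤ C := by
  refine lintegral_law_le_of_lebesguePoint hf hb hx
    ((measurable_cost_apply hH y).enorm.pow_const p) fun n hn => ?_
  have e : ∀ s, cost H y (translate (-(dil d n • x)) s) = cost H (dil d n • x + y) s := by
    intro s
    rw [← cost_translate hinv (-(dil d n • x)) (dil d n • x + y), neg_add_cancel_left]
  simp only [e]
  refine hC n hn _ _ _ ?_
  rw [← vadd_cube]
  exact ⟨y, hy, rfl⟩

lemma moment_of_lebesguePoint (hf : Measurable f) (hb : ∀ x, f x ≤ b)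
    (hx : LebesguePoint f x) {H : Finset (E d) → ℝ} (hH : Measurable H)
    (hinv : TranslationInvariant H) {q : ℝ} {C : ℝ≥0} {a : ℝ}
    (hC : ∀ n : ℕ, 1 ≤ n → ∀ z : E d, ∫⁻ s, ‖H s‖ₑ ^ q ∂law (dilated f n) (cube z a) ≤ C)
    (z : E d) : ∫⁻ s, ‖H s‖ₑ ^ q ∂law (fun _ => f x) (cube z a) ≤ C := by
  refine lintegral_law_le_of_lebesguePoint hf hb hx (hH.enorm.pow_const q) fun n hn => ?_
  have e : ∀ s, H (translate (-(dil d n • x)) s) = H s := fun s => hinv _ s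
  simp only [e]
  exact hC n hn _

end Transfer

section UniformIntegrability

variable {X : Type*} [MeasurableSpace X]

/-- The law `P` exceeds the law `Q` by at most `τ` on measurable functions with values in
`[0, 1]`. -/
def ExceedsByAtMost (P Q : Measure X) (τ : ℝ≥0∞) : Prop :=
  ∀ Φ : X → ℝ≥0∞, Measurable Φ → ∀ M : ℝ≥0∞, (∀ s, Φ s ≤ M) →
    ∫⁻ s, Φ s ∂P ≤ ∫⁻ s, Φ s ∂Q + M * τ

/-- The truncation of a real number at level `M`. -/
noncomputable def clamp (M r : ℝ) : ℝ := max (-M) (min r M)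

lemma abs_clamp_le {M : ℝ} (hM : 0 ≤ M) (r : ℝ) : |clamp M r| ≤ M :=
  abs_le.2 ⟨le_max_left _ _, max_le (by linarith) (min_le_right _ _)⟩

lemma abs_sub_clamp_le {M : ℝ} (hM : 0 < M) {q : ℝ} (hq : 1 ≤ q) (r : ℝ) :
    |r - clamp M r| ≤ M ^ (1 - q) * |r| ^ q := by
  rcases le_or_gt |r| M with h | h
  · have : clamp M r = r := by
      rw [clamp, min_eq_left (abs_le.1 h).2, max_eq_right (abs_le.1 h).1]
    rw [this, sub_self, abs_zero]
    positivity
  · have h0 : 0 < |r| := hM.trans h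
    have h1 : |r - clamp M r| ≤ |r| := by
      rcases le_total 0 r with hr | hr
      · rw [abs_of_nonneg hr] at h
        have : clamp M r = M := by
          rw [clamp, min_eq_right h.le, max_eq_right (by linarith)]
        rw [this, abs_of_nonneg hr, abs_of_nonneg (by linarith)]
        linarith
      · rw [abs_of_nonpos hr] at h
        have : clamp M r = -M := by
          rw [clamp, min_eq_left (by linarith), max_eq_left (by linarith)]
        rw [this, abs_of_nonpos hr, abs_of_nonpos (by linarith)]
        linarith
    calc |r - clamp M r| ≤ |r| := h1
      _ = |r| ^ (1 - q) * |r| ^ q := by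
          rw [← Real.rpow_add h0, sub_add_cancel, Real.rpow_one]
      _ ≤ M ^ (1 - q) * |r| ^ q := by
          gcongr ?_ * _
          exact Real.rpow_le_rpow_of_nonpos hM h.le (by linarith)

lemma measurable_clamp (M : ℝ) : Measurable (clamp M) :=
  measurable_const.max (measurable_id.min measurable_const)

lemma integrable_of_lintegral_rpow_le {P : Measure X} [IsProbabilityMeasure P] {φ : X → ℝ}
    (hφ : Measurable φ) {q : ℝ} (hq : 1 ≤ q) {C : ℝ≥0} (h : ∫⁻ s, ‖φ s‖ₑ ^ q ∂P ≤ C) :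
    Integrable φ P := by
  have hL : MemLp φ (ENNReal.ofReal q) P := by
    refine ⟨hφ.aestronglyMeasurable, ?_⟩
    rw [eLpNorm_lt_top_iff_lintegral_rpow_enorm_lt_top (by simp; linarith) ENNReal.ofReal_ne_top,
      ENNReal.toReal_ofReal (by linarith)]
    exact h.trans_lt ENNReal.coe_lt_top
  exact hL.integrable (by simpa using hq)

lemma abs_integral_sub_clamp_le {P : Measure X} [IsProbabilityMeasure P] {φ : X → ℝ}
    (hφ : Measurable φ) {q : ℝ} (hq : 1 ≤ q) {C : ℝ≥0} (h : ∫⁻ s, ‖φ s‖ₑ ^ q ∂P ≤ C)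
    {M : ℝ} (hM : 0 < M) : |∫ s, φ s ∂P - ∫ s, clamp M (φ s) ∂P| ≤ M ^ (1 - q) * C := by
  have hi := integrable_of_lintegral_rpow_le hφ hq h
  have hic : Integrable (fun s => clamp M (φ s)) P :=
    Integrable.of_bound ((measurable_clamp M).comp hφ).aestronglyMeasurable M
      (Eventually.of_forall fun s => abs_clamp_le hM.le _)
  rw [← integral_sub hi hic, ← Real.norm_eq_abs]
  have h1 : ‖∫ s, (φ s - clamp M (φ s)) ∂P‖ₑ ≤ ENNReal.ofReal (M ^ (1 - q) * C) := by
    refine (enorm_integral_le_lintegral_enorm _).trans ?_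
    calc ∫⁻ s, ‖φ s - clamp M (φ s)‖ₑ ∂P ≤ ∫⁻ s, ENNReal.ofReal (M ^ (1 - q)) * ‖φ s‖ₑ ^ q ∂P := by
          refine lintegral_mono fun s => ?_
          rw [Real.enorm_eq_ofReal_abs, Real.enorm_eq_ofReal_abs,
            ENNReal.ofReal_rpow_of_nonneg (abs_nonneg _) (by linarith),
            ← ENNReal.ofReal_mul (by positivity)]
          exact ENNReal.ofReal_le_ofReal (abs_sub_clamp_le hM hq _)
      _ ≤ ENNReal.ofReal (M ^ (1 - q)) * C := by
          rw [lintegral_const_mul _ (hφ.enorm.pow_const q)]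
          gcongr
      _ = _ := by rw [ENNReal.ofReal_mul (by positivity), ENNReal.ofReal_coe_nnreal]
  rwa [← ofReal_norm, ENNReal.ofReal_le_ofReal_iff (by positivity)] at h1

lemma integral_clamp_sub_le {P Q : Measure X} [IsProbabilityMeasure P] [IsProbabilityMeasure Q]
    {τ : ℝ≥0} (h : ExceedsByAtMost P Q τ) {φ : X → ℝ} (hφ : Measurable φ) {M : ℝ} (hM : 0 ≤ M) :
    ∫ s, clamp M (φ s) ∂P - ∫ s, clamp M (φ s) ∂Q ≤ 2 * M * τ := by
  have hm : Measurable fun s => clamp M (φ s) := (measurable_clamp M).comp hφ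
  have hi : ∀ (μ : Measure X) [IsProbabilityMeasure μ], Integrable (fun s => clamp M (φ s)) μ :=
    fun μ _ => Integrable.of_bound hm.aestronglyMeasurable M
      (Eventually.of_forall fun s => abs_clamp_le hM _)
  have hpos : ∀ s, 0 ≤ clamp M (φ s) + M := fun s => by
    linarith [(abs_le.1 (abs_clamp_le hM (φ s))).1]
  have he : ∀ (μ : Measure X) [IsProbabilityMeasure μ],
      ∫⁻ s, ENNReal.ofReal (clamp M (φ s) + M) ∂μ =
        ENNReal.ofReal (∫ s, clamp M (φ s) ∂μ + M) := by
    intro μ _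
    have hi' : Integrable (fun s => clamp M (φ s) + M) μ := (hi μ).add (integrable_const M)
    rw [← ofReal_integral_eq_lintegral_ofReal hi' (Eventually.of_forall hpos)]
    congr 1
    rw [integral_add (hi μ) (integrable_const M)]
    simp
  have hQ0 : 0 ≤ ∫ s, clamp M (φ s) ∂Q + M := by
    have : 0 ≤ ∫ s, (clamp M (φ s) + M) ∂Q := integral_nonneg hpos
    rw [integral_add (hi Q) (integrable_const M)] at this
    simpa using this
  have h1 := h (fun s => ENNReal.ofReal (clamp M (φ s) + M)) (by fun_prop)
    (ENNReal.ofReal (2 * M)) (fun s => ENNReal.ofReal_le_ofReal (by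
      linarith [(abs_le.1 (abs_clamp_le hM (φ s))).2]))
  rw [he P, he Q, ← ENNReal.ofReal_coe_nnreal, ← ENNReal.ofReal_mul (by positivity),
    ← ENNReal.ofReal_add hQ0 (by positivity), ENNReal.ofReal_le_ofReal_iff (by positivity)] at h1
  linarith

/-- If two sequences of laws get close in total variation, the integrals of a function with
uniformly bounded moments of an order `q > 1` get close. -/
theorem tendsto_integral_sub {P Q : ℕ → Measure X} {τ : ℕ → ℝ≥0∞}
    (hPQ : ∀ᶠ n in atTop, IsProbabilityMeasure (P n) ∧ IsProbabilityMeasure (Q n) ∧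
      ExceedsByAtMost (P n) (Q n) (τ n) ∧ ExceedsByAtMost (Q n) (P n) (τ n))
    (hτ : Tendsto τ atTop (𝓝 0)) {φ : X → ℝ} (hφ : Measurable φ) {q : ℝ} (hq : 1 < q) {C : ℝ≥0}
    (hP : ∀ᶠ n in atTop, ∫⁻ s, ‖φ s‖ₑ ^ q ∂P n ≤ C)
    (hQ : ∀ᶠ n in atTop, ∫⁻ s, ‖φ s‖ₑ ^ q ∂Q n ≤ C) :
    Tendsto (fun n => ∫ s, φ s ∂P n - ∫ s, φ s ∂Q n) atTop (𝓝 0) := by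
  rw [Metric.tendsto_nhds]
  intro ε hε
  obtain ⟨M, hM0, hM⟩ : ∃ M : ℝ, 0 < M ∧ M ^ (1 - q) * C < ε / 4 := by
    have h1 : Tendsto (fun M : ℝ => M ^ (1 - q) * C) atTop (𝓝 0) := by
      have := (tendsto_rpow_neg_atTop (y := q - 1) (by linarith)).mul_const (C : ℝ)
      simpa using this
    exact ((eventually_gt_atTop 0).and (h1.eventually (gt_mem_nhds (by positivity)))).exists
  have hτ' : ∀ᶠ n in atTop, τ n < ENNReal.ofReal (ε / (8 * M)) :=
    hτ.eventually (gt_mem_nhds (ENNReal.ofReal_pos.2 (by positivity)))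
  filter_upwards [hPQ, hτ', hP, hQ] with n ⟨i1, i2, h1, h2⟩ hτn hPn hQn
  have hne : τ n ≠ ∞ := (hτn.trans ENNReal.ofReal_lt_top).ne
  lift τ n to ℝ≥0 using hne with t ht
  have htε : (t : ℝ) < ε / (8 * M) := by
    rw [← ENNReal.ofReal_coe_nnreal] at hτn
    exact (ENNReal.ofReal_lt_ofReal_iff (by positivity)).1 hτn
  have htM : 2 * M * t < ε / 4 := by
    rw [lt_div_iff₀ (by positivity)] at htε
    linarith
  have a1 := abs_le.1 (abs_integral_sub_clamp_le hφ hq.le hPn hM0)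
  have a2 := abs_le.1 (abs_integral_sub_clamp_le hφ hq.le hQn hM0)
  have a3 := integral_clamp_sub_le h1 hφ hM0.le
  have a4 := integral_clamp_sub_le h2 hφ hM0.le
  rw [Real.dist_eq, sub_zero, abs_lt]
  constructor <;> linarith [a1.1, a1.2, a2.1, a2.2]

end UniformIntegrability

/-! ### Stabilization and comparison of variances -/

lemma translate_union (v : E d) (s t : Finset (E d)) :
    translate v (s ∪ t) = translate v s ∪ translate v t := Finset.map_union _ _

lemma translate_translate_neg (v : E d) (s : Finset (E d)) :
    translate v (translate (-v) s) = s := by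
  have := translate_neg_translate (-v) s
  rwa [neg_neg] at this

lemma measurableSet_cost_union_ne {H : Finset (E d) → ℝ} (hH : Measurable H) (y : E d) (t : Finset (E d)) :
    MeasurableSet {s | cost H y (s ∪ t) ≠ cost H y s} :=
  (measurableSet_eq_fun ((measurable_cost_apply hH y).comp
    (measurable_union_config.comp measurable_prodMk_right)) (measurable_cost_apply hH y)).compl

section Stabilization

variable [NeZero d] {g : E d → ℝ≥0} {b l : ℝ≥0} {H : Finset (E d) → ℝ} {ρ : ℝ → ℝ≥0∞}

/-- The influence of distant points `t` on the add one cost at `y`, for a process whose intensity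
is nearly constant around `y`. -/
lemma law_cost_union_ne_le (hg : Measurable g) (hb : ∀ x, g x ≤ b) (hl : l ≤ b)
    (hH : Measurable H) (hinv : TranslationInvariant H) (hst : StabilizationTail H l ρ)
    (y : E d) (r : ℝ) (t : Finset (E d)) (ht : Disjoint (t : Set (E d)) (Metric.closedBall y r)) :
    law g (Metric.closedBall y r) {s | cost H y (s ∪ t) ≠ cost H y s} ≤
      ρ r + ∫⁻ z in Metric.closedBall y r, edist (g z) l := by
  have hBb : Bornology.IsBounded (Metric.closedBall y r) := Metric.isBounded_closedBall
  have hBm : MeasurableSet (Metric.closedBall y r) := Metric.isClosed_closedBall.measurableSet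
  have hE := measurableSet_cost_union_ne hH y t
  have h1 := lintegral_law_le_of_density (g₂ := fun _ => l) hg measurable_const hb (fun _ => hl)
    hBm hBb (Φ := {s | cost H y (s ∪ t) ≠ cost H y s}.indicator 1) (M := 1)
    (measurable_one.indicator hE) (fun s => Set.indicator_le_self' (by simp) s)
  rw [lintegral_indicator_one hE, lintegral_indicator_one hE, one_mul] at h1
  refine h1.trans (add_le_add ?_ le_rfl)
  have hball : Metric.closedBall y r = y +ᵥ Metric.closedBall (0 : E d) r := by
    ext x
    rw [Set.mem_vadd_set_iff_neg_vadd_mem]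
    simp [dist_eq_norm, neg_add_eq_sub]
  rw [hball, ← map_translate_law l Metric.isBounded_closedBall y,
    Measure.map_apply (measurable_translate y) hE]
  have hset : translate y ⁻¹' {s | cost H y (s ∪ t) ≠ cost H y s} =
      {s | cost H 0 (s ∪ translate (-y) t) ≠ cost H 0 s} := by
    ext s
    have e1 : cost H y (translate y s ∪ t) = cost H 0 (s ∪ translate (-y) t) := by
      conv_lhs => rw [← translate_translate_neg y t, ← translate_union, ← add_zero y]
      rw [add_zero, ← cost_translate hinv y 0, add_zero]
    have e2 : cost H y (translate y s) = cost H 0 s := by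
      rw [← cost_translate hinv y 0, add_zero]
    simp only [Set.mem_preimage, Set.mem_ofPred_eq, e1, e2]
  rw [hset]
  refine hst r _ (Set.disjoint_left.2 fun x hx hxB => ?_)
  rw [Finset.mem_coe, mem_translate, sub_neg_eq_add] at hx
  refine Set.disjoint_left.1 ht hx ?_
  rw [Metric.mem_closedBall, dist_eq_norm] at hxB ⊢
  simpa using hxB

/-- Removing the points outside of a region `V` around `y` rarely changes the add one cost. -/
theorem law_cost_ne_restr_le (hg : Measurable g) (hb : ∀ x, g x ≤ b) (hl : l ≤ b)
    (hH : Measurable H) (hinv : TranslationInvariant H) (hst : StabilizationTail H l ρ)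
    {W V : Set (E d)} (hW : Bornology.IsBounded W) (hV : MeasurableSet V) {y : E d} {r : ℝ}
    (hBW : Metric.closedBall y r ⊆ W) (hBV : Metric.closedBall y r ⊆ V) :
    law g W {s | cost H y s - cost H y (restr V s) ≠ 0} ≤
      2 * (ρ r + ∫⁻ z in Metric.closedBall y r, edist (g z) l) := by
  set B := Metric.closedBall y r with hB
  have hBm : MeasurableSet B := Metric.isClosed_closedBall.measurableSet
  have := isFiniteMeasure_intensity hb hW
  have hcost := measurable_cost_apply hH y
  -- the exceptional event, for the points outside of the ball that lie in `A`
  let F : Set (E d) → Set (Finset (E d) × Finset (E d)) := fun A =>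
    {p | cost H y (p.1 ∪ restr A (restr Bᶜ p.2)) ≠ cost H y p.1}
  have hF : ∀ A, MeasurableSet A → law g W {s | (restr B s, restr Bᶜ s) ∈ F A} ≤
      ρ r + ∫⁻ z in B, edist (g z) l := by
    intro A hA
    have hFm : MeasurableSet (F A) :=
      (measurableSet_eq_fun (hcost.comp (measurable_union_config.comp (measurable_fst.prodMk
        ((measurable_restr hA).comp ((measurable_restr hBm.compl).comp measurable_snd)))))
        (hcost.comp measurable_fst)).compl
    have hm : Measurable fun s : Finset (E d) => (restr B s, restr Bᶜ s) :=
      (measurable_restr hBm).prodMk (measurable_restr hBm.compl)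
    change law g W ((fun s => (restr B s, restr Bᶜ s)) ⁻¹' F A) ≤ _
    rw [← Measure.map_apply hm hFm, law, map_restr_prod_poissonLaw _ hBm,
      Measure.prod_apply_symm hFm, Measure.restrict_restrict hBm, Set.inter_eq_left.2 hBW]
    have : IsProbabilityMeasure (poissonLaw (((intensity g).restrict W).restrict Bᶜ)) :=
      inferInstance
    calc _ ≤ ∫⁻ _, (ρ r + ∫⁻ z in B, edist (g z) l)
          ∂poissonLaw (((intensity g).restrict W).restrict Bᶜ) := by
          refine lintegral_mono fun t => ?_
          refine law_cost_union_ne_le hg hb hl hH hinv hst y r (restr A (restr Bᶜ t)) ?_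
          rw [Set.disjoint_left]
          intro x hx
          rw [Finset.mem_coe, mem_restr, mem_restr] at hx
          exact hx.1.2
      _ = _ := by rw [lintegral_const, measure_univ, mul_one]
  have hsub : {s | cost H y s - cost H y (restr V s) ≠ 0} ⊆
      {s | (restr B s, restr Bᶜ s) ∈ F Set.univ} ∪ {s | (restr B s, restr Bᶜ s) ∈ F V} := by
    intro s hs
    by_contra hcon
    simp only [Set.mem_union, Set.mem_ofPred_eq, F, not_or, not_not] at hcon
    have e1 : restr B s ∪ restr Set.univ (restr Bᶜ (restr Bᶜ s)) = s := by
      ext x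
      simp only [Finset.mem_union, mem_restr, Set.mem_compl_iff, Set.mem_univ, and_true]
      tauto
    have e2 : restr B s ∪ restr V (restr Bᶜ (restr Bᶜ s)) = restr V s := by
      ext x
      simp only [Finset.mem_union, mem_restr, Set.mem_compl_iff]
      have : x ∈ B → x ∈ V := fun h => hBV h
      tauto
    rw [e1, e2] at hcon
    exact hs (by rw [hcon.1, hcon.2, sub_self])
  refine (measure_mono hsub).trans ((measure_union_le _ _).trans ?_)
  rw [two_mul]
  exact add_le_add (hF _ MeasurableSet.univ) (hF _ hV)

end Stabilization

lemma enorm_sq_le_indicator_add {p : ℝ} (hp : 2 < p) (M : ℝ≥0) (r : ℝ) :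
    ‖r‖ₑ ^ 2 ≤ (M : ℝ≥0∞) ^ 2 * ({r : ℝ | r ≠ 0}.indicator 1 r) +
      (M : ℝ≥0∞) ^ (2 - p) * ‖r‖ₑ ^ p := by
  by_cases hr : r = 0
  · simp [hr]
  have hmem : r ∈ {r : ℝ | r ≠ 0} := hr
  rw [Set.indicator_of_mem hmem, Pi.one_apply, mul_one]
  rcases le_total ‖r‖ₑ (M : ℝ≥0∞) with h | h
  · exact le_add_right (by gcongr)
  · refine le_add_left ?_
    have h0 : ‖r‖ₑ ≠ 0 := by simpa using hr
    calc ‖r‖ₑ ^ 2 = ‖r‖ₑ ^ (2 - p) * ‖r‖ₑ ^ p := by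
          rw [← ENNReal.rpow_add _ _ h0 enorm_ne_top, sub_add_cancel, ENNReal.rpow_two]
      _ ≤ (M : ℝ≥0∞) ^ (2 - p) * ‖r‖ₑ ^ p := by
          gcongr ?_ * _
          rw [← neg_sub p 2, ENNReal.rpow_neg, ENNReal.rpow_neg]
          exact ENNReal.inv_le_inv.2 (ENNReal.rpow_le_rpow h (by linarith))

section Moments

variable {X : Type*} [MeasurableSpace X] {μ : Measure X} {p : ℝ} {C : ℝ≥0∞}

lemma lintegral_sq_le (hp : 2 < p) (M : ℝ≥0) {Z : X → ℝ} (hZ : Measurable Z) :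
    ∫⁻ s, ‖Z s‖ₑ ^ 2 ∂μ ≤ (M : ℝ≥0∞) ^ 2 * μ {s | Z s ≠ 0} +
      (M : ℝ≥0∞) ^ (2 - p) * ∫⁻ s, ‖Z s‖ₑ ^ p ∂μ := by
  have hm : MeasurableSet {s | Z s ≠ 0} := (measurableSet_eq_fun hZ measurable_const).compl
  calc _ ≤ ∫⁻ s, ((M : ℝ≥0∞) ^ 2 * ({s | Z s ≠ 0}.indicator 1 s) +
        (M : ℝ≥0∞) ^ (2 - p) * ‖Z s‖ₑ ^ p) ∂μ :=
        lintegral_mono fun s => enorm_sq_le_indicator_add hp M (Z s)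
    _ = _ := by
        rw [lintegral_add_left ((measurable_one.indicator hm).const_mul _),
          lintegral_const_mul _ (measurable_one.indicator hm), lintegral_indicator_one hm,
          lintegral_const_mul _ (hZ.enorm.pow_const p)]

lemma lintegral_sub_rpow_le (hp : 1 ≤ p) {Y Z : X → ℝ} (hY : Measurable Y)
    (h1 : ∫⁻ s, ‖Y s‖ₑ ^ p ∂μ ≤ C) (h2 : ∫⁻ s, ‖Z s‖ₑ ^ p ∂μ ≤ C) :
    ∫⁻ s, ‖Y s - Z s‖ₑ ^ p ∂μ ≤ 2 ^ (p - 1) * (C + C) := by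
  calc _ ≤ ∫⁻ s, 2 ^ (p - 1) * (‖Y s‖ₑ ^ p + ‖Z s‖ₑ ^ p) ∂μ := by
        refine lintegral_mono fun s => ?_
        refine (ENNReal.rpow_le_rpow enorm_sub_le (by linarith)).trans ?_
        exact ENNReal.rpow_add_le_mul_rpow_add_rpow _ _ hp
    _ = 2 ^ (p - 1) * (∫⁻ s, ‖Y s‖ₑ ^ p ∂μ + ∫⁻ s, ‖Z s‖ₑ ^ p ∂μ) := by
        rw [lintegral_const_mul' _ _ (by finiteness), lintegral_add_left (hY.enorm.pow_const p)]
    _ ≤ _ := by gcongr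

lemma lintegral_sq_le_one_add [IsProbabilityMeasure μ] (hp : 2 < p) {Z : X → ℝ}
    (hZ : Measurable Z) (h : ∫⁻ s, ‖Z s‖ₑ ^ p ∂μ ≤ C) : ∫⁻ s, ‖Z s‖ₑ ^ 2 ∂μ ≤ 1 + C := by
  refine (lintegral_sq_le hp 1 hZ).trans ?_
  simp only [ENNReal.coe_one, one_pow, one_mul, ENNReal.one_rpow]
  exact add_le_add prob_le_one h

lemma memLp_two_of_lintegral_rpow_le [IsProbabilityMeasure μ] (hp : 2 < p) {Z : X → ℝ}
    (hZ : Measurable Z) (hC : C ≠ ∞) (h : ∫⁻ s, ‖Z s‖ₑ ^ p ∂μ ≤ C) : MemLp Z 2 μ := by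
  refine ⟨hZ.aestronglyMeasurable, ?_⟩
  rw [eLpNorm_lt_top_iff_lintegral_rpow_enorm_lt_top (by simp) (by simp)]
  refine lt_of_le_of_lt ?_ (ENNReal.add_lt_top.2 ⟨ENNReal.one_lt_top, hC.lt_top⟩)
  simpa using lintegral_sq_le_one_add hp hZ h

/-- The triangle inequality for standard deviations. -/
lemma sqrt_variance_le_add [IsProbabilityMeasure μ] {F G : X → ℝ} (hF : MemLp F 2 μ)
    (hG : MemLp G 2 μ) : √(Var[F; μ]) ≤ √(Var[G; μ]) + √(Var[fun x => F x - G x; μ]) := by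
  set D : X → ℝ := fun x => F x - G x with hD
  have hDL : MemLp D 2 μ := hF.sub hG
  have hquad : ∀ t : ℝ, 0 ≤ Var[D; μ] * (t * t) + 2 * cov[G, D; μ] * t + Var[G; μ] := by
    intro t
    have h := variance_nonneg (fun x => G x + t * D x) μ
    rw [variance_fun_add hG (hDL.const_mul t), variance_const_mul, covariance_const_mul_right] at h
    linarith
  have hdisc := discrim_le_zero hquad
  rw [discrim] at hdisc
  have hcov : cov[G, D; μ] ≤ √(Var[G; μ]) * √(Var[D; μ]) := by
    rw [← Real.sqrt_mul (variance_nonneg _ _)]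
    exact Real.le_sqrt_of_sq_le (by linarith)
  have hFe : F = fun x => G x + D x := by
    ext x
    simp [hD]
  have hVar : Var[F; μ] = Var[G; μ] + 2 * cov[G, D; μ] + Var[D; μ] := by
    conv_lhs => rw [hFe]
    exact variance_fun_add hG hDL
  rw [Real.sqrt_le_left (by positivity), hVar]
  nlinarith [Real.sq_sqrt (variance_nonneg G μ), Real.sq_sqrt (variance_nonneg D μ)]

lemma abs_sqrt_variance_sub_le [IsProbabilityMeasure μ] {F G : X → ℝ} (hF : MemLp F 2 μ)
    (hG : MemLp G 2 μ) :
    |√(Var[F; μ]) - √(Var[G; μ])| ≤ √(Var[fun x => F x - G x; μ]) := by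
  have h1 := sqrt_variance_le_add hF hG
  have h2 := sqrt_variance_le_add hG hF
  have e : Var[fun x => G x - F x; μ] = Var[fun x => F x - G x; μ] := by
    rw [← variance_fun_neg]
    simp
  rw [e] at h2
  rw [abs_le]
  constructor <;> linarith

end Moments

/-! ### Cutting a window into cells -/

/-- The corner of the cell of index `i` in the cubic lattice of mesh `L`. -/
noncomputable def corner (L : ℝ) (i : Fin d → ℤ) : E d := WithLp.toLp 2 fun j => L * i j

/-- The cell of index `i` in the cubic lattice of mesh `L`. -/
noncomputable def cell (L : ℝ) (i : Fin d → ℤ) : Set (E d) := cube (corner L i) L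

/-- The index of the cell that contains `y`. -/
noncomputable def idx (L : ℝ) (y : E d) : Fin d → ℤ := fun j => ⌊y j / L⌋

/-- The points at a distance (in every coordinate) at least `r` from the boundary of the cell. -/
noncomputable def innerCell (L r : ℝ) (i : Fin d → ℤ) : Set (E d) :=
  cube (WithLp.toLp 2 fun j => L * i j + r) (L - 2 * r)

lemma mem_cell_iff {L : ℝ} (hL : 0 < L) {i : Fin d → ℤ} {y : E d} :
    y ∈ cell L i ↔ idx L y = i := by
  simp only [cell, cube, corner, Set.mem_ofPred_eq, idx, funext_iff, Int.floor_eq_iff,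
    le_div_iff₀ hL, div_lt_iff₀ hL, add_mul, one_mul, mul_comm L]

lemma measurableSet_cell (L : ℝ) (i : Fin d → ℤ) : MeasurableSet (cell L i) :=
  measurableSet_cube _ _

lemma measurable_idx (L : ℝ) : Measurable (idx (d := d) L) :=
  measurable_pi_lambda _ fun j => Int.measurable_floor.comp
    (((measurable_pi_apply j).comp (PiLp.volume_preserving_ofLp (Fin d)).measurable).div_const L)

lemma disjoint_cell {L : ℝ} (hL : 0 < L) {i j : Fin d → ℤ} (hij : i ≠ j) :
    Disjoint (cell (d := d) L i) (cell L j) :=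
  Set.disjoint_left.2 fun _ hx hx' => hij (((mem_cell_iff hL).1 hx).symm.trans
    ((mem_cell_iff hL).1 hx'))

lemma volume_cell (L : ℝ) (i : Fin d → ℤ) : volume (cell L i) = ENNReal.ofReal L ^ d :=
  volume_cube _ _

lemma volume_innerCell (L r : ℝ) (i : Fin d → ℤ) :
    volume (innerCell L r i) = ENNReal.ofReal (L - 2 * r) ^ d := volume_cube _ _

lemma closedBall_subset_cell {L r : ℝ} {i : Fin d → ℤ} {y : E d} (hy : y ∈ innerCell L r i) :
    Metric.closedBall y r ⊆ cell L i := by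
  intro z hz j
  have h1 := hy j
  have h2 : |z j - y j| ≤ r := by
    refine le_trans ?_ (mem_closedBall_iff_norm.1 hz)
    exact PiLp.norm_apply_le (z - y) j
  have h3 := abs_le.1 h2
  simp only [corner] at h1 ⊢
  constructor <;> linarith

lemma innerCell_subset_cell {L r : ℝ} (hr : 0 ≤ r) (i : Fin d → ℤ) :
    innerCell (d := d) L r i ⊆ cell L i := fun _ hy =>
  closedBall_subset_cell hy (Metric.mem_closedBall_self hr)

/-- The sum of the values of `H` on the restrictions of the configuration to the cells with indices
in `I`. -/
noncomputable def blockSum (H : Finset (E d) → ℝ) (L : ℝ) (I : Finset (Fin d → ℤ))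
    (s : Finset (E d)) : ℝ := ∑ i ∈ I, H (restr (cell L i) s)

lemma measurable_comp_restr {H : Finset (E d) → ℝ} (hH : Measurable H) {A : Set (E d)}
    (hA : MeasurableSet A) : Measurable fun s => H (restr A s) := hH.comp (measurable_restr hA)

lemma measurable_blockSum {H : Finset (E d) → ℝ} (hH : Measurable H) (L : ℝ)
    (I : Finset (Fin d → ℤ)) : Measurable (blockSum H L I) :=
  Finset.measurable_sum _ fun i _ => measurable_comp_restr hH (measurableSet_cell L i)

lemma restr_insert_of_mem {A : Set (E d)} {y : E d} (hy : y ∈ A) (s : Finset (E d)) :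
    restr A (insert y s) = insert y (restr A s) := by
  ext x
  simp only [mem_restr, Finset.mem_insert]
  constructor
  · tauto
  · rintro (rfl | h) <;> tauto

lemma restr_insert_of_notMem {A : Set (E d)} {y : E d} (hy : y ∉ A) (s : Finset (E d)) :
    restr A (insert y s) = restr A s := by
  ext x
  simp only [mem_restr, Finset.mem_insert]
  constructor
  · rintro ⟨rfl | h, hA⟩ <;> tauto
  · tauto

lemma cost_blockSum_of_mem {H : Finset (E d) → ℝ} {L : ℝ} (hL : 0 < L) {I : Finset (Fin d → ℤ)}
    {y : E d} (hy : idx L y ∈ I) (s : Finset (E d)) :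
    cost (blockSum H L I) y s = cost H y (restr (cell L (idx L y)) s) := by
  rw [cost, blockSum, blockSum, ← Finset.sum_sub_distrib, Finset.sum_eq_single_of_mem _ hy]
  · rw [restr_insert_of_mem ((mem_cell_iff hL).2 rfl), cost]
  · intro j _ hj
    rw [restr_insert_of_notMem, sub_self]
    exact fun h => hj ((mem_cell_iff hL).1 h).symm

lemma cost_blockSum_of_notMem {H : Finset (E d) → ℝ} {L : ℝ} (hL : 0 < L) {I : Finset (Fin d → ℤ)}
    {y : E d} (hy : idx L y ∉ I) (s : Finset (E d)) : cost (blockSum H L I) y s = 0 := by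
  rw [cost, blockSum, blockSum, ← Finset.sum_sub_distrib]
  refine Finset.sum_eq_zero fun j hj => ?_
  rw [restr_insert_of_notMem, sub_self]
  exact fun h => hy (((mem_cell_iff hL).1 h).symm ▸ hj)

lemma cost_sub (F G : Finset (E d) → ℝ) (y : E d) (s : Finset (E d)) :
    cost (fun s => F s - G s) y s = cost F y s - cost G y s := by
  simp only [cost]
  ring

/-- The mean square add one cost at `y` of the error made by cutting the window `W` into cells. -/
noncomputable def errCost (H : Finset (E d) → ℝ) (L : ℝ) (I : Finset (Fin d → ℤ))
    (P : Measure (Finset (E d))) (y : E d) : ℝ≥0∞ :=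
  ∫⁻ s, ‖cost (fun s => H s - blockSum H L I s) y s‖ₑ ^ 2 ∂P

lemma measurable_errCost {H : Finset (E d) → ℝ} {L : ℝ}
    {I : Finset (Fin d → ℤ)} (hH : Measurable H) (P : Measure (Finset (E d))) [SFinite P] :
    Measurable (errCost H L I P) := by
  have : Measurable fun p : E d × Finset (E d) =>
      ‖cost (fun s => H s - blockSum H L I s) p.1 p.2‖ₑ ^ 2 :=
    (measurable_cost (hH.sub (measurable_blockSum hH L I))).enorm.pow_const 2
  exact this.lintegral_prod_right'

section Block

variable [NeZero d] {g : E d → ℝ≥0} {b : ℝ≥0} {H : Finset (E d) → ℝ} {W : Set (E d)} {L : ℝ}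
  {I : Finset (Fin d → ℤ)}

lemma lintegral_comp_restr_law (hb : ∀ x, g x ≤ b) (hW : Bornology.IsBounded W) {V : Set (E d)}
    (hV : MeasurableSet V) (hVW : V ⊆ W) {Φ : Finset (E d) → ℝ≥0∞} (hΦ : Measurable Φ) :
    ∫⁻ s, Φ (restr V s) ∂law g W = ∫⁻ s, Φ s ∂law g V := by
  rw [← map_restr_law hb hW hV hVW, lintegral_map hΦ (measurable_restr hV)]

lemma memLp_comp_restr (hb : ∀ x, g x ≤ b) (hW : Bornology.IsBounded W) {V : Set (E d)}
    (hV : MeasurableSet V) (hVW : V ⊆ W) (hL2 : MemLp H 2 (law g V)) :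
    MemLp (fun s => H (restr V s)) 2 (law g W) := by
  rw [← map_restr_law hb hW hV hVW] at hL2
  exact hL2.comp_of_map (measurable_restr hV).aemeasurable

lemma variance_comp_restr (hb : ∀ x, g x ≤ b) (hW : Bornology.IsBounded W) (hH : Measurable H)
    {V : Set (E d)} (hV : MeasurableSet V) (hVW : V ⊆ W) :
    Var[fun s => H (restr V s); law g W] = Var[H; law g V] := by
  rw [← map_restr_law hb hW hV hVW, variance_map hH.aemeasurable (measurable_restr hV).aemeasurable]
  rfl

lemma memLp_blockSum (hb : ∀ x, g x ≤ b) (hW : Bornology.IsBounded W)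
    (hIW : ∀ i ∈ I, cell L i ⊆ W) (hL2 : ∀ i ∈ I, MemLp H 2 (law g (cell L i))) :
    MemLp (blockSum H L I) 2 (law g W) :=
  memLp_finsetSum I fun i hi =>
    memLp_comp_restr hb hW (measurableSet_cell L i) (hIW i hi) (hL2 i hi)

lemma indepFun_comp_restr (hb : ∀ x, g x ≤ b) (hW : Bornology.IsBounded W) (hH : Measurable H)
    (hL : 0 < L) {i j : Fin d → ℤ} (hij : i ≠ j) :
    IndepFun (fun s => H (restr (cell L i) s)) (fun s => H (restr (cell L j) s)) (law g W) := by
  have := isFiniteMeasure_intensity hb hW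
  exact (indepFun_restr _ (measurableSet_cell L i) (measurableSet_cell L j)
    (disjoint_cell hL hij)).comp hH hH

/-- The variance of the sum over the cells is the sum of the variances. -/
lemma variance_blockSum (hb : ∀ x, g x ≤ b) (hW : Bornology.IsBounded W) (hH : Measurable H)
    (hL : 0 < L) (hIW : ∀ i ∈ I, cell L i ⊆ W) (hL2 : ∀ i ∈ I, MemLp H 2 (law g (cell L i))) :
    Var[blockSum H L I; law g W] = ∑ i ∈ I, Var[H; law g (cell L i)] := by
  have e : blockSum H L I = ∑ i ∈ I, fun s => H (restr (cell L i) s) := by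
    ext s
    rw [blockSum, Finset.sum_apply]
  rw [e, IndepFun.variance_sum
    (fun i hi => memLp_comp_restr hb hW (measurableSet_cell L i) (hIW i hi) (hL2 i hi))
    (fun i _ j _ hij => indepFun_comp_restr hb hW hH hL hij)]
  exact Finset.sum_congr rfl fun i hi =>
    variance_comp_restr hb hW hH (measurableSet_cell L i) (hIW i hi)

/-- By the Poincaré inequality, the variance of the error made by cutting the window into cells is
controlled by add one costs. -/
lemma evariance_sub_blockSum_le (hg : Measurable g) (hb : ∀ x, g x ≤ b)
    (hW : Bornology.IsBounded W) (hWm : MeasurableSet W) (hH : Measurable H)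
    (hIW : ∀ i ∈ I, cell L i ⊆ W) (hL2W : MemLp H 2 (law g W))
    (hL2 : ∀ i ∈ I, MemLp H 2 (law g (cell L i))) :
    evariance (fun s => H s - blockSum H L I s) (law g W) ≤
      ∫⁻ y in W, g y * errCost H L I (law g W) y := by
  have := isFiniteMeasure_intensity hb hW
  have := isProbabilityMeasure_law hb hW
  refine (evariance_le_energy ((intensity g).restrict W) (hH.sub (measurable_blockSum hH L I))
    (hL2W.sub (memLp_blockSum hb hW hIW hL2))).trans_eq ?_
  change ∫⁻ y in W, errCost H L I (law g W) y ∂intensity g = _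
  rw [setLIntegral_withDensity_eq_setLIntegral_mul _ hg.coe_nnreal_ennreal
    (measurable_errCost hH (law g W)) hWm]
  rfl

end Block

/-- `C` bounds the moments of order `p` of the add one cost of `H`, for the process with intensity
function `g`, uniformly in the cubical window and the position of the added point. -/
def CostBound (H : Finset (E d) → ℝ) (g : E d → ℝ≥0) (p : ℝ) (C : ℝ≥0) : Prop :=
  ∀ (y z : E d) (a : ℝ), y ∈ cube z a → ∫⁻ s, ‖cost H y s‖ₑ ^ p ∂law g (cube z a) ≤ C

/-- A bound for the moments of order `p` of the difference of two add one costs. -/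
noncomputable def diffBound (p : ℝ) (C : ℝ≥0) : ℝ≥0∞ := 2 ^ (p - 1) * ((C : ℝ≥0∞) + C)

lemma diffBound_ne_top (p : ℝ) (C : ℝ≥0) : diffBound p C ≠ ∞ := by
  rw [diffBound]
  finiteness

lemma le_diffBound {p : ℝ} (hp : 2 < p) (C : ℝ≥0) : (C : ℝ≥0∞) ≤ diffBound p C := by
  rw [diffBound]
  have h1 : (1 : ℝ≥0∞) ≤ 2 ^ (p - 1) := ENNReal.one_le_rpow (by norm_num) (by linarith)
  calc (C : ℝ≥0∞) ≤ 1 * (C + C) := by rw [one_mul]; exact le_self_add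
    _ ≤ _ := by gcongr

section ErrCost

variable [NeZero d] {g : E d → ℝ≥0} {b l : ℝ≥0} {H : Finset (E d) → ℝ} {z : E d} {a L p : ℝ}
  {C : ℝ≥0} {I : Finset (Fin d → ℤ)}

lemma lintegral_cost_restr_le (hb : ∀ x, g x ≤ b) (hH : Measurable H) (hC : CostBound H g p C)
    (hL : 0 < L) {y : E d} (hV : cell L (idx L y) ⊆ cube z a) :
    ∫⁻ s, ‖cost H y (restr (cell L (idx L y)) s)‖ₑ ^ p ∂law g (cube z a) ≤ C := by
  rw [lintegral_comp_restr_law hb (isBounded_cube z a) (measurableSet_cell _ _) hV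
    ((measurable_cost_apply hH y).enorm.pow_const p)]
  exact hC _ _ _ ((mem_cell_iff hL).2 rfl)

/-- A bound for the mean square error cost that holds everywhere in the window; it is used for the
points close to the boundary of a cell. -/
lemma errCost_le (hp : 2 < p) (hb : ∀ x, g x ≤ b) (hH : Measurable H) (hC : CostBound H g p C)
    (hL : 0 < L) (hIW : ∀ i ∈ I, cell L i ⊆ cube z a) {y : E d} (hy : y ∈ cube z a) :
    errCost H L I (law g (cube z a)) y ≤ 1 + diffBound p C := by
  have := isProbabilityMeasure_law hb (isBounded_cube z a)
  have hcost := measurable_cost_apply hH y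
  simp only [errCost, cost_sub]
  by_cases hi : idx L y ∈ I
  · simp only [cost_blockSum_of_mem hL hi]
    exact lintegral_sq_le_one_add hp
      (hcost.sub (hcost.comp (measurable_restr (measurableSet_cell L _))))
      (lintegral_sub_rpow_le (by linarith) hcost (hC y z a hy)
        (lintegral_cost_restr_le hb hH hC hL (hIW _ hi)))
  · simp only [cost_blockSum_of_notMem hL hi, sub_zero]
    exact lintegral_sq_le_one_add hp hcost ((hC y z a hy).trans (le_diffBound hp C))

/-- Far from the boundary of its cell, a point has a small error cost: by stabilization, its add one
cost in the window and in the cell differ with a small probability only, and the moments of order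
`p > 2` control what happens then, by truncation at the level `M`. -/
lemma errCost_le_of_inner (hp : 2 < p) (hg : Measurable g) (hb : ∀ x, g x ≤ b) (hl : l ≤ b)
    (hH : Measurable H) (hinv : TranslationInvariant H) {ρ : ℝ → ℝ≥0∞}
    (hst : StabilizationTail H l ρ) (hC : CostBound H g p C) (hL : 0 < L)
    (hIW : ∀ i ∈ I, cell L i ⊆ cube z a) {i : Fin d → ℤ} (hi : i ∈ I) {r : ℝ} (hr : 0 ≤ r)
    {y : E d} (hy : y ∈ innerCell L r i) (M : ℝ≥0) :
    errCost H L I (law g (cube z a)) y ≤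
      (M : ℝ≥0∞) ^ 2 * (2 * (ρ r + ∫⁻ w in Metric.closedBall y r, edist (g w) l)) +
        (M : ℝ≥0∞) ^ (2 - p) * diffBound p C := by
  have hyc : y ∈ cell L i := innerCell_subset_cell hr i hy
  obtain rfl : idx L y = i := (mem_cell_iff hL).1 hyc
  have hball := closedBall_subset_cell hy
  have hcost := measurable_cost_apply hH y
  simp only [errCost, cost_sub, cost_blockSum_of_mem hL hi]
  refine (lintegral_sq_le hp M
    (hcost.sub (hcost.comp (measurable_restr (measurableSet_cell L _))))).trans ?_
  gcongr
  · exact law_cost_ne_restr_le hg hb hl hH hinv hst (isBounded_cube z a)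
      (measurableSet_cell L _) (hball.trans (hIW _ hi)) hball
  · exact lintegral_sub_rpow_le (by linarith) hcost (hC y z a (hIW _ hi hyc))
      (lintegral_cost_restr_le hb hH hC hL (hIW _ hi))

end ErrCost

/-! ### Boxes of cells -/

/-- The indices `i` with `m ≤ i j < m + N` for all `j`. -/
noncomputable def box (m : ℤ) (N : ℕ) : Finset (Fin d → ℤ) :=
  Fintype.piFinset fun _ => Finset.Ico m (m + N)

lemma card_box (m : ℤ) (N : ℕ) : (box m N : Finset (Fin d → ℤ)).card = N ^ d := by
  simp [box, Fintype.card_piFinset]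

lemma mem_cube_iff_idx_mem_box {L : ℝ} (hL : 0 < L) {m : ℤ} {N : ℕ} {y : E d} :
    y ∈ cube (corner L fun _ => m) (N * L) ↔ idx L y ∈ box m N := by
  simp only [cube, corner, Set.mem_ofPred_eq, idx, box, Fintype.mem_piFinset, Finset.mem_Ico,
    Int.le_floor, Int.floor_lt, le_div_iff₀ hL, div_lt_iff₀ hL]
  push_cast
  simp only [add_mul, mul_comm L]

lemma cell_subset_cube {L : ℝ} (hL : 0 < L) {m : ℤ} {N : ℕ} {i : Fin d → ℤ} (hi : i ∈ box m N) :
    cell L i ⊆ cube (corner L fun _ => m) (N * L) := fun y hy => by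
  rw [mem_cube_iff_idx_mem_box hL, (mem_cell_iff hL).1 hy]
  exact hi

/-- The points of the cells with index in `I` which are far from the boundary of their cell. -/
noncomputable def innerRegion (L r : ℝ) (I : Finset (Fin d → ℤ)) : Set (E d) :=
  ⋃ i ∈ I, innerCell L r i

lemma measurableSet_innerRegion (L r : ℝ) (I : Finset (Fin d → ℤ)) :
    MeasurableSet (innerRegion L r I) :=
  I.measurableSet_biUnion fun _ _ => measurableSet_cube _ _

lemma volume_innerRegion {L r : ℝ} (hL : 0 < L) (hr : 0 ≤ r) (I : Finset (Fin d → ℤ)) :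
    volume (innerRegion L r I) = I.card * ENNReal.ofReal (L - 2 * r) ^ d := by
  rw [innerRegion, measure_biUnion_finset (fun i _ j _ hij => (disjoint_cell hL hij).mono
    (innerCell_subset_cell hr i) (innerCell_subset_cell hr j)) fun _ _ => measurableSet_cube _ _]
  simp [volume_innerCell]

lemma volume_cube_diff_innerRegion {L r a : ℝ} (hL : 0 < L) (hr : 0 ≤ r) (hrL : 2 * r ≤ L)
    (ha : 0 ≤ a) {I : Finset (Fin d → ℤ)} {z : E d} (hI : ∀ i ∈ I, cell L i ⊆ cube z a) :
    volume (cube z a \ innerRegion L r I) =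
      ENNReal.ofReal (a ^ d - I.card * (L - 2 * r) ^ d) := by
  have hs : innerRegion L r I ⊆ cube z a :=
    Set.iUnion₂_subset fun i hi => (innerCell_subset_cell hr i).trans (hI i hi)
  have hv := volume_innerRegion hL hr I
  have h0 : 0 ≤ L - 2 * r := by linarith
  rw [measure_sdiff hs (measurableSet_innerRegion L r I).nullMeasurableSet (by rw [hv]; finiteness),
    hv, volume_cube, ENNReal.ofReal_sub (a ^ d) (by positivity), ENNReal.ofReal_mul (by positivity),
    ENNReal.ofReal_pow ha, ENNReal.ofReal_pow h0, ENNReal.ofReal_natCast]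

/-- The bounds for the error costs can be made small: truncation at a high level `M` first, then
a large radius `r`. -/
lemma exists_truncation {p : ℝ} (hp : 2 < p) {D : ℝ≥0∞} (hD : D ≠ ∞) {ε : ℝ≥0∞} (hε : 0 < ε) :
    ∃ M : ℝ≥0, ∀ T : ℕ → ℝ≥0∞, Tendsto T atTop (𝓝 0) →
      ∀ᶠ n in atTop, (M : ℝ≥0∞) ^ 2 * (2 * T n) + (M : ℝ≥0∞) ^ (2 - p) * D < ε := by
  have h1 : Tendsto (fun M : ℝ≥0 => (M : ℝ≥0∞) ^ (2 - p) * D) atTop (𝓝 (0 * D)) := by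
    refine ENNReal.Tendsto.mul_const ?_ (Or.inr hD)
    have h2 : Tendsto (fun M : ℝ≥0 => M ^ (-(p - 2))) atTop (𝓝 0) :=
      NNReal.tendsto_coe.1
        ((tendsto_rpow_neg_atTop (sub_pos.2 hp)).comp (NNReal.tendsto_coe_atTop.2 tendsto_id))
    refine (ENNReal.tendsto_coe.2 h2).congr' ?_
    filter_upwards [eventually_gt_atTop 0] with M hM
    rw [ENNReal.coe_rpow_of_ne_zero hM.ne', neg_sub]
  rw [zero_mul] at h1
  obtain ⟨M, hM⟩ := (h1.eventually_lt_const hε).exists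
  refine ⟨M, fun T hT => ?_⟩
  have h3 : Tendsto (fun n => (M : ℝ≥0∞) ^ 2 * (2 * T n) + (M : ℝ≥0∞) ^ (2 - p) * D) atTop
      (𝓝 ((M : ℝ≥0∞) ^ 2 * (2 * 0) + (M : ℝ≥0∞) ^ (2 - p) * D)) :=
    (ENNReal.Tendsto.const_mul (ENNReal.Tendsto.const_mul hT (Or.inr (by simp)))
      (Or.inr (by finiteness))).add tendsto_const_nhds
  refine h3.eventually_lt_const ?_
  simpa using hM

/-- The variance of `H` in a cube of side `a`, for the homogeneous process. -/
noncomputable def cubeVariance (H : Finset (E d) → ℝ) (l : ℝ≥0) (a : ℝ) : ℝ :=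
  Var[H; law (fun _ => l) (cube 0 a)]

lemma cubeVariance_nonneg (H : Finset (E d) → ℝ) (l : ℝ≥0) (a : ℝ) : 0 ≤ cubeVariance H l a :=
  variance_nonneg _ _

section Homogeneous

variable [NeZero d] {l : ℝ≥0} {H : Finset (E d) → ℝ} {ρ : ℝ → ℝ≥0∞} {p : ℝ} {C : ℝ≥0}

lemma variance_law_cube (hH : Measurable H) (hinv : TranslationInvariant H) (l : ℝ≥0) (z : E d)
    (a : ℝ) : Var[H; law (fun _ => l) (cube z a)] = cubeVariance H l a := by
  have h : law (fun _ => l) (cube z a) = (law (fun _ => l) (cube 0 a)).map (translate z) := by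
    rw [map_translate_law l (isBounded_cube 0 a), vadd_cube, add_zero]
  rw [h, variance_map hH.aemeasurable (measurable_translate z).aemeasurable, cubeVariance]
  congr 1
  ext s
  exact hinv z s

/-- The variance of the error made by cutting a cube of side `a` into cells, for the homogeneous
process. -/
lemma evariance_sub_blockSum_homogeneous_le (hp : 2 < p) (hH : Measurable H)
    (hinv : TranslationInvariant H) (hst : StabilizationTail H l ρ)
    (hC : CostBound H (fun _ => l) p C)
    (hL2 : ∀ (z : E d) (a : ℝ), 0 < a → MemLp H 2 (law (fun _ => l) (cube z a)))
    {L r a : ℝ} (hL : 0 < L) (hr : 0 ≤ r) (ha : 0 < a) {I : Finset (Fin d → ℤ)} {z : E d}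
    (hI : ∀ i ∈ I, cell L i ⊆ cube z a) (M : ℝ≥0) :
    evariance (fun s => H s - blockSum H L I s) (law (fun _ => l) (cube z a)) ≤
      l * (((M : ℝ≥0∞) ^ 2 * (2 * ρ r) + (M : ℝ≥0∞) ^ (2 - p) * diffBound p C) * volume (cube z a) +
        (1 + diffBound p C) * volume (cube z a \ innerRegion L r I)) := by
  have hb : ∀ x : E d, (fun _ : E d => l) x ≤ l := fun _ => le_rfl
  have hgm : Measurable fun _ : E d => l := measurable_const
  have hs : innerRegion L r I ⊆ cube z a :=
    Set.iUnion₂_subset fun i hi => (innerCell_subset_cell hr i).trans (hI i hi)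
  have hW := isBounded_cube z a
  have := isProbabilityMeasure_law hb hW
  refine (evariance_sub_blockSum_le hgm hb hW (measurableSet_cube z a) hH hI (hL2 z a ha)
    fun i _ => hL2 _ _ hL).trans ?_
  have he := measurable_errCost (I := I) (L := L) hH (law (fun _ => l) (cube z a))
  rw [lintegral_const_mul _ he]
  gcongr
  rw [← lintegral_inter_add_sdiff _ (cube z a) (measurableSet_innerRegion L r I),
    Set.inter_eq_self_of_subset_right hs]
  gcongr
  · calc _ ≤ ∫⁻ _ in innerRegion L r I,
          ((M : ℝ≥0∞) ^ 2 * (2 * ρ r) + (M : ℝ≥0∞) ^ (2 - p) * diffBound p C) := by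
          refine setLIntegral_mono measurable_const fun y hy => ?_
          obtain ⟨i, hi, hyi⟩ := Set.mem_iUnion₂.1 hy
          simpa using errCost_le_of_inner hp hgm hb le_rfl hH hinv hst hC hL hI hi hr hyi M
      _ ≤ _ := by
          rw [setLIntegral_const]
          gcongr
  · rw [← setLIntegral_const]
    exact setLIntegral_mono measurable_const fun y hy => errCost_le hp hb hH hC hL hI hy.1

end Homogeneous

/-! ### The limiting variance of the homogeneous process -/

/-- The constant of the uniform bound `errCost_le`, as a nonnegative real number. -/
noncomputable def costConst (p : ℝ) (C : ℝ≥0) : ℝ≥0 := (1 + diffBound p C).toNNReal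

lemma coe_costConst (p : ℝ) (C : ℝ≥0) : (costConst p C : ℝ≥0∞) = 1 + diffBound p C :=
  ENNReal.coe_toNNReal (by simp [diffBound_ne_top])

lemma tendsto_natFloor_div_div {L : ℝ} (hL : 0 < L) :
    Tendsto (fun a : ℝ => (⌊a / L⌋₊ : ℝ) / (a / L)) atTop (𝓝 1) :=
  (tendsto_nat_floor_div_atTop (R := ℝ)).comp (tendsto_id.atTop_div_const hL)

lemma tendsto_one_sub_pow (r : ℝ) :
    Tendsto (fun L : ℝ => 1 - (1 - 2 * r / L) ^ d) atTop (𝓝 0) := by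
  have h : Tendsto (fun L : ℝ => 1 - (1 - 2 * r / L) ^ d) atTop (𝓝 (1 - (1 - 0) ^ d)) :=
    ((tendsto_const_nhds.sub (tendsto_const_nhds.div_atTop tendsto_id)).pow d).const_sub 1
  simpa using h

section Homogeneous

variable [NeZero d] {l : ℝ≥0} {H : Finset (E d) → ℝ} {ρ : ℝ → ℝ≥0∞} {p : ℝ} {C : ℝ≥0}

/-- The variance in a cube grows at most linearly in the volume of the cube. -/
lemma cubeVariance_le (hp : 2 < p) (hH : Measurable H) (hC : CostBound H (fun _ => l) p C)
    (hL2 : ∀ (z : E d) (a : ℝ), 0 < a → MemLp H 2 (law (fun _ => l) (cube z a))) {a : ℝ}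
    (ha : 0 < a) : cubeVariance H l a ≤ l * costConst p C * a ^ d := by
  have hb : ∀ x : E d, (fun _ : E d => l) x ≤ l := fun _ => le_rfl
  have h : evariance H (law (fun _ => l) (cube 0 a)) ≤ ENNReal.ofReal (l * costConst p C * a ^ d) := by
    -- without cells, the error made by cutting is `H` itself
    have h1 := evariance_sub_blockSum_le (I := ∅) (L := 1) measurable_const hb (isBounded_cube 0 a)
      (measurableSet_cube 0 a) hH (by simp) (hL2 0 a ha) (by simp)
    simp only [blockSum, Finset.sum_empty, sub_zero] at h1
    refine h1.trans ?_
    calc _ ≤ ∫⁻ _ in cube (0 : E d) a, (l : ℝ≥0∞) * costConst p C := by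
          refine setLIntegral_mono measurable_const fun y hy => ?_
          rw [coe_costConst]
          gcongr
          exact errCost_le hp hb hH hC one_pos (by simp) hy
      _ = _ := by
          rw [setLIntegral_const, volume_cube, ENNReal.ofReal_mul (by positivity),
            ENNReal.ofReal_mul (by positivity), ENNReal.ofReal_coe_nnreal,
            ENNReal.ofReal_coe_nnreal, ENNReal.ofReal_pow ha.le]
  exact ENNReal.toReal_le_of_le_ofReal (by positivity) h

lemma variance_blockSum_box (hH : Measurable H) (hinv : TranslationInvariant H)
    (hL2 : ∀ (z : E d) (a : ℝ), 0 < a → MemLp H 2 (law (fun _ => l) (cube z a)))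
    {L a : ℝ} (hL : 0 < L) {I : Finset (Fin d → ℤ)} {z : E d}
    (hI : ∀ i ∈ I, cell L i ⊆ cube z a) :
    Var[blockSum H L I; law (fun _ => l) (cube z a)] = I.card * cubeVariance H l L := by
  rw [variance_blockSum (fun _ => le_rfl) (isBounded_cube z a) hH hL hI fun i _ => hL2 _ _ hL]
  simp [cell, variance_law_cube hH hinv]

/-- Comparison of the standard deviations at the scales `a` and `L < a`. -/
lemma abs_sqrt_cubeVariance_sub_le (hp : 2 < p) (hH : Measurable H)
    (hinv : TranslationInvariant H) (hst : StabilizationTail H l ρ)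
    (hC : CostBound H (fun _ => l) p C)
    (hL2 : ∀ (z : E d) (a : ℝ), 0 < a → MemLp H 2 (law (fun _ => l) (cube z a)))
    {L r a : ℝ} (hL : 0 < L) (hr : 0 ≤ r) (hrL : 2 * r ≤ L) (ha : 0 < a) (M ε : ℝ≥0)
    (hε : (M : ℝ≥0∞) ^ 2 * (2 * ρ r) + (M : ℝ≥0∞) ^ (2 - p) * diffBound p C ≤ ε) :
    |√(cubeVariance H l a / a ^ d) - √((⌊a / L⌋₊ / (a / L)) ^ d) * √(cubeVariance H l L / L ^ d)| ≤
      √(l * (ε + costConst p C * (1 - ((⌊a / L⌋₊ / (a / L)) * (1 - 2 * r / L)) ^ d))) := by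
  set k := ⌊a / L⌋₊ with hk
  set I : Finset (Fin d → ℤ) := box 0 k
  have hcorner : corner L (fun _ : Fin d => (0 : ℤ)) = 0 := by ext j; simp [corner]
  have hkL : k * L ≤ a := by
    have := Nat.floor_le (div_nonneg ha.le hL.le)
    rwa [le_div_iff₀ hL] at this
  have hI : ∀ i ∈ I, cell L i ⊆ cube (0 : E d) a := fun i hi y hy j => by
    have := cell_subset_cube hL hi hy j
    rw [hcorner] at this
    exact ⟨this.1, this.2.trans_le (by linarith)⟩
  have hb : ∀ x : E d, (fun _ : E d => l) x ≤ l := fun _ => le_rfl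
  have := isProbabilityMeasure_law hb (isBounded_cube 0 a)
  have hmem := memLp_blockSum hb (isBounded_cube 0 a) hI fun i _ => hL2 (corner L i) L hL
  have h1 := abs_sqrt_variance_sub_le (hL2 0 a ha) hmem
  have hcard : (I.card : ℝ) = (k : ℝ) ^ d := by simp [I, card_box]
  rw [variance_blockSum_box hH hinv hL2 hL hI, hcard] at h1
  have hnn : 0 ≤ a ^ d - k ^ d * (L - 2 * r) ^ d := by
    rw [← mul_pow]
    refine sub_nonneg.2 (pow_le_pow_left₀ (mul_nonneg (by positivity) (by linarith)) ?_ _)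
    nlinarith [(Nat.cast_nonneg k : (0 : ℝ) ≤ k)]
  have h2 : Var[fun s => H s - blockSum H L I s; law (fun _ => l) (cube 0 a)] ≤
      l * (ε * a ^ d + costConst p C * (a ^ d - k ^ d * (L - 2 * r) ^ d)) := by
    refine ENNReal.toReal_le_of_le_ofReal (by positivity)
      ((evariance_sub_blockSum_homogeneous_le hp hH hinv hst hC hL2 hL hr ha hI M).trans ?_)
    rw [volume_cube_diff_innerRegion hL hr hrL ha.le hI, hcard, volume_cube,
      ENNReal.ofReal_mul (by positivity), ENNReal.ofReal_add (by positivity) (by positivity),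
      ENNReal.ofReal_mul (by positivity), ENNReal.ofReal_mul (by positivity),
      ENNReal.ofReal_coe_nnreal, ENNReal.ofReal_coe_nnreal, ENNReal.ofReal_coe_nnreal,
      ENNReal.ofReal_pow ha.le, coe_costConst]
    gcongr
  have had : 0 < a ^ d := by positivity
  have e1 : √((k / (a / L)) ^ d) * √(cubeVariance H l L / L ^ d) =
      √(k ^ d * cubeVariance H l L) / √(a ^ d) := by
    rw [← Real.sqrt_mul (by positivity), ← Real.sqrt_div' _ had.le]
    congr 1
    rw [div_div_eq_mul_div, div_pow, mul_pow]
    field_simp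
  have e2 : l * (ε + costConst p C * (1 - ((k / (a / L)) * (1 - 2 * r / L)) ^ d)) =
      l * (ε * a ^ d + costConst p C * (a ^ d - k ^ d * (L - 2 * r) ^ d)) / a ^ d := by
    have : (k / (a / L)) * (1 - 2 * r / L) = (k * (L - 2 * r)) / a := by field_simp
    rw [this, div_pow, mul_pow]
    field_simp
  rw [e1, e2, Real.sqrt_div' _ had.le, Real.sqrt_div' _ had.le, ← sub_div, abs_div,
    abs_of_nonneg (Real.sqrt_nonneg (a ^ d))]
  gcongr
  exact h1.trans (Real.sqrt_le_sqrt h2)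

/-- The variance of `H` in a cube, divided by the volume of the cube, has a limit. -/
theorem exists_tendsto_cubeVariance (hp : 2 < p) (hH : Measurable H)
    (hinv : TranslationInvariant H) (hst : StabilizationTail H l ρ)
    (hρ : Tendsto ρ atTop (𝓝 0)) (hC : CostBound H (fun _ => l) p C)
    (hL2 : ∀ (z : E d) (a : ℝ), 0 < a → MemLp H 2 (law (fun _ => l) (cube z a))) :
    ∃ v : ℝ, Tendsto (fun a => cubeVariance H l a / a ^ d) atTop (𝓝 v) := by
  set s : ℝ → ℝ := fun a => √(cubeVariance H l a / a ^ d) with hs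
  -- the normalized standard deviations `s a` form a Cauchy family: cutting the cube of side `a`
  -- into cells of a large fixed side `L` changes them little
  have key : ∀ η : ℝ, 0 < η → ∃ L : ℝ, ∀ᶠ a in atTop, |s a - s L| < η := by
    intro η hη
    set ε : ℝ≥0 := Real.toNNReal (η ^ 2 / (2 * (l + 1))) with hεd
    have hε0 : (ε : ℝ) = η ^ 2 / (2 * (l + 1)) := Real.coe_toNNReal _ (by positivity)
    have hεpos : (0 : ℝ≥0∞) < ε := by
      rw [ENNReal.coe_pos, ← NNReal.coe_pos, hε0]
      positivity
    obtain ⟨M, hM⟩ := exists_truncation hp (diffBound_ne_top p C) hεpos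
    obtain ⟨r, hr⟩ := (hM (fun n => ρ n) (hρ.comp tendsto_natCast_atTop_atTop)).exists
    have hlim : Tendsto (fun L : ℝ => l * (ε + costConst p C * (1 - (1 - 2 * (r : ℝ) / L) ^ d)))
        atTop (𝓝 (l * (ε + costConst p C * 0))) :=
      (((tendsto_one_sub_pow (r : ℝ)).const_mul _).const_add _).const_mul _
    have hlt : l * (ε + costConst p C * 0) < η ^ 2 := by
      rw [hε0, mul_zero, add_zero, ← mul_div_assoc, div_lt_iff₀ (by positivity)]
      nlinarith [sq_pos_of_pos hη, l.coe_nonneg]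
    obtain ⟨L, hLη, hL0, hrL⟩ := ((hlim.eventually_lt_const hlt).and
      ((eventually_gt_atTop 0).and (eventually_ge_atTop (2 * (r : ℝ))))).exists
    refine ⟨L, ?_⟩
    have hq := tendsto_natFloor_div_div hL0
    have h1 : Tendsto (fun a : ℝ => √(l * (ε + costConst p C *
        (1 - ((⌊a / L⌋₊ / (a / L)) * (1 - 2 * (r : ℝ) / L)) ^ d))) +
          |√((⌊a / L⌋₊ / (a / L)) ^ d) - 1| * s L) atTop
        (𝓝 (√(l * (ε + costConst p C * (1 - (1 * (1 - 2 * (r : ℝ) / L)) ^ d))) +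
          |√(1 ^ d) - 1| * s L)) :=
      (((((hq.mul_const _).pow d).const_sub 1).const_mul _).const_add _ |>.const_mul _).sqrt.add
        ((((hq.pow d).sqrt).sub_const 1).abs.mul_const _)
    have h2 : √(l * (ε + costConst p C * (1 - (1 * (1 - 2 * (r : ℝ) / L)) ^ d))) +
          |√(1 ^ d) - 1| * s L < η := by
      rw [one_pow, Real.sqrt_one, sub_self, abs_zero, zero_mul, add_zero, one_mul,
        Real.sqrt_lt' hη]
      exact hLη
    filter_upwards [h1.eventually_lt_const h2, eventually_gt_atTop 0] with a ha ha0
    have h3 := abs_sqrt_cubeVariance_sub_le hp hH hinv hst hC hL2 hL0 (Nat.cast_nonneg r) hrL ha0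
      M ε hr.le
    refine lt_of_le_of_lt ?_ ha
    calc |s a - s L| = |(s a - √((⌊a / L⌋₊ / (a / L)) ^ d) * s L) +
          (√((⌊a / L⌋₊ / (a / L)) ^ d) - 1) * s L| := by ring_nf
      _ ≤ |s a - √((⌊a / L⌋₊ / (a / L)) ^ d) * s L| +
          |(√((⌊a / L⌋₊ / (a / L)) ^ d) - 1) * s L| := abs_add_le _ _
      _ ≤ _ := by
          rw [abs_mul _ (s L), abs_of_nonneg (Real.sqrt_nonneg _ : 0 ≤ s L)]
          gcongr
  have hc : Cauchy (map s atTop) := by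
    refine Metric.cauchy_iff.2 ⟨inferInstance, fun ε hε => ?_⟩
    obtain ⟨L, hL⟩ := key (ε / 2) (by positivity)
    refine ⟨Metric.ball (s L) (ε / 2), ?_, fun x hx y hy => ?_⟩
    · exact mem_map.2 (by filter_upwards [hL] with a ha using ha)
    · have := dist_triangle_right x y (s L)
      rw [Metric.mem_ball] at hx hy
      linarith
  obtain ⟨σ, hσ⟩ := CompleteSpace.complete hc
  refine ⟨σ ^ 2, (Tendsto.pow (show Tendsto s atTop (𝓝 σ) from hσ) 2).congr' ?_⟩
  filter_upwards [eventually_gt_atTop 0] with a ha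
  exact Real.sq_sqrt (div_nonneg (cubeVariance_nonneg H l a) (by positivity))

end Homogeneous

/-! ### Convergence of the variances over the cells -/

/-- The cube `[-K, K)^d`. -/
noncomputable def symmCube (K : ℝ) : Set (E d) := cube (WithLp.toLp 2 fun _ => -K) (2 * K)

lemma mem_symmCube {K : ℝ} {x : E d} : x ∈ symmCube K ↔ ∀ j, -K ≤ x j ∧ x j < K := by
  simp only [symmCube, cube, Set.mem_ofPred_eq]
  refine forall_congr' fun j => and_congr Iff.rfl ?_
  rw [show -K + 2 * K = K by ring]

/-- The hypotheses on the functional `H` and the density `f`, in terms of laws only: `f` is bounded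
by `b` and vanishes outside of `[-K, K)^d`, the add one costs have bounded moments of order
`p > 2`, the values of `H` in a cube have bounded moments of an order greater than `2`, and `H`
is stabilizing at the densities `f x`. -/
structure Regular (H : Finset (E d) → ℝ) (f : E d → ℝ≥0) (b : ℝ≥0) (K p : ℝ) (C : ℝ≥0) :
    Prop where
  measH : Measurable H
  inv : TranslationInvariant H
  measf : Measurable f
  le : ∀ x, f x ≤ b
  pos : 0 < K
  supp : ∀ x, f x ≠ 0 → x ∈ symmCube K
  two_lt : 2 < p
  cost : ∀ n : ℕ, 1 ≤ n → CostBound H (dilated f n) p C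
  moment : ∀ a : ℝ, 0 < a → ∃ q : ℝ, 2 < q ∧ ∃ B : ℝ≥0, ∀ n : ℕ, 1 ≤ n → ∀ z : E d,
    ∫⁻ s, ‖H s‖ₑ ^ q ∂law (dilated f n) (cube z a) ≤ B
  stab : ∀ x, ∃ ρ : ℝ → ℝ≥0∞, Tendsto ρ atTop (𝓝 0) ∧ StabilizationTail H (f x) ρ

/-- The number of cells of side `L` that cover `[0, n ^ (1 / d) * K)`. -/
noncomputable def halfWidth (d : ℕ) (K L : ℝ) (n : ℕ) : ℕ := ⌈dil d n * K / L⌉₊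

/-- The indices of the cells of side `L` that tile the window of the `n`-th process. -/
noncomputable def blocks (K L : ℝ) (n : ℕ) : Finset (Fin d → ℤ) :=
  box (-(halfWidth d K L n : ℤ)) (2 * halfWidth d K L n)

/-- The side of the window of the `n`-th process. -/
noncomputable def winSide (d : ℕ) (K L : ℝ) (n : ℕ) : ℝ := ((2 * halfWidth d K L n : ℕ) : ℝ) * L

/-- The window of the `n`-th process: a cube tiled by cells of side `L` and containing the
support of the intensity function. -/
noncomputable def win (K L : ℝ) (n : ℕ) : Set (E d) :=
  cube (corner L fun _ => -(halfWidth d K L n : ℤ)) (winSide d K L n)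

lemma mem_win_iff_idx {K L : ℝ} {n : ℕ} (hL : 0 < L) {y : E d} :
    y ∈ win K L n ↔ idx L y ∈ blocks K L n := mem_cube_iff_idx_mem_box hL

lemma cell_subset_win {K L : ℝ} {n : ℕ} (hL : 0 < L) {i : Fin d → ℤ} (hi : i ∈ blocks K L n) :
    cell L i ⊆ win K L n := cell_subset_cube hL hi

lemma isBounded_win (K L : ℝ) (n : ℕ) : Bornology.IsBounded (win (d := d) K L n) :=
  isBounded_cube _ _

lemma measurableSet_win (K L : ℝ) (n : ℕ) : MeasurableSet (win (d := d) K L n) :=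
  measurableSet_cube _ _

lemma mem_win {K L : ℝ} {n : ℕ} {y : E d} :
    y ∈ win K L n ↔ ∀ j, -(halfWidth d K L n * L) ≤ y j ∧ y j < halfWidth d K L n * L := by
  simp only [win, winSide, cube, corner, Set.mem_ofPred_eq]
  refine forall_congr' fun j => and_congr ?_ ?_
  · push_cast
    rw [mul_neg, mul_comm]
  · push_cast
    rw [show L * -(halfWidth d K L n : ℝ) + 2 * halfWidth d K L n * L =
      halfWidth d K L n * L by ring]

lemma le_halfWidth_mul {K L : ℝ} (hL : 0 < L) (n : ℕ) : dil d n * K ≤ halfWidth d K L n * L := by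
  rw [← div_le_iff₀ hL]
  exact Nat.le_ceil _

lemma halfWidth_mul_le {K L : ℝ} (hK : 0 < K) (hL : 0 < L) {n : ℕ} (hn : 1 ≤ n) :
    halfWidth d K L n * L ≤ dil d n * K + L := by
  have h1 : (halfWidth d K L n : ℝ) < dil d n * K / L + 1 :=
    Nat.ceil_lt_add_one (div_nonneg (mul_nonneg (dil_pos hn).le hK.le) hL.le)
  have h2 := mul_lt_mul_of_pos_right h1 hL
  rw [add_mul, one_mul, div_mul_cancel₀ _ hL.ne'] at h2
  exact h2.le

/-- Scaled back, the windows remain in a fixed cube. -/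
lemma mem_symmCube_of_smul_mem_win {K L : ℝ} (hK : 0 < K) (hL : 0 < L) {n : ℕ} (hn : 1 ≤ n)
    {x : E d} (hx : dil d n • x ∈ win K L n) : x ∈ symmCube (K + L) := by
  rw [mem_symmCube]
  intro j
  have h := mem_win.1 hx j
  have h1 := halfWidth_mul_le (d := d) hK hL hn
  have h2 := one_le_dil (d := d) hn
  have h3 : (dil d n • x) j = dil d n * x j := rfl
  rw [h3] at h
  constructor <;> nlinarith

section Law

lemma restrict_intensity_eq_self {g : E d → ℝ≥0} (hg : Measurable g) {W : Set (E d)}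
    (h : ∀ x, g x ≠ 0 → x ∈ W) : (intensity g).restrict W = intensity g := by
  refine Measure.restrict_eq_self_of_ae_mem ((ae_withDensity_iff hg.coe_nnreal_ennreal).2 ?_)
  exact Eventually.of_forall fun x hx => h x (by simpa using hx)

/-- The law of a Poisson process whose intensity function vanishes outside of the window. -/
lemma law_eq_poissonLaw {g : E d → ℝ≥0} (hg : Measurable g) {W : Set (E d)}
    (h : ∀ x, g x ≠ 0 → x ∈ W) : law g W = poissonLaw (intensity g) := by
  rw [law, restrict_intensity_eq_self hg h]

lemma intensity_restrict_eq_zero {g : E d → ℝ≥0} (hg : Measurable g) {W : Set (E d)}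
    (hW : MeasurableSet W) (h : ∀ x ∈ W, g x = 0) : (intensity g).restrict W = 0 := by
  rw [Measure.restrict_eq_zero, withDensity_apply _ hW, lintegral_eq_zero_iff hg.coe_nnreal_ennreal]
  filter_upwards [ae_restrict_mem hW] with x hx
  simp [h x hx]

lemma variance_law_eq_zero {g : E d → ℝ≥0} (hg : Measurable g) {W : Set (E d)}
    (hW : MeasurableSet W) (h : ∀ x ∈ W, g x = 0) (H : Finset (E d) → ℝ) :
    Var[H; law g W] = 0 := by
  have h1 : H =ᵐ[law g W] fun _ => H ∅ := by
    rw [law, intensity_restrict_eq_zero hg hW h]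
    have h2 := poissonLaw_ne_empty_le (0 : Measure (E d))
    have h3 : poissonLaw (0 : Measure (E d)) {∅}ᶜ = 0 := by simpa using h2
    filter_upwards [measure_eq_zero_iff_ae_notMem.1 h3] with s hs
    rw [not_not.1 hs]
  have : IsProbabilityMeasure (law g W) := by
    rw [law, intensity_restrict_eq_zero hg hW h]
    infer_instance
  rw [variance_congr h1, variance_eq_integral aemeasurable_const]
  simp

/-- Poisson laws with nearby intensity functions are close in total variation. -/
lemma exceedsByAtMost_law [NeZero d] {b : ℝ≥0} {g₁ g₂ : E d → ℝ≥0} (hg₁ : Measurable g₁)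
    (hg₂ : Measurable g₂) (hb₁ : ∀ x, g₁ x ≤ b) (hb₂ : ∀ x, g₂ x ≤ b) {A B : Set (E d)}
    (hA : MeasurableSet A) (hAb : Bornology.IsBounded A) (hAB : A ⊆ B) :
    ExceedsByAtMost (law g₁ A) (law g₂ A) (∫⁻ x in B, edist (g₁ x) (g₂ x)) := by
  intro Φ hΦ M hM
  refine (lintegral_law_le_of_density hg₁ hg₂ hb₁ hb₂ hA hAb hΦ hM).trans ?_
  gcongr

lemma integral_law_cube [NeZero d] {H : Finset (E d) → ℝ} (hinv : TranslationInvariant H)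
    (hH : Measurable H) {φ : ℝ → ℝ} (hφ : Measurable φ) (l : ℝ≥0) (z : E d) (a : ℝ) :
    ∫ s, φ (H s) ∂law (fun _ => l) (cube z a) = ∫ s, φ (H s) ∂law (fun _ => l) (cube 0 a) := by
  have h : law (fun _ => l) (cube z a) = (law (fun _ => l) (cube 0 a)).map (translate z) := by
    rw [map_translate_law l (isBounded_cube 0 a), vadd_cube, add_zero]
  rw [h, integral_map (f := fun s => φ (H s)) (measurable_translate z).aemeasurable
    (hφ.comp hH).aestronglyMeasurable]
  congr 1
  ext s
  exact congrArg φ (hinv z s)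

end Law

/-- The variance of `H` in the cell that contains the point `y`, for the `n`-th process. -/
noncomputable def cellVariance (H : Finset (E d) → ℝ) (f : E d → ℝ≥0) (L : ℝ)
    (n : ℕ) (y : E d) : ℝ := Var[H; law (dilated f n) (cell L (idx L y))]

lemma measurable_cellVariance (H : Finset (E d) → ℝ) (f : E d → ℝ≥0) (L : ℝ)
    (n : ℕ) : Measurable (cellVariance H f L n) :=
  (Measurable.of_discrete (f := fun i : Fin d → ℤ => Var[H; law (dilated f n) (cell L i)])).comp
    (measurable_idx L)

namespace Regular

variable {H : Finset (E d) → ℝ} {f : E d → ℝ≥0} {b : ℝ≥0} {K p L : ℝ} {C : ℝ≥0} {n : ℕ}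

lemma measg (h : Regular H f b K p C) (n : ℕ) : Measurable (dilated f n) :=
  measurable_dilated h.measf n

lemma dilated_le (h : Regular H f b K p C) (n : ℕ) (x : E d) : dilated f n x ≤ b := h.le _

lemma mem_win_of_dilated_ne_zero (h : Regular H f b K p C) (hn : 1 ≤ n) (hL : 0 < L) {y : E d}
    (hy : dilated f n y ≠ 0) : y ∈ win K L n := by
  rw [mem_win]
  intro j
  have h1 := mem_symmCube.1 (h.supp _ hy) j
  have h3 : ((dil d n)⁻¹ • y) j = (dil d n)⁻¹ * y j := rfl
  have h2 := le_halfWidth_mul (d := d) (K := K) hL n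
  have h4 := dil_pos (d := d) hn
  rw [h3, le_inv_mul_iff₀ h4, inv_mul_lt_iff₀ h4] at h1
  constructor <;> linarith

lemma law_win (h : Regular H f b K p C) (hn : 1 ≤ n) (hL : 0 < L) :
    law (dilated f n) (win K L n) = poissonLaw (intensity (dilated f n)) :=
  law_eq_poissonLaw (h.measg n) fun _ => h.mem_win_of_dilated_ne_zero hn hL

lemma winSide_pos (h : Regular H f b K p C) (hn : 1 ≤ n) (hL : 0 < L) : 0 < winSide d K L n := by
  have h1 := le_halfWidth_mul (d := d) (K := K) hL n
  have h2 := mul_pos (dil_pos (d := d) hn) h.pos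
  rw [winSide]
  push_cast
  linarith

lemma dilated_smul (hn : 1 ≤ n) (x : E d) : dilated f n (dil d n • x) = f x := by
  rw [dilated, inv_smul_smul₀ (dil_pos hn).ne']

lemma memLp_dilated (h : Regular H f b K p C) (hn : 1 ≤ n) (z : E d) {a : ℝ} (ha : 0 < a) :
    MemLp H 2 (law (dilated f n) (cube z a)) := by
  obtain ⟨q, hq, B, hB⟩ := h.moment a ha
  have := isProbabilityMeasure_law (h.dilated_le n) (isBounded_cube z a)
  exact memLp_two_of_lintegral_rpow_le hq h.measH ENNReal.coe_ne_top (hB n hn z)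

lemma cellVariance_eq_zero (h : Regular H f b K p C) (hn : 1 ≤ n) (hL : 0 < L) {y : E d}
    (hy : y ∉ win K L n) : cellVariance H f L n y = 0 := by
  refine variance_law_eq_zero (h.measg n) (measurableSet_cell _ _) (fun w hw => ?_) H
  by_contra hne
  have := h.mem_win_of_dilated_ne_zero hn hL hne
  rw [mem_win_iff_idx hL, (mem_cell_iff hL).1 hw, ← mem_win_iff_idx hL] at this
  exact hy this

lemma integral_cellVariance (h : Regular H f b K p C) (hn : 1 ≤ n) (hL : 0 < L) :
    ∫ y, cellVariance H f L n y =
      (∑ i ∈ blocks K L n, Var[H; law (dilated f n) (cell L i)]) * L ^ d := by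
  have e : cellVariance H f L n = fun y => ∑ i ∈ blocks K L n,
      (cell L i).indicator (fun _ => Var[H; law (dilated f n) (cell L i)]) y := by
    ext y
    by_cases hy : y ∈ win K L n
    · rw [Finset.sum_eq_single_of_mem (idx L y) ((mem_win_iff_idx hL).1 hy),
        Set.indicator_of_mem ((mem_cell_iff hL).2 rfl), cellVariance]
      intro j _ hj
      exact Set.indicator_of_notMem (fun hy' => hj ((mem_cell_iff hL).1 hy').symm) _
    · rw [h.cellVariance_eq_zero hn hL hy, Finset.sum_eq_zero]
      intro j hj
      exact Set.indicator_of_notMem (fun hy' => hy (cell_subset_win hL hj hy')) _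
  have hv : ∀ i : Fin d → ℤ, volume.real (cell L i) = L ^ d := fun i => by
    rw [measureReal_def, volume_cell, ENNReal.toReal_pow, ENNReal.toReal_ofReal hL.le]
  rw [e, integral_finsetSum]
  · simp_rw [integral_indicator_const _ (measurableSet_cell L _), hv, smul_eq_mul, Finset.sum_mul,
      mul_comm]
  · intro i _
    refine (integrable_indicator_iff (measurableSet_cell L i)).2 (integrableOn_const ?_)
    rw [volume_cell]
    finiteness

lemma exists_cellVariance_le (h : Regular H f b K p C) (hL : 0 < L) :
    ∃ B : ℝ, 0 ≤ B ∧ ∀ n : ℕ, 1 ≤ n → ∀ y : E d, cellVariance H f L n y ≤ B := by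
  obtain ⟨q, hq, B, hB⟩ := h.moment L hL
  refine ⟨1 + B, by positivity, fun n hn y => ENNReal.toReal_le_of_le_ofReal (by positivity) ?_⟩
  have := isProbabilityMeasure_law (h.dilated_le n) (isBounded_cube (corner L (idx L y)) L)
  refine (evariance_le_lintegral_sub_sq (h.memLp_dilated hn _ hL) 0).trans ?_
  simp only [sub_zero]
  refine (lintegral_sq_le_one_add hq h.measH (hB n hn _)).trans_eq ?_
  rw [ENNReal.ofReal_add zero_le_one B.coe_nonneg, ENNReal.ofReal_one, ENNReal.ofReal_coe_nnreal]

variable [NeZero d]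

variable {x : E d}

lemma costBound_const (h : Regular H f b K p C) (hx : LebesguePoint f x) :
    CostBound H (fun _ => f x) p C := fun _ _ _ hy =>
  cost_moment_of_lebesguePoint h.measf h.le hx h.measH h.inv h.cost hy

lemma memLp_const (h : Regular H f b K p C) (hx : LebesguePoint f x) (z : E d) (a : ℝ)
    (ha : 0 < a) : MemLp H 2 (law (fun _ => f x) (cube z a)) := by
  obtain ⟨q, hq, B, hB⟩ := h.moment a ha
  have := isProbabilityMeasure_law (fun _ : E d => h.le x) (isBounded_cube z a)
  exact memLp_two_of_lintegral_rpow_le hq h.measH ENNReal.coe_ne_top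
    (moment_of_lebesguePoint h.measf h.le hx h.measH h.inv hB z)

end Regular

/-- The limit of the variances in large cubes, divided by the volume of the cubes. -/
noncomputable def asymptoticVariance (H : Finset (E d) → ℝ) (l : ℝ≥0) : ℝ :=
  limUnder atTop fun a => cubeVariance H l a / a ^ d

namespace Regular

variable [NeZero d] {H : Finset (E d) → ℝ} {f : E d → ℝ≥0} {b : ℝ≥0} {K p L : ℝ} {C : ℝ≥0} {n : ℕ}
  {x : E d}

theorem tendsto_cubeVariance (h : Regular H f b K p C) (hx : LebesguePoint f x) :
    Tendsto (fun a => cubeVariance H (f x) a / a ^ d) atTop (𝓝 (asymptoticVariance H (f x))) := by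
  obtain ⟨ρ, hρ, hst⟩ := h.stab x
  exact tendsto_nhds_limUnder (exists_tendsto_cubeVariance h.two_lt h.measH h.inv hst hρ
    (h.costBound_const hx) (h.memLp_const hx))

lemma cubeVariance_div_le (h : Regular H f b K p C) (hx : LebesguePoint f x) {a : ℝ} (ha : 0 < a) :
    cubeVariance H (f x) a / a ^ d ≤ f x * costConst p C := by
  rw [div_le_iff₀ (by positivity)]
  exact cubeVariance_le h.two_lt h.measH (h.costBound_const hx) (h.memLp_const hx) ha

lemma asymptoticVariance_nonneg (h : Regular H f b K p C) (hx : LebesguePoint f x) :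
    0 ≤ asymptoticVariance H (f x) :=
  ge_of_tendsto (h.tendsto_cubeVariance hx) (by
    filter_upwards [eventually_gt_atTop 0] with a ha
    exact div_nonneg (cubeVariance_nonneg H _ a) (by positivity))

lemma asymptoticVariance_le (h : Regular H f b K p C) (hx : LebesguePoint f x) :
    asymptoticVariance H (f x) ≤ f x * costConst p C :=
  le_of_tendsto (h.tendsto_cubeVariance hx) (by
    filter_upwards [eventually_gt_atTop 0] with a ha
    exact h.cubeVariance_div_le hx ha)

/-- The sum of the variances over the cells as an integral. -/
lemma sum_variance_div_eq (h : Regular H f b K p C) (hn : 1 ≤ n) (hL : 0 < L) :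
    (∑ i ∈ blocks K L n, Var[H; law (dilated f n) (cell L i)]) / n =
      ∫ x, cellVariance H f L n (dil d n • x) / L ^ d := by
  have hn' : (0 : ℝ) < n := by exact_mod_cast hn
  rw [integral_div, Measure.integral_comp_smul, h.integral_cellVariance hn hL,
    finrank_euclideanSpace_fin, dil_pow, abs_of_pos (by positivity), smul_eq_mul]
  field_simp

/-- Around a Lebesgue point, the variances in cells of a fixed size converge. -/
theorem tendsto_cellVariance (h : Regular H f b K p C) (hx : LebesguePoint f x) (hL : 0 < L) :
    Tendsto (fun n => cellVariance H f L n (dil d n • x)) atTop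
      (𝓝 (cubeVariance H (f x) L)) := by
  obtain ⟨q, hq, B, hB⟩ := h.moment L hL
  set P : ℕ → Measure (Finset (E d)) := fun n =>
    law (dilated f n) (cell L (idx L (dil d n • x))) with hP
  set Q : ℕ → Measure (Finset (E d)) := fun n =>
    law (fun _ => f x) (cell L (idx L (dil d n • x))) with hQ
  have hd : 0 < √(d : ℝ) * L := by
    have := NeZero.pos d
    positivity
  have hsub : ∀ n, cell L (idx L (dil d n • x)) ⊆ Metric.closedBall (dil d n • x) (√d * L) :=
    fun n y hy => dist_le_of_mem_cube hy ((mem_cell_iff hL).2 rfl)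
  have hPQ : ∀ᶠ n in atTop, IsProbabilityMeasure (P n) ∧ IsProbabilityMeasure (Q n) ∧
      ExceedsByAtMost (P n) (Q n) (∫⁻ z in Metric.closedBall (dil d n • x) (√d * L),
        edist (dilated f n z) (f x)) ∧
      ExceedsByAtMost (Q n) (P n) (∫⁻ z in Metric.closedBall (dil d n • x) (√d * L),
        edist (dilated f n z) (f x)) := by
    refine Eventually.of_forall fun n => ⟨isProbabilityMeasure_law (h.dilated_le n)
      (isBounded_cube _ _), isProbabilityMeasure_law (fun _ => h.le x) (isBounded_cube _ _),
      exceedsByAtMost_law (h.measg n) measurable_const (h.dilated_le n) (fun _ => h.le x)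
        (measurableSet_cell _ _) (isBounded_cube _ _) (hsub n), ?_⟩
    simp_rw [edist_comm (dilated f n _)]
    exact exceedsByAtMost_law measurable_const (h.measg n) (fun _ => h.le x) (h.dilated_le n)
        (measurableSet_cell _ _) (isBounded_cube _ _) (hsub n)
  have hPm : ∀ᶠ n in atTop, ∫⁻ s, ‖H s‖ₑ ^ q ∂P n ≤ B := by
    filter_upwards [eventually_ge_atTop 1] with n hn using hB n hn _
  have hQm : ∀ᶠ n in atTop, ∫⁻ s, ‖H s‖ₑ ^ q ∂Q n ≤ B :=
    Eventually.of_forall fun n => moment_of_lebesguePoint h.measf h.le hx h.measH h.inv hB _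
  -- the expectations of `H` and of `H ^ 2` both converge; the latter because `q / 2 > 1`
  have hsq : ∀ s, ‖H s ^ 2‖ₑ ^ (q / 2) = ‖H s‖ₑ ^ q := fun s => by
    rw [enorm_pow, ← ENNReal.rpow_natCast, ← ENNReal.rpow_mul]
    congr 1
    push_cast
    ring
  have h1 := tendsto_integral_sub hPQ (hx _ hd) h.measH (by linarith : 1 < q) hPm hQm
  have h2 := tendsto_integral_sub hPQ (hx _ hd) (h.measH.pow_const 2) (by linarith : 1 < q / 2)
    (by simpa only [hsq] using hPm) (by simpa only [hsq] using hQm)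
  have e1 : ∀ n, ∫ s, H s ∂Q n = ∫ s, H s ∂law (fun _ => f x) (cube 0 L) := fun n =>
    integral_law_cube h.inv h.measH measurable_id (f x) _ L
  have e2 : ∀ n, ∫ s, H s ^ 2 ∂Q n = ∫ s, H s ^ 2 ∂law (fun _ => f x) (cube 0 L) := fun n =>
    integral_law_cube h.inv h.measH (measurable_id.pow_const 2) (f x) _ L
  simp only [e1, e2] at h1 h2
  have h3 := ((h2.add_const (∫ s, H s ^ 2 ∂law (fun _ => f x) (cube 0 L))).sub
    ((h1.add_const (∫ s, H s ∂law (fun _ => f x) (cube 0 L))).pow 2))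
  simp only [sub_add_cancel, zero_add] at h3
  have := isProbabilityMeasure_law (fun _ : E d => h.le x) (isBounded_cube (0 : E d) L)
  rw [cubeVariance, variance_eq_sub (h.memLp_const hx 0 L hL)]
  refine h3.congr' ?_
  filter_upwards [eventually_ge_atTop 1, hPQ] with n hn hn'
  have := hn'.1
  exact (variance_eq_sub (μ := P n) (h.memLp_dilated hn _ hL)).symm

/-- The sum of the variances over the cells of a fixed size, divided by `n`, converges. -/
theorem tendsto_sum_variance_div (h : Regular H f b K p C) (hL : 0 < L) :
    Tendsto (fun n : ℕ => (∑ i ∈ blocks K L n, Var[H; law (dilated f n) (cell L i)]) / n) atTop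
      (𝓝 (∫ x, cubeVariance H (f x) L / L ^ d)) := by
  obtain ⟨B, hB0, hB⟩ := h.exists_cellVariance_le hL
  have h1 : Tendsto (fun n : ℕ => ∫ x, cellVariance H f L n (dil d n • x) / L ^ d) atTop
      (𝓝 (∫ x, cubeVariance H (f x) L / L ^ d)) := by
    refine tendsto_integral_filter_of_dominated_convergence
      ((symmCube (K + L)).indicator fun _ => B / L ^ d) ?_ ?_ ?_ ?_
    · exact Eventually.of_forall fun n => (((measurable_cellVariance H f L n).comp
        (measurable_const_smul _)).div_const _).aestronglyMeasurable
    · filter_upwards [eventually_ge_atTop 1] with n hn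
      refine Eventually.of_forall fun x => ?_
      have h0 : 0 ≤ cellVariance H f L n (dil d n • x) := variance_nonneg _ _
      rw [Real.norm_of_nonneg (by positivity)]
      by_cases hx : dil d n • x ∈ win K L n
      · rw [Set.indicator_of_mem (mem_symmCube_of_smul_mem_win h.pos hL hn hx)]
        gcongr
        exact hB n hn _
      · rw [h.cellVariance_eq_zero hn hL hx, zero_div]
        exact Set.indicator_nonneg (fun _ _ => by positivity) _
    · refine (integrable_indicator_iff (measurableSet_cube _ _)).2 (integrableOn_const ?_)
      exact (isBounded_cube _ _).measure_lt_top.ne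
    · filter_upwards [ae_lebesguePoint h.measf h.le] with x hx
      exact (h.tendsto_cellVariance hx hL).div_const _
  refine h1.congr' ?_
  filter_upwards [eventually_ge_atTop 1] with n hn
  exact (h.sum_variance_div_eq hn hL).symm

end Regular

/-! ### The error made by cutting is negligible -/

/-- The mean square error cost at the point `dil d n • x`, if this point is at a distance at least
`√L` from the boundary of its cell, and `0` otherwise. The truncation at the level `costConst p C`
is only there to have a bound for all `n` and `x`. -/
noncomputable def innerCost (H : Finset (E d) → ℝ) (f : E d → ℝ≥0) (K p : ℝ) (C : ℝ≥0) (L : ℝ)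
    (n : ℕ) (x : E d) : ℝ≥0∞ :=
  min (costConst p C) ((innerRegion L (√L) (blocks K L n)).indicator
    (errCost H L (blocks K L n) (law (dilated f n) (win K L n))) (dil d n • x))

lemma tendsto_boundaryFraction (d : ℕ) :
    Tendsto (fun L : ℕ => 1 - (1 - 2 * √(L : ℝ) / L) ^ d) atTop (𝓝 0) := by
  have h1 : Tendsto (fun L : ℕ => 2 * √(L : ℝ) / L) atTop (𝓝 0) := by
    have h2 : Tendsto (fun L : ℕ => 2 * (√(L : ℝ))⁻¹) atTop (𝓝 (2 * 0)) :=
      ((tendsto_inv_atTop_zero.comp (Real.tendsto_sqrt_atTop.comp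
        tendsto_natCast_atTop_atTop)).const_mul 2)
    rw [mul_zero] at h2
    refine h2.congr fun L => ?_
    rw [mul_div_assoc, Real.sqrt_div_self', one_div]
  simpa using ((h1.const_sub 1).pow d).const_sub 1

namespace Regular

variable {H : Finset (E d) → ℝ} {f : E d → ℝ≥0} {b : ℝ≥0} {K p L : ℝ} {C : ℝ≥0} {n : ℕ}
  {x : E d}

lemma measurable_innerCost (h : Regular H f b K p C) (L : ℝ) (n : ℕ) :
    Measurable (innerCost H f K p C L n) := by
  have := isProbabilityMeasure_law (h.dilated_le n) (isBounded_win K L n)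
  exact measurable_const.min (((measurable_errCost h.measH _).indicator
    (measurableSet_innerRegion _ _ _)).comp (measurable_const_smul _))

lemma lintegral_ne_top (h : Regular H f b K p C) : ∫⁻ x, (f x : ℝ≥0∞) ≠ ∞ := by
  have h1 : ∫⁻ x, (f x : ℝ≥0∞) ≤
      ∫⁻ x, (symmCube (d := d) K).indicator (fun _ => (b : ℝ≥0∞)) x := by
    refine lintegral_mono fun x => ?_
    by_cases hx : x ∈ symmCube K
    · rw [Set.indicator_of_mem hx]
      exact ENNReal.coe_le_coe.2 (h.le x)
    · rw [Set.indicator_of_notMem hx, not_not.1 fun hne => hx (h.supp x hne)]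
      simp
  refine (h1.trans_lt ?_).ne
  rw [lintegral_indicator_const (s := symmCube K) (measurableSet_cube _ _)]
  exact ENNReal.mul_lt_top ENNReal.coe_lt_top (isBounded_cube _ _).measure_lt_top

lemma lintegral_mul_costConst_ne_top (h : Regular H f b K p C) :
    ∫⁻ x, (f x : ℝ≥0∞) * costConst p C ≠ ∞ := by
  rw [lintegral_mul_const _ h.measf.coe_nnreal_ennreal]
  exact ENNReal.mul_ne_top h.lintegral_ne_top ENNReal.coe_ne_top

variable [NeZero d]

/-- Around a Lebesgue point, stabilization bounds the inner error costs for large `n`. -/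
lemma limsup_innerCost_le (h : Regular H f b K p C) (hx : LebesguePoint f x) (hL : 0 < L)
    {ρ : ℝ → ℝ≥0∞} (hst : StabilizationTail H (f x) ρ) (M : ℝ≥0) {ε : ℝ≥0∞}
    (hε : (M : ℝ≥0∞) ^ 2 * (2 * ρ (√L)) + (M : ℝ≥0∞) ^ (2 - p) * diffBound p C < ε) :
    limsup (fun n => innerCost H f K p C L n x) atTop ≤ ε := by
  have hr : 0 < √L := Real.sqrt_pos.2 hL
  have h1 : Tendsto (fun n : ℕ => (M : ℝ≥0∞) ^ 2 * (2 * (ρ (√L) +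
      ∫⁻ w in Metric.closedBall (dil d n • x) (√L), edist (dilated f n w) (f x))) +
      (M : ℝ≥0∞) ^ (2 - p) * diffBound p C) atTop
      (𝓝 ((M : ℝ≥0∞) ^ 2 * (2 * (ρ (√L) + 0)) + (M : ℝ≥0∞) ^ (2 - p) * diffBound p C)) :=
    (ENNReal.Tendsto.const_mul (ENNReal.Tendsto.const_mul (tendsto_const_nhds.add (hx _ hr))
      (Or.inr (by simp))) (Or.inr (by finiteness))).add tendsto_const_nhds
  rw [add_zero] at h1
  refine limsup_le_of_le (by isBoundedDefault) ?_
  filter_upwards [h1.eventually_lt_const hε, eventually_ge_atTop 1] with n hn hn1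
  refine (min_le_right _ _).trans ?_
  by_cases hy : dil d n • x ∈ innerRegion L (√L) (blocks K L n)
  · rw [Set.indicator_of_mem hy]
    obtain ⟨i, hi, hyi⟩ := Set.mem_iUnion₂.1 hy
    exact (errCost_le_of_inner h.two_lt (h.measg n) (h.dilated_le n) (h.le x) h.measH h.inv hst
      (h.cost n hn1) hL (fun i hi => cell_subset_win hL hi) hi hr.le hyi M).trans hn.le
  · rw [Set.indicator_of_notMem hy]
    exact zero_le

lemma tendsto_limsup_innerCost (h : Regular H f b K p C) (hx : LebesguePoint f x) :
    Tendsto (fun L : ℕ => limsup (fun n => innerCost H f K p C L n x) atTop) atTop (𝓝 0) := by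
  obtain ⟨ρ, hρ, hst⟩ := h.stab x
  refine ENNReal.tendsto_nhds_zero.2 fun ε hε => ?_
  obtain ⟨M, hM⟩ := exists_truncation h.two_lt (diffBound_ne_top p C) hε
  filter_upwards [hM (fun L : ℕ => ρ (√L)) (hρ.comp (Real.tendsto_sqrt_atTop.comp
    tendsto_natCast_atTop_atTop)), eventually_ge_atTop 1] with L hL hL1
  exact h.limsup_innerCost_le hx (by exact_mod_cast hL1) hst M hL

/-- By the reverse Fatou lemma, the inner points contribute little, first for large `n` and then
for large `L`. -/
lemma eventually_lintegral_innerCost_lt (h : Regular H f b K p C) {ε : ℝ≥0∞} (hε : 0 < ε) :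
    ∀ᶠ L : ℕ in atTop, ∀ᶠ n in atTop, ∫⁻ x, f x * innerCost H f K p C L n x < ε := by
  have hm : ∀ (L : ℝ) (n : ℕ), Measurable fun x => (f x : ℝ≥0∞) * innerCost H f K p C L n x :=
    fun L n => h.measf.coe_nnreal_ennreal.mul (h.measurable_innerCost L n)
  have hle : ∀ (L : ℝ) (n : ℕ) (x : E d),
      (f x : ℝ≥0∞) * innerCost H f K p C L n x ≤ f x * costConst p C := fun L n x => by
    gcongr
    exact min_le_left _ _
  have h1 : Tendsto (fun L : ℕ => ∫⁻ x, limsup (fun n => f x * innerCost H f K p C L n x) atTop)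
      atTop (𝓝 (∫⁻ _ : E d, 0)) := by
    refine tendsto_lintegral_of_dominated_convergence (fun x => (f x : ℝ≥0∞) * costConst p C)
      (fun L => Measurable.limsup (hm L)) (fun L => Eventually.of_forall fun x => ?_)
      h.lintegral_mul_costConst_ne_top ?_
    · exact limsup_le_of_le (by isBoundedDefault) (Eventually.of_forall fun n => hle L n x)
    · filter_upwards [ae_lebesguePoint h.measf h.le] with x hx
      have h2 := ENNReal.Tendsto.const_mul (a := (f x : ℝ≥0∞)) (h.tendsto_limsup_innerCost hx)
        (Or.inr ENNReal.coe_ne_top)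
      rw [mul_zero] at h2
      exact h2.congr fun L => (ENNReal.limsup_const_mul_of_ne_top ENNReal.coe_ne_top).symm
  rw [lintegral_zero] at h1
  filter_upwards [h1.eventually_lt_const hε] with L hL
  refine eventually_lt_of_limsup_lt ((limsup_lintegral_le _ (hm L)
    (fun n => Eventually.of_forall (hle L n)) h.lintegral_mul_costConst_ne_top).trans_lt hL)

lemma lintegral_comp_smul (hn : 1 ≤ n) {φ : E d → ℝ≥0∞} (hφ : Measurable φ) :
    ∫⁻ y, φ y = n * ∫⁻ x, φ (dil d n • x) := by
  have h := lintegral_comp_inv_smul (dil_pos (d := d) hn)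
    (φ := fun x => φ (dil d n • x)) (hφ.comp (measurable_const_smul _))
  simp only [smul_inv_smul₀ (dil_pos hn).ne'] at h
  rw [h, dil_pow, ENNReal.ofReal_natCast]

/-- The scaled volume of the points of the window close to the boundary of a cell. -/
lemma volume_boundary_le (hK : 0 < K) (hL : 4 ≤ L) (hn : 1 ≤ n) (hLn : L ≤ dil d n) :
    volume {x : E d | dil d n • x ∈ win K L n \ innerRegion L (√L) (blocks K L n)} ≤
      ENNReal.ofReal ((2 * (K + 1)) ^ d * (1 - (1 - 2 * √L / L) ^ d)) := by
  have hL0 : 0 < L := by linarith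
  have hr : 2 * √L ≤ L := by
    nlinarith [Real.sq_sqrt hL0.le, Real.sqrt_nonneg L, Real.le_sqrt' (x := 2) (y := L) two_pos |>.2
      (by linarith)]
  set A := win K L n \ innerRegion L (√L) (blocks (d := d) K L n)
  have hA : MeasurableSet A := (measurableSet_win K L n).diff (measurableSet_innerRegion _ _ _)
  have h1 := lintegral_comp_smul hn (φ := A.indicator 1) (measurable_one.indicator hA)
  rw [lintegral_indicator_one hA] at h1
  have e1 : ∫⁻ x : E d, A.indicator 1 (dil d n • x) = volume {x : E d | dil d n • x ∈ A} :=
    lintegral_indicator_one ((measurable_const_smul (dil d n)) hA)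
  have h2 : volume A ≤
      ENNReal.ofReal (n * ((2 * (K + 1)) ^ d * (1 - (1 - 2 * √L / L) ^ d))) := by
    refine (volume_cube_diff_innerRegion hL0 (Real.sqrt_nonneg L) hr
      (mul_nonneg (by positivity) hL0.le) fun i hi => cell_subset_win hL0 hi).trans_le
      (ENNReal.ofReal_le_ofReal ?_)
    have e2 : L - 2 * √L = L * (1 - 2 * √L / L) := by field_simp
    have hq : 0 ≤ 1 - 2 * √L / L := by
      rw [sub_nonneg, div_le_one hL0]
      exact hr
    have hβ : 0 ≤ 1 - (1 - 2 * √L / L) ^ d := sub_nonneg.2 (pow_le_one₀ hq (by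
      have : 0 ≤ 2 * √L / L := by positivity
      linarith))
    have e3 : (n : ℝ) = dil d n ^ d := (dil_pow n).symm
    rw [blocks, card_box, e2, mul_pow L, Nat.cast_pow, ← mul_assoc, ← mul_pow,
      ← mul_one_sub, e3, ← mul_assoc, ← mul_pow]
    refine mul_le_mul_of_nonneg_right (pow_le_pow_left₀ (by positivity) ?_ _) hβ
    have := halfWidth_mul_le (d := d) hK hL0 hn
    push_cast
    nlinarith
  have hn0 : (n : ℝ≥0∞) ≠ 0 := by simpa using (by omega : n ≠ 0)
  rw [h1, e1, ENNReal.ofReal_mul (by positivity), ENNReal.ofReal_natCast] at h2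
  exact (ENNReal.mul_le_mul_iff_right hn0 (ENNReal.natCast_ne_top n)).1 h2

/-- The variance of the error made by cutting the window into cells. -/
lemma evariance_error_le (h : Regular H f b K p C) (hn : 1 ≤ n) (hL : 0 < L) :
    evariance (fun s => H s - blockSum H L (blocks K L n) s)
        (poissonLaw (intensity (dilated f n))) ≤
      n * ((∫⁻ x, f x * innerCost H f K p C L n x) + b * costConst p C *
        volume {x : E d | dil d n • x ∈ win K L n \ innerRegion L (√L) (blocks K L n)}) := by
  have hI : ∀ i ∈ blocks K L n, cell (d := d) L i ⊆ win K L n := fun i hi => cell_subset_win hL hi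
  have := isProbabilityMeasure_law (h.dilated_le n) (isBounded_win K L n)
  have he := measurable_errCost (I := blocks K L n) (L := L) h.measH
    (law (dilated f n) (win K L n))
  set A : Set (E d) := {x | dil d n • x ∈ win K L n \ innerRegion L (√L) (blocks K L n)}
  have hA : MeasurableSet A := (measurable_const_smul (dil d n))
    ((measurableSet_win K L n).diff (measurableSet_innerRegion _ _ _))
  rw [← h.law_win hn hL]
  refine (evariance_sub_blockSum_le (h.measg n) (h.dilated_le n) (isBounded_win K L n)
    (measurableSet_win K L n) h.measH hI (h.memLp_dilated hn _ (h.winSide_pos hn hL))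
    fun i _ => h.memLp_dilated hn _ hL).trans ?_
  rw [← lintegral_indicator (measurableSet_win K L n), lintegral_comp_smul hn
    (φ := (win K L n).indicator fun y => (dilated f n y : ℝ≥0∞) *
      errCost H L (blocks K L n) (law (dilated f n) (win K L n)) y)
    (((h.measg n).coe_nnreal_ennreal.mul he).indicator (measurableSet_win K L n))]
  gcongr
  rw [← lintegral_indicator_const hA, ← lintegral_add_right _ (measurable_const.indicator hA)]
  refine lintegral_mono fun x => ?_
  by_cases hxW : dil d n • x ∈ win K L n
  swap
  · rw [Set.indicator_of_notMem hxW]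
    exact zero_le
  have hcost : errCost H L (blocks K L n) (law (dilated f n) (win K L n)) (dil d n • x) ≤
      costConst p C := by
    rw [coe_costConst]
    exact errCost_le h.two_lt (h.dilated_le n) h.measH (h.cost n hn) hL hI hxW
  rw [Set.indicator_of_mem hxW, dilated_smul hn]
  by_cases hxi : dil d n • x ∈ innerRegion L (√L) (blocks K L n)
  · refine le_add_right ?_
    rw [innerCost, Set.indicator_of_mem hxi, min_eq_right hcost]
  · refine le_add_left ?_
    rw [Set.indicator_of_mem (show x ∈ A from ⟨hxW, hxi⟩)]
    gcongr
    exact h.le x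

/-- The error made by cutting the window into cells is negligible, for large `n` and then
large `L`. -/
theorem eventually_evariance_error_le (h : Regular H f b K p C) {η : ℝ≥0} (hη : 0 < η) :
    ∀ᶠ L : ℕ in atTop, ∀ᶠ n : ℕ in atTop,
      evariance (fun s => H s - blockSum H L (blocks K L n) s)
        (poissonLaw (intensity (dilated f n))) ≤ n * η := by
  have h1 : Tendsto (fun L : ℕ => (b : ℝ≥0∞) * costConst p C *
      ENNReal.ofReal ((2 * (K + 1)) ^ d * (1 - (1 - 2 * √(L : ℝ) / L) ^ d))) atTop
      (𝓝 ((b : ℝ≥0∞) * costConst p C * ENNReal.ofReal ((2 * (K + 1)) ^ d * 0))) :=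
    ENNReal.Tendsto.const_mul (ENNReal.tendsto_ofReal
      ((tendsto_boundaryFraction d).const_mul _)) (Or.inr (by finiteness))
  have hη' : (0 : ℝ≥0∞) < (η / 2 : ℝ≥0) := by
    rw [ENNReal.coe_pos]
    positivity
  rw [mul_zero, ENNReal.ofReal_zero, mul_zero] at h1
  filter_upwards [h1.eventually_lt_const hη', h.eventually_lintegral_innerCost_lt hη',
    eventually_ge_atTop 4] with L hL1 hL2 hL4
  have hL4' : (4 : ℝ) ≤ L := by exact_mod_cast hL4
  filter_upwards [hL2, eventually_ge_atTop 1, (tendsto_dil (d := d)).eventually_ge_atTop (L : ℝ)]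
    with n hn hn1 hLn
  refine (h.evariance_error_le hn1 (by linarith)).trans ?_
  gcongr
  calc _ ≤ ((η / 2 : ℝ≥0) : ℝ≥0∞) + (η / 2 : ℝ≥0) := by
        gcongr
        refine le_trans ?_ hL1.le
        gcongr
        exact volume_boundary_le h.pos hL4' hn1 hLn
    _ = η := by rw [← ENNReal.coe_add, add_halves]

end Regular

/-! ### Characteristic functions -/

section CharFun

lemma norm_prod_sub_prod_le {ι : Type*} (I : Finset ι) {a b : ι → ℂ} (ha : ∀ i ∈ I, ‖a i‖ ≤ 1)
    (hb : ∀ i ∈ I, ‖b i‖ ≤ 1) : ‖∏ i ∈ I, a i - ∏ i ∈ I, b i‖ ≤ ∑ i ∈ I, ‖a i - b i‖ := by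
  induction I using Finset.induction_on with
  | empty => simp
  | insert j I hj ih =>
    rw [Finset.prod_insert hj, Finset.prod_insert hj, Finset.sum_insert hj]
    have h1 : ‖∏ i ∈ I, b i‖ ≤ 1 := by
      rw [norm_prod]
      exact Finset.prod_le_one (fun _ _ => norm_nonneg _)
        fun i hi => hb i (Finset.mem_insert_of_mem hi)
    have h2 := ih (fun i hi => ha i (Finset.mem_insert_of_mem hi))
      fun i hi => hb i (Finset.mem_insert_of_mem hi)
    have h3 := ha j (Finset.mem_insert_self j I)
    calc _ = ‖a j * (∏ i ∈ I, a i - ∏ i ∈ I, b i) + (a j - b j) * ∏ i ∈ I, b i‖ := by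
          congr 1
          ring
      _ ≤ ‖a j‖ * ‖∏ i ∈ I, a i - ∏ i ∈ I, b i‖ + ‖a j - b j‖ * ‖∏ i ∈ I, b i‖ := by
          rw [← norm_mul, ← norm_mul]
          exact norm_add_le _ _
      _ ≤ 1 * (∑ i ∈ I, ‖a i - b i‖) + ‖a j - b j‖ * 1 := by gcongr
      _ = _ := by ring

/-- The second order Taylor expansion of the exponential, with an error term of any order between
`2` and `3`. -/
lemma norm_exp_mul_I_sub_le {q : ℝ} (hq2 : 2 ≤ q) (hq3 : q ≤ 3) (x : ℝ) :
    ‖Complex.exp (x * Complex.I) - (1 + x * Complex.I - x ^ 2 / 2)‖ ≤ 4 * |x| ^ q := by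
  have hn : ‖(x : ℂ) * Complex.I‖ = |x| := by simp
  rcases le_total |x| 1 with h | h
  · have h1 := Complex.exp_bound (x := (x : ℂ) * Complex.I) (by rwa [hn]) (n := 3) (by norm_num)
    have e : ∑ m ∈ Finset.range 3, ((x : ℂ) * Complex.I) ^ m / (m.factorial : ℂ) =
        1 + x * Complex.I - x ^ 2 / 2 := by
      simp only [Finset.sum_range_succ, Finset.sum_range_zero, mul_pow, Nat.factorial]
      rw [Complex.I_sq]
      push_cast
      ring
    rw [e, hn] at h1
    refine h1.trans ?_
    have h2 : |x| ^ (3 : ℕ) ≤ |x| ^ q := by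
      rcases eq_or_lt_of_le (abs_nonneg x) with h0 | h0
      · rw [← h0, Real.zero_rpow (by linarith)]
        norm_num
      · rw [← Real.rpow_natCast]
        exact Real.rpow_le_rpow_of_exponent_ge h0 h (by exact_mod_cast hq3)
    have h3 : (0 : ℝ) ≤ |x| ^ q := by positivity
    norm_num [Nat.factorial]
    nlinarith
  · have h1 : ‖Complex.exp (x * Complex.I)‖ = 1 := Complex.norm_exp_ofReal_mul_I x
    have h2 : |x| ^ (2 : ℕ) ≤ |x| ^ q := by
      rw [← Real.rpow_natCast]
      exact Real.rpow_le_rpow_of_exponent_le h (by exact_mod_cast hq2)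
    calc _ ≤ ‖Complex.exp (x * Complex.I)‖ + ((‖(1 : ℂ)‖ + ‖(x : ℂ) * Complex.I‖) +
          ‖(x : ℂ) ^ 2 / 2‖) := (norm_sub_le _ _).trans (by
            gcongr
            exact (norm_sub_le _ _).trans (by gcongr; exact norm_add_le _ _))
      _ = 1 + ((1 + |x|) + |x| ^ 2 / 2) := by
          rw [h1, hn]
          simp
      _ ≤ 4 * |x| ^ q := by nlinarith

variable {X : Type*} [MeasurableSpace X] {μ : Measure X}

lemma charFun_map_eq_integral {Z : X → ℝ} (hZ : Measurable Z) (u : ℝ) :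
    charFun (μ.map Z) u = ∫ s, Complex.exp ((u * Z s : ℝ) * Complex.I) ∂μ := by
  rw [charFun_apply_real, integral_map hZ.aemeasurable]
  · push_cast
    rfl
  · exact Measurable.aestronglyMeasurable (by fun_prop)

lemma charFun_map_div {Z : X → ℝ} (hZ : Measurable Z) (c u : ℝ) :
    charFun (μ.map fun s => Z s / c) u = charFun (μ.map Z) (u / c) := by
  rw [charFun_map_eq_integral hZ, charFun_map_eq_integral (hZ.div_const c)]
  congr 1
  ext s
  rw [mul_div_assoc', div_mul_eq_mul_div]

lemma integral_abs_rpow_le {Z : X → ℝ} (hZ : Measurable Z) {q : ℝ} (hq : 0 ≤ q) {B : ℝ≥0}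
    (h : ∫⁻ s, ‖Z s‖ₑ ^ q ∂μ ≤ B) :
    Integrable (fun s => |Z s| ^ q) μ ∧ ∫ s, |Z s| ^ q ∂μ ≤ B := by
  have e : ∀ s, ‖Z s‖ₑ ^ q = ENNReal.ofReal (|Z s| ^ q) := fun s => by
    rw [Real.enorm_eq_ofReal_abs, ENNReal.ofReal_rpow_of_nonneg (abs_nonneg _) hq]
  simp_rw [e] at h
  have hm : Measurable fun s => |Z s| ^ q := (hZ.abs).pow_const q
  have h0 : 0 ≤ᵐ[μ] fun s => |Z s| ^ q := Eventually.of_forall fun s => by positivity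
  have hi : Integrable (fun s => |Z s| ^ q) μ :=
    (lintegral_ofReal_ne_top_iff_integrable hm.aestronglyMeasurable h0).1
      (h.trans_lt ENNReal.coe_lt_top).ne
  refine ⟨hi, ?_⟩
  rw [← ofReal_integral_eq_lintegral_ofReal hi h0] at h
  simpa using ENNReal.toReal_le_of_le_ofReal B.coe_nonneg (by simpa using h) |>.trans'
    (ENNReal.toReal_ofReal (integral_nonneg_of_ae h0)).ge

variable [IsProbabilityMeasure μ]

/-- The expansion of order two of the characteristic function of a centered random variable. -/
lemma norm_charFun_sub_le {Z : X → ℝ} (hZ : Measurable Z) (h0 : ∫ s, Z s ∂μ = 0)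
    (h2 : MemLp Z 2 μ) {q : ℝ} (hq2 : 2 ≤ q) (hq3 : q ≤ 3) {B : ℝ≥0}
    (h : ∫⁻ s, ‖Z s‖ₑ ^ q ∂μ ≤ B) (u : ℝ) :
    ‖charFun (μ.map Z) u - (1 - u ^ 2 * Var[Z; μ] / 2 : ℝ)‖ ≤ 4 * (|u| ^ q * B) := by
  obtain ⟨hi, hB⟩ := integral_abs_rpow_le hZ (by linarith) h
  have hexp : Integrable (fun s => Complex.exp ((u * Z s : ℝ) * Complex.I)) μ :=
    Integrable.of_bound (Measurable.aestronglyMeasurable (by fun_prop)) 1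
      (Eventually.of_forall fun s => (Complex.norm_exp_ofReal_mul_I _).le)
  have hZi : Integrable Z μ := h2.integrable (by norm_num)
  have hZ2 : Integrable (fun s => Z s ^ 2) μ := h2.integrable_sq
  have hT : ∫ s, ((1 : ℂ) + ((u * Z s : ℝ) : ℂ) * Complex.I - ((u * Z s : ℝ) : ℂ) ^ 2 / 2) ∂μ =
      ((1 - u ^ 2 * Var[Z; μ] / 2 : ℝ) : ℂ) := by
    have e : ∀ s, (1 + ((u * Z s : ℝ) : ℂ) * Complex.I - ((u * Z s : ℝ) : ℂ) ^ 2 / 2) =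
        ((1 - u ^ 2 / 2 * Z s ^ 2 : ℝ) : ℂ) + ((u * Z s : ℝ) : ℂ) * Complex.I := fun s => by
      push_cast
      ring
    simp_rw [e]
    rw [integral_add, integral_mul_const, integral_complex_ofReal, integral_complex_ofReal,
      integral_const_mul, h0, integral_sub (integrable_const _) (hZ2.const_mul _),
      integral_const_mul, variance_of_integral_eq_zero hZ.aemeasurable h0]
    · simp
      ring
    · exact ((integrable_const _).sub (hZ2.const_mul _)).ofReal
    · exact ((hZi.const_mul u).ofReal).mul_const _
  have hTi : Integrable
      (fun s => 1 + ((u * Z s : ℝ) : ℂ) * Complex.I - ((u * Z s : ℝ) : ℂ) ^ 2 / 2) μ := by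
    refine ((integrable_const _).add (((hZi.const_mul u).ofReal).mul_const _)).sub ?_
    have : Integrable (fun s => (u * Z s) ^ 2 / 2) μ :=
      (hZ2.const_mul (u ^ 2 / 2)).congr (Eventually.of_forall fun s => by ring)
    simpa using this.ofReal (𝕜 := ℂ)
  rw [charFun_map_eq_integral hZ, ← hT, ← integral_sub hexp hTi]
  calc _ ≤ ∫ s, 4 * (|u| ^ q * |Z s| ^ q) ∂μ := by
        refine norm_integral_le_of_norm_le ((hi.const_mul _).const_mul _)
          (Eventually.of_forall fun s => ?_)
        rw [← Real.mul_rpow (abs_nonneg _) (abs_nonneg _), ← abs_mul]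
        exact norm_exp_mul_I_sub_le hq2 hq3 (u * Z s)
    _ = 4 * (|u| ^ q * ∫ s, |Z s| ^ q ∂μ) := by rw [integral_const_mul, integral_const_mul]
    _ ≤ _ := by gcongr

/-- The characteristic function of a centered random variable compared with that of the centered
normal law with the same variance. -/
lemma norm_charFun_sub_exp_le {Z : X → ℝ} (hZ : Measurable Z) (h0 : ∫ s, Z s ∂μ = 0)
    (h2 : MemLp Z 2 μ) {q : ℝ} (hq2 : 2 ≤ q) (hq3 : q ≤ 3) {B : ℝ≥0}
    (h : ∫⁻ s, ‖Z s‖ₑ ^ q ∂μ ≤ B) {u D : ℝ} (hD : Var[Z; μ] ≤ D) (hu : u ^ 2 * D / 2 ≤ 1) :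
    ‖charFun (μ.map Z) u - (Real.exp (-(u ^ 2 * Var[Z; μ] / 2)) : ℝ)‖ ≤
      4 * (|u| ^ q * B) + (u ^ 2 * D / 2) ^ 2 := by
  have hv := variance_nonneg Z μ
  set t := u ^ 2 * Var[Z; μ] / 2 with ht
  have ht0 : 0 ≤ t := by positivity
  have htD : t ≤ u ^ 2 * D / 2 := by
    rw [ht]
    gcongr
  have h1 := norm_charFun_sub_le hZ h0 h2 hq2 hq3 h u
  have h3 := Real.abs_exp_sub_one_sub_id_le (x := -t) (by rw [abs_neg, abs_of_nonneg ht0]; linarith)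
  have h4 : ‖((1 - t : ℝ) : ℂ) - (Real.exp (-t) : ℝ)‖ ≤ (u ^ 2 * D / 2) ^ 2 := by
    rw [← Complex.ofReal_sub, Complex.norm_real, Real.norm_eq_abs, abs_sub_comm]
    calc |Real.exp (-t) - (1 - t)| = |Real.exp (-t) - 1 - -t| := by ring_nf
      _ ≤ (-t) ^ 2 := h3
      _ = t ^ 2 := neg_sq t
      _ ≤ _ := by gcongr
  exact (norm_sub_le_norm_sub_add_norm_sub _ _ _).trans (add_le_add h1 h4)

end CharFun

lemma restr_restr_of_subset {A B : Set (E d)} (h : A ⊆ B) (s : Finset (E d)) :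
    restr A (restr B s) = restr A s := by
  ext x
  simp only [mem_restr]
  constructor
  · rintro ⟨⟨h1, _⟩, h3⟩
    exact ⟨h1, h3⟩
  · rintro ⟨h1, h2⟩
    exact ⟨⟨h1, h h2⟩, h2⟩

/-- As a Poisson process splits into independent processes on disjoint sets, the characteristic
function of a sum over disjoint sets is a product. -/
lemma charFun_map_sum_comp_restr (ν : Measure (E d)) [IsFiniteMeasure ν] [NullSingletonClass ν]
    {ι : Type*} {A : ι → Set (E d)} (hA : ∀ i, MeasurableSet (A i))
    (hd : Pairwise fun i j => Disjoint (A i) (A j)) {F : ι → Finset (E d) → ℝ}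
    (hF : ∀ i, Measurable (F i)) (I : Finset ι) (u : ℝ) :
    charFun ((poissonLaw ν).map fun s => ∑ i ∈ I, F i (restr (A i) s)) u =
      ∏ i ∈ I, charFun ((poissonLaw ν).map fun s => F i (restr (A i) s)) u := by
  induction I using Finset.induction_on with
  | empty =>
    simp only [Finset.sum_empty, Finset.prod_empty]
    rw [charFun_map_eq_integral measurable_const]
    simp
  | insert j I hj ih =>
    have hm : ∀ i, Measurable fun s => F i (restr (A i) s) := fun i =>
      (hF i).comp (measurable_restr (hA i))
    have hS : Measurable fun s => ∑ i ∈ I, F i (restr (A i) s) :=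
      Finset.measurable_sum I fun i _ => hm i
    have hind : IndepFun (fun s => F j (restr (A j) s)) (fun s => ∑ i ∈ I, F i (restr (A i) s))
        (poissonLaw ν) := by
      have h1 := (indepFun_restr ν (hA j) (hA j).compl disjoint_compl_right).comp (hF j) hS
      have h2 : (fun s => ∑ i ∈ I, F i (restr (A i) s)) =
          (fun s => ∑ i ∈ I, F i (restr (A i) s)) ∘ restr (A j)ᶜ := by
        ext s
        refine Finset.sum_congr rfl fun i hi => ?_
        rw [restr_restr_of_subset]
        exact Set.subset_compl_iff_disjoint_right.2 (hd fun hij => hj (hij ▸ hi))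
      rw [h2]
      exact h1
    simp_rw [Finset.sum_insert hj]
    rw [hind.charFun_map_fun_add_eq_mul (hm j).aemeasurable hS.aemeasurable,
      Finset.prod_insert hj, Pi.mul_apply, ih]

/-! ### The central limit theorem for sums over cells -/

lemma enorm_rpow_le_one_add {r q : ℝ} (hr : 0 ≤ r) (hrq : r ≤ q) (x : ℝ) :
    ‖x‖ₑ ^ r ≤ 1 + ‖x‖ₑ ^ q := by
  rcases le_total ‖x‖ₑ 1 with h | h
  · exact le_add_right (ENNReal.rpow_le_one h hr)
  · exact le_add_left (ENNReal.rpow_le_rpow_of_exponent_le h hrq)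

section Centered

variable {X : Type*} [MeasurableSpace X] {μ : Measure X} [IsProbabilityMeasure μ]

lemma lintegral_rpow_le_one_add {Z : X → ℝ} {r q : ℝ} (hr : 0 ≤ r) (hrq : r ≤ q) {B : ℝ≥0∞}
    (h : ∫⁻ s, ‖Z s‖ₑ ^ q ∂μ ≤ B) : ∫⁻ s, ‖Z s‖ₑ ^ r ∂μ ≤ 1 + B := by
  calc _ ≤ ∫⁻ s, (1 + ‖Z s‖ₑ ^ q) ∂μ := lintegral_mono fun s => enorm_rpow_le_one_add hr hrq _
    _ = 1 + ∫⁻ s, ‖Z s‖ₑ ^ q ∂μ := by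
        rw [lintegral_add_left measurable_const, lintegral_const, measure_univ, one_mul]
    _ ≤ _ := by gcongr

/-- Centering preserves moment bounds. -/
lemma lintegral_centered_rpow_le {Z : X → ℝ} (hZ : Measurable Z) {r q : ℝ} (hr : 1 ≤ r)
    (hrq : r ≤ q) {B : ℝ≥0∞} (h : ∫⁻ s, ‖Z s‖ₑ ^ q ∂μ ≤ B) :
    ∫⁻ s, ‖Z s - ∫ s', Z s' ∂μ‖ₑ ^ r ∂μ ≤ 2 ^ (r - 1) * ((1 + B) ^ r + (1 + B) ^ r) := by
  refine lintegral_sub_rpow_le hr hZ ?_ ?_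
  · refine (lintegral_rpow_le_one_add (by linarith) hrq h).trans ?_
    calc 1 + B = (1 + B) ^ (1 : ℝ) := (ENNReal.rpow_one _).symm
      _ ≤ _ := ENNReal.rpow_le_rpow_of_exponent_le le_self_add hr
  · rw [lintegral_const, measure_univ, mul_one]
    gcongr
    calc _ ≤ ∫⁻ s, ‖Z s‖ₑ ^ (1 : ℝ) ∂μ := by
          simp only [ENNReal.rpow_one]
          exact enorm_integral_le_lintegral_enorm _
      _ ≤ 1 + B := lintegral_rpow_le_one_add zero_le_one (by linarith) h

end Centered

lemma card_blocks_le [NeZero d] {K L : ℝ} (hK : 0 < K) (hL : 0 < L) {n : ℕ} (hn : 1 ≤ n) :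
    ((blocks K L n : Finset (Fin d → ℤ)).card : ℝ) ≤ (2 * (K + L) / L) ^ d * n := by
  rw [blocks, card_box, ← dil_pow (d := d) n, ← mul_pow, Nat.cast_pow]
  refine pow_le_pow_left₀ (by positivity) ?_ d
  have h1 := halfWidth_mul_le (d := d) hK hL hn
  have h2 := one_le_dil (d := d) hn
  rw [div_mul_eq_mul_div, le_div_iff₀ hL]
  push_cast
  nlinarith

/-- The value of `H` on the cell of index `i`, minus its expectation. -/
noncomputable def centered (H : Finset (E d) → ℝ) (f : E d → ℝ≥0) (L : ℝ) (n : ℕ)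
    (i : Fin d → ℤ) (s : Finset (E d)) : ℝ := H s - ∫ s', H s' ∂law (dilated f n) (cell L i)

namespace Regular

variable {H : Finset (E d) → ℝ} {f : E d → ℝ≥0} {b : ℝ≥0} {K p L : ℝ} {C : ℝ≥0} {n : ℕ}
  {x : E d}

lemma exists_centered_moment_le (h : Regular H f b K p C) (hL : 0 < L) :
    ∃ q : ℝ, 2 < q ∧ q ≤ 3 ∧ ∃ B : ℝ≥0, ∀ n : ℕ, 1 ≤ n → ∀ z : E d,
      ∫⁻ s, ‖H s - ∫ s', H s' ∂law (dilated f n) (cube z L)‖ₑ ^ q ∂law (dilated f n) (cube z L)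
        ≤ B := by
  obtain ⟨q, hq, B, hB⟩ := h.moment L hL
  have hr : 2 < min q 3 := lt_min hq (by norm_num)
  set B' : ℝ≥0∞ := 2 ^ (min q 3 - 1) * ((1 + (B : ℝ≥0∞)) ^ (min q 3) + (1 + B) ^ (min q 3))
  have hB' : B' ≠ ∞ := by
    have : 0 ≤ min q 3 := by linarith
    finiteness
  refine ⟨min q 3, hr, min_le_right _ _, B'.toNNReal, fun n hn z => ?_⟩
  have := isProbabilityMeasure_law (h.dilated_le n) (isBounded_cube z L)
  rw [ENNReal.coe_toNNReal hB']
  exact lintegral_centered_rpow_le h.measH (by linarith) (min_le_left _ _) (hB n hn z)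

variable [NeZero d]

lemma integral_comp_restr (h : Regular H f b K p C) {W V : Set (E d)}
    (hW : Bornology.IsBounded W) (hV : MeasurableSet V) (hVW : V ⊆ W) {F : Finset (E d) → ℝ}
    (hF : Measurable F) :
    ∫ s, F (restr V s) ∂law (dilated f n) W = ∫ s, F s ∂law (dilated f n) V := by
  rw [← map_restr_law (h.dilated_le n) hW hV hVW,
    integral_map (measurable_restr hV).aemeasurable hF.aestronglyMeasurable]

lemma blockSum_sub_integral (h : Regular H f b K p C) (hn : 1 ≤ n) (hL : 0 < L)
    (s : Finset (E d)) :
    blockSum H L (blocks K L n) s -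
        ∫ s', blockSum H L (blocks K L n) s' ∂law (dilated f n) (win K L n) =
      ∑ i ∈ blocks K L n, centered H f L n i (restr (cell L i) s) := by
  have := isProbabilityMeasure_law (h.dilated_le n) (isBounded_win K L n)
  simp only [blockSum, centered, Finset.sum_sub_distrib]
  congr 1
  rw [integral_finsetSum]
  · exact Finset.sum_congr rfl fun i hi => h.integral_comp_restr (isBounded_win K L n)
      (measurableSet_cell L i) (cell_subset_win hL hi) h.measH
  · exact fun i hi => (memLp_comp_restr (h.dilated_le n) (isBounded_win K L n)
      (measurableSet_cell L i) (cell_subset_win hL hi)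
      (h.memLp_dilated hn _ hL)).integrable (by norm_num)

/-- The characteristic function of the normalized sum over the cells, compared with that of the
normal law with the same variance. -/
lemma norm_charFun_blockSum_sub_le (h : Regular H f b K p C) (hn : 1 ≤ n) (hL : 0 < L)
    {q : ℝ} (hq2 : 2 < q) (hq3 : q ≤ 3) {B : ℝ≥0} (hB : ∀ z : E d,
      ∫⁻ s, ‖H s - ∫ s', H s' ∂law (dilated f n) (cube z L)‖ₑ ^ q ∂law (dilated f n) (cube z L)
        ≤ B) {D : ℝ} (hD : ∀ y : E d, cellVariance H f L n y ≤ D) {u : ℝ}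
    (hu : u ^ 2 * D / 2 ≤ 1) :
    ‖charFun ((law (dilated f n) (win K L n)).map fun s => blockSum H L (blocks K L n) s -
        ∫ s', blockSum H L (blocks K L n) s' ∂law (dilated f n) (win K L n)) u -
      (Real.exp (-(u ^ 2 * (∑ i ∈ blocks K L n, Var[H; law (dilated f n) (cell L i)]) / 2)) : ℝ)‖ ≤
      (blocks K L n : Finset (Fin d → ℤ)).card * (4 * (|u| ^ q * B) + (u ^ 2 * D / 2) ^ 2) := by
  have hW := isBounded_win (d := d) K L n
  have := isFiniteMeasure_intensity (h.dilated_le n) hW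
  have hprob := isProbabilityMeasure_law (h.dilated_le n) hW
  have hcm : ∀ i, Measurable (centered H f L n i) := fun i => h.measH.sub_const _
  have hcr : ∀ i, Measurable fun s => centered H f L n i (restr (cell L i) s) := fun i =>
    (hcm i).comp (measurable_restr (measurableSet_cell L i))
  simp_rw [h.blockSum_sub_integral hn hL]
  rw [show charFun ((law (dilated f n) (win K L n)).map fun s =>
      ∑ i ∈ blocks K L n, centered H f L n i (restr (cell L i) s)) u =
      ∏ i ∈ blocks K L n, charFun ((law (dilated f n) (win K L n)).map fun s =>
        centered H f L n i (restr (cell L i) s)) u from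
    charFun_map_sum_comp_restr _ (measurableSet_cell L) (fun i j => disjoint_cell hL) hcm _ u]
  have e : ((Real.exp (-(u ^ 2 *
      (∑ i ∈ blocks K L n, Var[H; law (dilated f n) (cell L i)]) / 2)) : ℝ) : ℂ) =
      ∏ i ∈ blocks K L n,
        ((Real.exp (-(u ^ 2 * Var[H; law (dilated f n) (cell L i)] / 2)) : ℝ) : ℂ) := by
    rw [← Complex.ofReal_prod, ← Real.exp_sum, Finset.sum_neg_distrib, ← Finset.sum_div,
      ← Finset.mul_sum]
  rw [e]
  refine (norm_prod_sub_prod_le _ (fun i _ => ?_) fun i _ => ?_).trans ?_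
  · have := Measure.isProbabilityMeasure_map (μ := law (dilated f n) (win K L n))
      (hcr i).aemeasurable
    exact norm_charFun_le_one u
  · rw [Complex.norm_real, Real.norm_of_nonneg (Real.exp_nonneg _), Real.exp_le_one_iff,
      neg_nonpos]
    have := variance_nonneg H (law (dilated f n) (cell L i))
    positivity
  · rw [← nsmul_eq_mul]
    refine Finset.sum_le_card_nsmul _ _ _ fun i hi => ?_
    have hV := measurableSet_cell L i
    have hVW := cell_subset_win hL hi
    have hL2 : MemLp H 2 (law (dilated f n) (cell L i)) := h.memLp_dilated hn (corner L i) hL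
    have hpi : IsProbabilityMeasure (law (dilated f n) (cell L i)) :=
      isProbabilityMeasure_law (h.dilated_le n) (isBounded_cube (corner L i) L)
    have hc2 : MemLp (centered H f L n i) 2 (law (dilated f n) (cell L i)) :=
      hL2.sub (MeasureTheory.memLp_const _)
    have hv : Var[fun s => centered H f L n i (restr (cell L i) s);
        law (dilated f n) (win K L n)] = Var[H; law (dilated f n) (cell L i)] := by
      rw [variance_comp_restr (h.dilated_le n) hW (hcm i) hV hVW]
      exact variance_sub_const h.measH.aestronglyMeasurable _
    rw [← hv]
    refine norm_charFun_sub_exp_le (hcr i) ?_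
      (memLp_comp_restr (h.dilated_le n) hW hV hVW hc2) hq2.le hq3 ?_ ?_ hu
    · rw [h.integral_comp_restr hW hV hVW (hcm i)]
      simp only [centered]
      rw [integral_sub (hL2.integrable (by norm_num)) (integrable_const _), integral_const,
        probReal_univ, one_smul]
      exact sub_self _
    · rw [lintegral_comp_restr_law (h.dilated_le n) hW hV hVW
        ((hcm i).enorm.pow_const q)]
      exact hB (corner L i)
    · rw [hv]
      have hy : corner L i ∈ cell (d := d) L i := fun j => ⟨le_rfl, by linarith⟩
      have := hD (corner L i)
      rwa [cellVariance, (mem_cell_iff hL).1 hy] at this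

/-- The central limit theorem for the sums over the cells of a fixed size. -/
theorem tendsto_charFun_blockSum (h : Regular H f b K p C) (hL : 0 < L) (θ : ℝ) :
    Tendsto (fun n : ℕ => charFun ((law (dilated f n) (win K L n)).map fun s =>
      (blockSum H L (blocks K L n) s -
        ∫ s', blockSum H L (blocks K L n) s' ∂law (dilated f n) (win K L n)) / √n) θ) atTop
      (𝓝 (Real.exp (-(θ ^ 2 * (∫ x, cubeVariance H (f x) L / L ^ d) / 2)) : ℝ)) := by
  obtain ⟨q, hq2, hq3, B, hB⟩ := h.exists_centered_moment_le hL
  obtain ⟨D, hD0, hD⟩ := h.exists_cellVariance_le hL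
  have h1 : Tendsto (fun n : ℕ => Real.exp (-(θ ^ 2 *
      ((∑ i ∈ blocks K L n, Var[H; law (dilated f n) (cell L i)]) / n) / 2))) atTop
      (𝓝 (Real.exp (-(θ ^ 2 * (∫ x, cubeVariance H (f x) L / L ^ d) / 2)))) :=
    (Real.continuous_exp.tendsto _).comp
      ((((h.tendsto_sum_variance_div hL).const_mul _).div_const 2).neg)
  have h2 : Tendsto (fun n : ℕ => ((Real.exp (-(θ ^ 2 *
      ((∑ i ∈ blocks K L n, Var[H; law (dilated f n) (cell L i)]) / n) / 2)) : ℝ) : ℂ)) atTop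
      (𝓝 (Real.exp (-(θ ^ 2 * (∫ x, cubeVariance H (f x) L / L ^ d) / 2)) : ℝ)) :=
    (Complex.continuous_ofReal.tendsto _).comp h1
  refine h2.congr_dist ?_
  simp_rw [dist_eq_norm]
  set c := (2 * (K + L) / L) ^ d with hc
  have hc0 : 0 ≤ c := by
    have := h.pos
    positivity
  have e1 : Tendsto (fun n : ℕ => (n : ℝ) ^ (-(q / 2 - 1))) atTop (𝓝 0) :=
    (tendsto_rpow_neg_atTop (by linarith)).comp tendsto_natCast_atTop_atTop
  have e2 : Tendsto (fun n : ℕ => ((n : ℝ))⁻¹) atTop (𝓝 0) :=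
    tendsto_inv_atTop_zero.comp tendsto_natCast_atTop_atTop
  have h3 : Tendsto (fun n : ℕ => c * (4 * (|θ| ^ q * B)) * (n : ℝ) ^ (-(q / 2 - 1)) +
      c * (θ ^ 2 * D / 2) ^ 2 * ((n : ℝ))⁻¹) atTop (𝓝 (c * (4 * (|θ| ^ q * B)) * 0 +
      c * (θ ^ 2 * D / 2) ^ 2 * 0)) := (e1.const_mul _).add (e2.const_mul _)
  have h4 : Tendsto (fun n : ℕ => θ ^ 2 * D / 2 * (n : ℝ)⁻¹) atTop (𝓝 (θ ^ 2 * D / 2 * 0)) :=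
    e2.const_mul _
  rw [mul_zero, mul_zero, add_zero] at h3
  rw [mul_zero] at h4
  refine squeeze_zero' (Eventually.of_forall fun _ => norm_nonneg _) ?_ h3
  filter_upwards [eventually_ge_atTop 1, h4.eventually_le_const one_pos] with n hn hn1
  have hn0 : (0 : ℝ) < n := by exact_mod_cast hn
  have hu : (θ / √n) ^ 2 = θ ^ 2 * (n : ℝ)⁻¹ := by
    rw [div_pow, Real.sq_sqrt hn0.le, div_eq_mul_inv]
  have h5 := h.norm_charFun_blockSum_sub_le hn hL hq2 hq3 (hB n hn) (hD n hn) (u := θ / √n)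
    (by rw [hu]; linarith)
  rw [norm_sub_rev, charFun_map_div ((measurable_blockSum h.measH _ _).sub_const _)]
  have e3 : (θ / √n) ^ 2 * (∑ i ∈ blocks K L n, Var[H; law (dilated f n) (cell L i)]) / 2 =
      θ ^ 2 * ((∑ i ∈ blocks K L n, Var[H; law (dilated f n) (cell L i)]) / n) / 2 := by
    rw [hu]
    ring
  rw [e3] at h5
  refine h5.trans ?_
  have e4 : |θ / √n| ^ q = |θ| ^ q * (n : ℝ) ^ (-(q / 2)) := by
    rw [abs_div, abs_of_nonneg (Real.sqrt_nonneg _), Real.div_rpow (abs_nonneg _)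
      (Real.sqrt_nonneg _), Real.sqrt_eq_rpow, ← Real.rpow_mul hn0.le, Real.rpow_neg hn0.le,
      div_eq_mul_inv]
    congr 3
    ring
  have e5 : (n : ℝ) ^ (-(q / 2 - 1)) = n * (n : ℝ) ^ (-(q / 2)) := by
    rw [neg_sub, sub_eq_add_neg, Real.rpow_add hn0, Real.rpow_one]
  calc _ ≤ (c * n) * (4 * (|θ / √n| ^ q * B) + ((θ / √n) ^ 2 * D / 2) ^ 2) := by
        gcongr
        exact card_blocks_le h.pos hL hn
    _ = _ := by
        rw [e4, e5, hu]
        field_simp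

end Regular

/-! ### Letting the cells grow -/

section Approximation

/-- A sequence converges if it is approximated, first for large `n` and then for large `L`, by
convergent sequences whose limits converge. -/
lemma tendsto_of_approx {α : Type*} [PseudoMetricSpace α] {a : ℕ → α} {c : ℕ → ℕ → α} {s : ℕ → α}
    {t : α} (hc : ∀ L, 1 ≤ L → Tendsto (c L) atTop (𝓝 (s L))) (hs : Tendsto s atTop (𝓝 t))
    (h : ∀ η : ℝ, 0 < η → ∀ᶠ L in atTop, ∀ᶠ n in atTop, dist (a n) (c L n) ≤ η) :
    Tendsto a atTop (𝓝 t) := by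
  refine Metric.tendsto_nhds.2 fun ε hε => ?_
  obtain ⟨L, hL, hL1, hLs⟩ := ((h (ε / 3) (by positivity)).and ((eventually_ge_atTop 1).and
    (Metric.tendsto_nhds.1 hs (ε / 3) (by positivity)))).exists
  filter_upwards [hL, Metric.tendsto_nhds.1 (hc L hL1) (ε / 3) (by positivity)] with n h1 h2
  linarith [dist_triangle4 (a n) (c L n) (s L) t]

variable {X : Type*} [MeasurableSpace X] {μ : Measure X} [IsProbabilityMeasure μ]

lemma integral_abs_le_sqrt_variance {Z : X → ℝ} (hZ : MemLp Z 2 μ) :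
    ∫ s, |Z s - ∫ s', Z s' ∂μ| ∂μ ≤ √(Var[Z; μ]) := by
  have hc : MemLp (fun s => Z s - ∫ s', Z s' ∂μ) 2 μ := hZ.sub (memLp_const _)
  refine Real.le_sqrt_of_sq_le ?_
  have h1 := variance_nonneg (fun s => |Z s - ∫ s', Z s' ∂μ|) μ
  have hc' : MemLp (fun s => |Z s - ∫ s', Z s' ∂μ|) 2 μ := hc.norm
  rw [variance_eq_sub hc'] at h1
  rw [variance_eq_integral hZ.aemeasurable]
  simpa [sq_abs] using h1

lemma norm_exp_mul_I_sub_exp_le (x y : ℝ) :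
    ‖Complex.exp (x * Complex.I) - Complex.exp (y * Complex.I)‖ ≤ |x - y| := by
  have e : Complex.exp (x * Complex.I) - Complex.exp (y * Complex.I) =
      Complex.exp (y * Complex.I) * (Complex.exp (Complex.I * (x - y : ℝ)) - 1) := by
    rw [mul_sub_one, ← Complex.exp_add]
    congr 2
    push_cast
    ring
  rw [e, norm_mul, Complex.norm_exp_ofReal_mul_I, one_mul]
  exact Real.norm_exp_I_mul_ofReal_sub_one_le

/-- The characteristic functions of two centered random variables whose difference has a small
variance are close to each other. -/
lemma norm_charFun_centered_sub_le {F G : X → ℝ} (hF : Measurable F) (hG : Measurable G)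
    (hF2 : MemLp F 2 μ) (hG2 : MemLp G 2 μ) (u : ℝ) :
    ‖charFun (μ.map fun s => F s - ∫ s', F s' ∂μ) u -
      charFun (μ.map fun s => G s - ∫ s', G s' ∂μ) u‖ ≤ |u| * √(Var[fun s => F s - G s; μ]) := by
  have hD : MemLp (fun s => F s - G s) 2 μ := hF2.sub hG2
  have hDi : Integrable (fun s => F s - G s) μ := hD.integrable (by norm_num)
  have hb : ∀ {Z : X → ℝ}, Measurable Z →
      Integrable (fun s => Complex.exp ((u * Z s : ℝ) * Complex.I)) μ := fun hZ =>
    Integrable.of_bound (Measurable.aestronglyMeasurable (by fun_prop)) 1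
      (Eventually.of_forall fun s => (Complex.norm_exp_ofReal_mul_I _).le)
  have hF' := hF.sub_const (∫ s', F s' ∂μ)
  have hG' := hG.sub_const (∫ s', G s' ∂μ)
  rw [charFun_map_eq_integral hF', charFun_map_eq_integral hG',
    ← integral_sub (hb hF') (hb hG')]
  have e : ∫ s', (F s' - G s') ∂μ = ∫ s', F s' ∂μ - ∫ s', G s' ∂μ :=
    integral_sub (hF2.integrable (by norm_num)) (hG2.integrable (by norm_num))
  calc _ ≤ ∫ s, |u| * |F s - G s - ∫ s', (F s' - G s') ∂μ| ∂μ := by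
        refine norm_integral_le_of_norm_le
          ((hDi.sub (integrable_const _)).abs.const_mul _) (Eventually.of_forall fun s => ?_)
        refine (norm_exp_mul_I_sub_exp_le _ _).trans_eq ?_
        rw [← mul_sub, abs_mul, e]
        congr 2
        ring
    _ = |u| * ∫ s, |F s - G s - ∫ s', (F s' - G s') ∂μ| ∂μ := integral_const_mul _ _
    _ ≤ _ := by
        gcongr
        exact integral_abs_le_sqrt_variance hD

end Approximation

/-- The asymptotic variance of the homogeneous process with density `f x`, integrated over `x`. -/
noncomputable def totalVariance (H : Finset (E d) → ℝ) (f : E d → ℝ≥0) : ℝ :=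
  ∫ x, asymptoticVariance H (f x)

namespace Regular

variable {H : Finset (E d) → ℝ} {f : E d → ℝ≥0} {b : ℝ≥0} {K p L : ℝ} {C : ℝ≥0} {n : ℕ}

lemma integrable_bound (h : Regular H f b K p C) :
    Integrable (fun x => (f x : ℝ) * costConst p C) := by
  refine Integrable.mul_const ⟨h.measf.coe_nnreal_real.aestronglyMeasurable, ?_⟩ _
  rw [HasFiniteIntegral]
  simpa using h.lintegral_ne_top.lt_top

lemma memLp_poissonLaw (h : Regular H f b K p C) (hn : 1 ≤ n) :
    MemLp H 2 (poissonLaw (intensity (dilated f n))) := by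
  rw [← h.law_win hn one_pos]
  exact h.memLp_dilated hn _ (h.winSide_pos hn one_pos)

lemma isProbabilityMeasure_poissonLaw (h : Regular H f b K p C) (hn : 1 ≤ n) :
    IsProbabilityMeasure (poissonLaw (intensity (dilated f n))) := by
  rw [← h.law_win hn one_pos]
  exact isProbabilityMeasure_law (h.dilated_le n) (isBounded_win K 1 n)

variable [NeZero d]

lemma aestronglyMeasurable_cubeVariance (h : Regular H f b K p C) (hL : 0 < L) :
    AEStronglyMeasurable (fun x => cubeVariance H (f x) L / L ^ d) volume := by
  refine aestronglyMeasurable_of_tendsto_ae atTop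
    (f := fun n x => cellVariance H f L n (dil d n • x) / L ^ d) (fun n => ?_) ?_
  · exact (((measurable_cellVariance H f L n).comp
      (measurable_const_smul _)).div_const _).aestronglyMeasurable
  · filter_upwards [ae_lebesguePoint h.measf h.le] with x hx
    exact (h.tendsto_cellVariance hx hL).div_const _

lemma aestronglyMeasurable_asymptoticVariance (h : Regular H f b K p C) :
    AEStronglyMeasurable (fun x => asymptoticVariance H (f x)) volume := by
  refine aestronglyMeasurable_of_tendsto_ae atTop
    (f := fun (n : ℕ) x => cubeVariance H (f x) (n + 1 : ℝ) / (n + 1 : ℝ) ^ d)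
    (fun n => h.aestronglyMeasurable_cubeVariance (by positivity)) ?_
  filter_upwards [ae_lebesguePoint h.measf h.le] with x hx
  exact (h.tendsto_cubeVariance hx).comp
    (tendsto_atTop_add_const_right _ _ tendsto_natCast_atTop_atTop)

lemma integrable_asymptoticVariance (h : Regular H f b K p C) :
    Integrable fun x => asymptoticVariance H (f x) := by
  refine h.integrable_bound.mono' h.aestronglyMeasurable_asymptoticVariance ?_
  filter_upwards [ae_lebesguePoint h.measf h.le] with x hx
  rw [Real.norm_of_nonneg (h.asymptoticVariance_nonneg hx)]
  exact h.asymptoticVariance_le hx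

lemma totalVariance_nonneg (h : Regular H f b K p C) : 0 ≤ totalVariance H f :=
  integral_nonneg_of_ae (by
    filter_upwards [ae_lebesguePoint h.measf h.le] with x hx
    exact h.asymptoticVariance_nonneg hx)

lemma tendsto_integral_cubeVariance (h : Regular H f b K p C) :
    Tendsto (fun L : ℕ => ∫ x, cubeVariance H (f x) L / (L : ℝ) ^ d) atTop
      (𝓝 (totalVariance H f)) := by
  refine tendsto_integral_filter_of_dominated_convergence
    (fun x => (f x : ℝ) * costConst p C) ?_ ?_ h.integrable_bound ?_
  · filter_upwards [eventually_ge_atTop 1] with L hL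
    exact h.aestronglyMeasurable_cubeVariance (by exact_mod_cast hL)
  · filter_upwards [eventually_ge_atTop 1] with L hL
    filter_upwards [ae_lebesguePoint h.measf h.le] with x hx
    rw [Real.norm_of_nonneg (div_nonneg (cubeVariance_nonneg _ _ _) (by positivity))]
    exact h.cubeVariance_div_le hx (by exact_mod_cast hL)
  · filter_upwards [ae_lebesguePoint h.measf h.le] with x hx
    exact (h.tendsto_cubeVariance hx).comp tendsto_natCast_atTop_atTop

lemma memLp_blockSum_poissonLaw (h : Regular H f b K p C) (hn : 1 ≤ n) (hL : 0 < L) :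
    MemLp (blockSum H L (blocks K L n)) 2 (poissonLaw (intensity (dilated f n))) := by
  rw [← h.law_win hn hL]
  exact memLp_blockSum (h.dilated_le n) (isBounded_win K L n) (fun i hi => cell_subset_win hL hi)
    fun i _ => h.memLp_dilated hn _ hL

lemma eventually_variance_error_le (h : Regular H f b K p C) {η : ℝ} (hη : 0 < η) :
    ∀ᶠ L : ℕ in atTop, ∀ᶠ n : ℕ in atTop,
      √(Var[fun s => H s - blockSum H L (blocks K L n) s;
        poissonLaw (intensity (dilated f n))]) ≤ √n * η := by
  filter_upwards [h.eventually_evariance_error_le (η := (η ^ 2).toNNReal)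
    (Real.toNNReal_pos.2 (by positivity))] with L hL
  filter_upwards [hL] with n hn
  rw [Real.sqrt_le_iff]
  refine ⟨by positivity, ENNReal.toReal_le_of_le_ofReal (by positivity) (hn.trans_eq ?_)⟩
  rw [mul_pow, Real.sq_sqrt (by positivity), ENNReal.ofReal_mul (by positivity),
    ENNReal.ofReal_natCast]
  rfl

/-- Convergence of the variances. -/
theorem tendsto_variance_div (h : Regular H f b K p C) :
    Tendsto (fun n : ℕ => Var[H; poissonLaw (intensity (dilated f n))] / n) atTop
      (𝓝 (totalVariance H f)) := by
  have h1 : Tendsto (fun n : ℕ => √(Var[H; poissonLaw (intensity (dilated f n))] / n)) atTop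
      (𝓝 (√(totalVariance H f))) := by
    refine tendsto_of_approx (c := fun (L n : ℕ) => √((∑ i ∈ blocks K L n,
      Var[H; law (dilated f n) (cell L i)]) / n)) (fun L hL => (h.tendsto_sum_variance_div
        (L := L) (by exact_mod_cast hL)).sqrt) h.tendsto_integral_cubeVariance.sqrt ?_
    intro η hη
    filter_upwards [h.eventually_variance_error_le hη, eventually_ge_atTop 1] with L hL hL1
    filter_upwards [hL, eventually_ge_atTop 1] with n hn hn1
    have hL0 : (0 : ℝ) < L := by exact_mod_cast hL1
    have hn0 : (0 : ℝ) < n := by exact_mod_cast hn1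
    have := h.isProbabilityMeasure_poissonLaw hn1
    have hv := variance_blockSum (h.dilated_le n) (isBounded_win K L n) h.measH hL0
      (fun i hi => cell_subset_win hL0 hi) fun i (_ : i ∈ blocks K L n) =>
        h.memLp_dilated hn1 (corner L i) hL0
    rw [h.law_win hn1 hL0] at hv
    rw [← hv, Real.dist_eq, Real.sqrt_div' _ hn0.le, Real.sqrt_div' _ hn0.le, ← sub_div, abs_div,
      abs_of_nonneg (Real.sqrt_nonneg (n : ℝ)), div_le_iff₀ (Real.sqrt_pos.2 hn0), mul_comm η]
    exact (abs_sqrt_variance_sub_le (h.memLp_poissonLaw hn1)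
      (h.memLp_blockSum_poissonLaw hn1 hL0)).trans hn
  have h2 := h1.pow 2
  rw [Real.sq_sqrt h.totalVariance_nonneg] at h2
  refine h2.congr fun n => Real.sq_sqrt (div_nonneg (variance_nonneg _ _) (by positivity))

/-- Convergence of the characteristic functions. -/
theorem tendsto_charFun (h : Regular H f b K p C) (θ : ℝ) :
    Tendsto (fun n : ℕ => charFun ((poissonLaw (intensity (dilated f n))).map fun s =>
      (H s - ∫ s', H s' ∂poissonLaw (intensity (dilated f n))) / √n) θ) atTop
      (𝓝 (Real.exp (-(θ ^ 2 * totalVariance H f / 2)) : ℝ)) := by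
  refine tendsto_of_approx
    (c := fun (L n : ℕ) => charFun ((law (dilated f n) (win K L n)).map fun s =>
      (blockSum H L (blocks K L n) s -
        ∫ s', blockSum H L (blocks K L n) s' ∂law (dilated f n) (win K L n)) / √n) θ)
    (fun L hL => h.tendsto_charFun_blockSum (L := L) (by exact_mod_cast hL) θ)
    ((Complex.continuous_ofReal.tendsto _).comp ((Real.continuous_exp.tendsto _).comp
      (((h.tendsto_integral_cubeVariance.const_mul (θ ^ 2)).div_const 2).neg))) ?_
  intro η hη
  filter_upwards [h.eventually_variance_error_le (η := η / (|θ| + 1)) (by positivity),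
    eventually_ge_atTop 1] with L hL hL1
  filter_upwards [hL, eventually_ge_atTop 1] with n hn hn1
  have hL0 : (0 : ℝ) < L := by exact_mod_cast hL1
  have hn0 : (0 : ℝ) < √n := Real.sqrt_pos.2 (by exact_mod_cast hn1)
  have := h.isProbabilityMeasure_poissonLaw hn1
  have hG := measurable_blockSum h.measH L (blocks K L n)
  rw [h.law_win hn1 hL0, charFun_map_div (h.measH.sub_const _), charFun_map_div (hG.sub_const _),
    dist_eq_norm]
  refine (norm_charFun_centered_sub_le h.measH hG (h.memLp_poissonLaw hn1)
    (h.memLp_blockSum_poissonLaw hn1 hL0) _).trans ?_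
  rw [abs_div, abs_of_pos hn0]
  calc _ ≤ |θ| / √n * (√n * (η / (|θ| + 1))) := by gcongr
    _ = |θ| / (|θ| + 1) * η := by field_simp
    _ ≤ 1 * η := by
        gcongr
        rw [div_le_one (by positivity)]
        linarith
    _ = η := one_mul η

end Regular

/-! ### Transfer to point processes -/

lemma boxVal_eq {Ω : Type*} [MeasurableSpace Ω] {P : Ω → Set (E d)} {g : E d → ℝ≥0}
    {μ : Measure Ω} (hP : IsPoissonProcess P g μ) (H : Finset (E d) → ℝ) (t : ℝ) :
    boxVal H P t = H ∘ window hP (isBounded_cube (0 : E d) (t ^ ((1 : ℝ) / d))) := by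
  ext ω
  exact val_inter hP (isBounded_cube _ _) H ω

section Processes

variable [NeZero d] {Ω : Type*} [MeasurableSpace Ω] {P : Ω → Set (E d)} {g : E d → ℝ≥0}
  {μ : Measure Ω} [IsProbabilityMeasure μ] {H : Finset (E d) → ℝ} {l : ℝ≥0} {a t : ℝ} {x : E d}
  {f : E d → ℝ≥0} {b : ℝ≥0} {K p : ℝ} {C : ℝ≥0} {n : ℕ}

lemma ae_inter_eq_empty (hP : IsPoissonProcess P g μ) {A : Set (E d)}
    (hg : Measurable g) (hA : MeasurableSet A) (hAb : Bornology.IsBounded A)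
    (h : ∀ x ∈ A, g x = 0) : ∀ᵐ ω ∂μ, P ω ∩ A = ∅ := by
  have h1 : law g A {∅}ᶜ = 0 := by
    rw [law, intensity_restrict_eq_zero hg hA h]
    simpa using poissonLaw_ne_empty_le (0 : Measure (E d))
  rw [← law_of_process hP hAb hA, Measure.map_apply (measurable_window hP hAb hA)
    measurableSet_singleton_empty.compl] at h1
  filter_upwards [measure_eq_zero_iff_ae_notMem.1 h1] with ω hω
  have h2 : window hP hAb ω = ∅ := not_not.1 hω
  rw [← coe_window hP hAb, h2, Finset.coe_empty]

/-- Almost surely, there are no points where the intensity function vanishes. -/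
lemma ae_subset_of_support (hP : IsPoissonProcess P g μ) (hg : Measurable g) {W : Set (E d)}
    (hW : MeasurableSet W) (h : ∀ x, g x ≠ 0 → x ∈ W) : ∀ᵐ ω ∂μ, P ω ⊆ W := by
  have h1 : ∀ᵐ ω ∂μ, ∀ k : ℕ, P ω ∩ (Metric.closedBall 0 k \ W) = ∅ :=
    ae_all_iff.2 fun k => ae_inter_eq_empty hP hg
      (Metric.isClosed_closedBall.measurableSet.diff hW)
      (Metric.isBounded_closedBall.subset Set.sdiff_subset)
      fun x hx => by_contra fun hne => hx.2 (h x hne)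
  filter_upwards [h1] with ω hω y hy
  by_contra hyW
  obtain ⟨k, hk⟩ := exists_nat_ge ‖y‖
  exact (Set.eq_empty_iff_forall_notMem.1 (hω k)) y
    ⟨hy, mem_closedBall_zero_iff.2 hk, hyW⟩

lemma memLp_boxVal (hP : IsPoissonProcess P g μ)
    (h : MemLp H 2 (law g (cube 0 (t ^ ((1 : ℝ) / d))))) : MemLp (boxVal H P t) 2 μ := by
  rw [boxVal_eq hP]
  rw [← law_of_process hP (isBounded_cube _ _) (measurableSet_cube _ _)] at h
  exact h.comp_of_map (measurable_window hP _ (measurableSet_cube _ _)).aemeasurable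

lemma variance_boxVal (hP : IsPoissonProcess P (fun _ => l) μ) (hH : Measurable H) (t : ℝ) :
    Var[boxVal H P t; μ] = cubeVariance H l (t ^ ((1 : ℝ) / d)) := by
  rw [boxVal_eq hP, cubeVariance,
    ← law_of_process hP (isBounded_cube _ _) (measurableSet_cube _ _),
    variance_map hH.aemeasurable (measurable_window hP _ (measurableSet_cube _ _)).aemeasurable]

lemma Regular.tendsto_variance_boxVal (h : Regular H f b K p C) (hx : LebesguePoint f x)
    (hP : IsPoissonProcess P (fun _ => f x) μ) :
    Tendsto (fun t : ℝ => Var[boxVal H P t; μ] / t) atTop (𝓝 (asymptoticVariance H (f x))) := by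
  have hd : 0 < (1 : ℝ) / d := by
    have := NeZero.pos d
    positivity
  refine ((h.tendsto_cubeVariance hx).comp (tendsto_rpow_atTop hd)).congr' ?_
  filter_upwards [eventually_gt_atTop 0] with t ht
  rw [variance_boxVal hP h.measH, Function.comp_apply, ← Real.rpow_natCast, ← Real.rpow_mul ht.le,
    one_div_mul_cancel (Nat.cast_ne_zero.2 (NeZero.ne d)), Real.rpow_one]

lemma Regular.limitingVariance_eq (h : Regular H f b K p C) (hx : LebesguePoint f x)
    (hP : IsPoissonProcess P (fun _ => f x) μ) :
    limitingVariance H P μ = asymptoticVariance H (f x) :=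
  (h.tendsto_variance_boxVal hx hP).limUnder_eq

/-- Almost surely, the `n`-th process has no points outside of a bounded window, so that it can be
replaced by a random finite configuration, whose law is the Poisson law. -/
lemma Regular.exists_window (h : Regular H f b K p C) (hn : 1 ≤ n)
    (hP : IsPoissonProcess P (dilated f n) μ) :
    ∃ w : Ω → Finset (E d), Measurable w ∧ μ.map w = poissonLaw (intensity (dilated f n)) ∧
      (fun ω => val H (P ω)) =ᵐ[μ] H ∘ w := by
  have hm := measurableSet_win (d := d) K 1 n
  refine ⟨window hP (isBounded_win K 1 n), measurable_window hP _ hm, ?_, ?_⟩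
  · rw [law_of_process hP _ hm, h.law_win hn one_pos]
  · filter_upwards [ae_subset_of_support hP (h.measg n) hm
      fun _ => h.mem_win_of_dilated_ne_zero hn one_pos] with ω hω
    rw [Function.comp_apply, ← val_inter hP (isBounded_win K 1 n) H, Set.inter_eq_left.2 hω]

end Processes

lemma exists_support_subset_symmCube {f : E d → ℝ≥0} (hf : HasCompactSupport f) :
    ∃ K : ℝ, 0 < K ∧ ∀ x, f x ≠ 0 → x ∈ symmCube K := by
  obtain ⟨R, hR⟩ := hf.isCompact.isBounded.subset_closedBall 0
  refine ⟨|R| + 1, by positivity, fun x hx => mem_symmCube.2 fun j => ?_⟩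
  have h1 : ‖x‖ ≤ R := mem_closedBall_zero_iff.1 (hR (subset_tsupport f hx))
  have h2 := abs_le.1 ((PiLp.norm_apply_le x j).trans h1)
  have h3 := le_abs_self R
  constructor <;> linarith

end PoissonCLT

theorem theorem3p2 {d : ℕ} (hd : 1 ≤ d)
    (f : PoissonCLT.E d → ℝ≥0) (hf_meas : Measurable f)
    (hf_bdd : BddAbove (Set.range f)) (hf_supp : HasCompactSupport f)
    (H : Finset (PoissonCLT.E d) → ℝ) (hH_meas : PoissonCLT.IsFunctional H)
    (hH_inv : PoissonCLT.TranslationInvariant H)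
    -- for each `l ≤ sup f`, a homogeneous Poisson point process `P l` with density `l`
    {Ω : ℝ≥0 → Type*} [∀ l, MeasurableSpace (Ω l)]
    (μ : ∀ l, Measure (Ω l)) [∀ l, IsProbabilityMeasure (μ l)]
    (P : ∀ l, Ω l → Set (PoissonCLT.E d))
    (hP : ∀ l, l ≤ ⨆ x, f x → PoissonCLT.IsPoissonProcess (P l) (fun _ => l) (μ l))
    -- for each `n ≥ 1`, a Poisson point process `Q n` with intensity function `n f`
    {Ω' : ℕ → Type*} [∀ n, MeasurableSpace (Ω' n)]
    (ν : ∀ n, Measure (Ω' n)) [∀ n, IsProbabilityMeasure (ν n)]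
    (Q : ∀ n, Ω' n → Set (PoissonCLT.E d))
    (hQ : ∀ n : ℕ, 1 ≤ n →
      PoissonCLT.IsPoissonProcess (Q n) (fun x => (n : ℝ≥0) * f x) (ν n))
    (h_stab : ∀ l, l ≤ ⨆ x, f x → PoissonCLT.StronglyStabilizing H (P l) (μ l))
    (h_pbm : PoissonCLT.PoissonBoundedMoments H (fun n => PoissonCLT.scaled n (Q n)) ν)
    (h_lbm : PoissonCLT.LocallyBoundedMoments H (fun n => PoissonCLT.scaled n (Q n)) ν) :
    -- the limiting variance of the homogeneous process is well defined at a.e. `f x`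
    (∀ᵐ x : PoissonCLT.E d,
      (∀ t : ℝ, 0 < t → MemLp (PoissonCLT.boxVal H (P (f x)) t) 2 (μ (f x))) ∧
      Tendsto (fun t : ℝ => Var[PoissonCLT.boxVal H (P (f x)) t; μ (f x)] / t) atTop
        (𝓝 (PoissonCLT.limitingVariance H (P (f x)) (μ (f x))))) ∧
    Integrable (fun x : PoissonCLT.E d =>
      PoissonCLT.limitingVariance H (P (f x)) (μ (f x))) ∧
    -- convergence of the variances
    (∀ n : ℕ, 1 ≤ n →
      MemLp (fun ω => PoissonCLT.val H (PoissonCLT.scaled n (Q n) ω)) 2 (ν n)) ∧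
    Tendsto
      (fun n : ℕ => Var[fun ω => PoissonCLT.val H (PoissonCLT.scaled n (Q n) ω); ν n] / n) atTop
      (𝓝 (∫ x : PoissonCLT.E d, PoissonCLT.limitingVariance H (P (f x)) (μ (f x)))) ∧
    -- the central limit theorem
    TendstoInDistribution
      (fun (n : ℕ) (ω : Ω' n) =>
        (PoissonCLT.val H (PoissonCLT.scaled n (Q n) ω) -
          ∫ ω', PoissonCLT.val H (PoissonCLT.scaled n (Q n) ω') ∂(ν n)) / √(n : ℝ))
      atTop (id : ℝ → ℝ) ν
      (gaussianReal 0
        (∫ x : PoissonCLT.E d,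
          PoissonCLT.limitingVariance H (P (f x)) (μ (f x))).toNNReal) := by
  have : NeZero d := ⟨by omega⟩
  have hH : Measurable H := hH_meas
  obtain ⟨K, hK, hsupp⟩ := PoissonCLT.exists_support_subset_symmCube hf_supp
  obtain ⟨p, hp, C, hC⟩ := PoissonCLT.exists_cost_moment_bound hH hf_meas hQ h_pbm
  have hle : ∀ x, f x ≤ ⨆ x, f x := fun x => le_ciSup hf_bdd x
  have h : PoissonCLT.Regular H f (⨆ x, f x) K p C :=
    { measH := hH
      inv := hH_inv
      measf := hf_meas
      le := hle
      pos := hK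
      supp := hsupp
      two_lt := hp
      cost := hC
      moment := fun a ha => PoissonCLT.exists_moment_bound hH hf_meas hQ h_lbm ha
      stab := fun x =>
        PoissonCLT.exists_stabilizationTail hH (hP _ (hle x)) (h_stab _ (hle x)) }
  have hLeb := PoissonCLT.ae_lebesguePoint hf_meas hle
  have hlim : (fun x => PoissonCLT.limitingVariance H (P (f x)) (μ (f x))) =ᵐ[volume]
      fun x => PoissonCLT.asymptoticVariance H (f x) := by
    filter_upwards [hLeb] with x hx
    exact h.limitingVariance_eq hx (hP _ (hle x))
  have htot : ∫ x, PoissonCLT.limitingVariance H (P (f x)) (μ (f x)) =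
      PoissonCLT.totalVariance H f := integral_congr_ae hlim
  have hw : ∀ n : ℕ, 1 ≤ n → ∃ w : Ω' n → Finset (PoissonCLT.E d), Measurable w ∧
      (ν n).map w = PoissonCLT.poissonLaw (PoissonCLT.intensity (PoissonCLT.dilated f n)) ∧
      (fun ω => PoissonCLT.val H (PoissonCLT.scaled n (Q n) ω)) =ᵐ[ν n] H ∘ w := fun n hn =>
    h.exists_window hn (PoissonCLT.isPoissonProcess_dilated hn hf_meas (hQ n hn))
  choose! w hwm hwl hwH using hw
  have hint : ∀ n : ℕ, 1 ≤ n → ∫ ω', PoissonCLT.val H (PoissonCLT.scaled n (Q n) ω') ∂(ν n) =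
      ∫ s, H s ∂PoissonCLT.poissonLaw (PoissonCLT.intensity (PoissonCLT.dilated f n)) := by
    intro n hn
    rw [integral_congr_ae (hwH n hn), ← hwl n hn, integral_map (hwm n hn).aemeasurable
      hH.aestronglyMeasurable]
    rfl
  rw [htot]
  refine ⟨?_, h.integrable_asymptoticVariance.congr hlim.symm, ?_, ?_, ?_⟩
  · filter_upwards [hLeb] with x hx
    refine ⟨fun t ht => PoissonCLT.memLp_boxVal (hP _ (hle x))
      (h.memLp_const hx 0 _ (Real.rpow_pos_of_pos ht _)), ?_⟩
    rw [h.limitingVariance_eq hx (hP _ (hle x))]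
    exact h.tendsto_variance_boxVal hx (hP _ (hle x))
  · intro n hn
    have hL2 := h.memLp_poissonLaw hn
    rw [← hwl n hn] at hL2
    exact (memLp_congr_ae (hwH n hn)).2 (hL2.comp_of_map (hwm n hn).aemeasurable)
  · refine h.tendsto_variance_div.congr' ?_
    filter_upwards [eventually_ge_atTop 1] with n hn
    rw [variance_congr (hwH n hn), ← hwl n hn, variance_map hH.aemeasurable
      (hwm n hn).aemeasurable]
  · have hae : ∀ n : ℕ, 1 ≤ n → (fun ω => (PoissonCLT.val H (PoissonCLT.scaled n (Q n) ω) -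
        ∫ ω', PoissonCLT.val H (PoissonCLT.scaled n (Q n) ω') ∂(ν n)) / √(n : ℝ)) =ᵐ[ν n]
        (fun s => (H s - ∫ s', H s' ∂PoissonCLT.poissonLaw
          (PoissonCLT.intensity (PoissonCLT.dilated f n))) / √(n : ℝ)) ∘ w n := by
      intro n hn
      filter_upwards [hwH n hn] with ω hω
      rw [hω, hint n hn]
      rfl
    have hm : ∀ n : ℕ, Measurable fun s => (H s - ∫ s', H s' ∂PoissonCLT.poissonLaw
          (PoissonCLT.intensity (PoissonCLT.dilated f n))) / √(n : ℝ) := fun n =>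
      (hH.sub_const _).div_const _
    refine ⟨fun n => ?_, aemeasurable_id, ?_⟩
    · rcases Nat.eq_zero_or_pos n with rfl | hn
      · -- division by `√0` gives the constant `0`
        simp
      · exact (((hm n).comp (hwm n hn)).aemeasurable).congr (hae n hn).symm
    · refine ProbabilityMeasure.tendsto_iff_tendsto_charFun.2 fun θ => ?_
      have hgauss : charFun ((gaussianReal 0 (PoissonCLT.totalVariance H f).toNNReal).map id) θ =
          (Real.exp (-(θ ^ 2 * PoissonCLT.totalVariance H f / 2)) : ℝ) := by
        rw [Measure.map_id, charFun_gaussianReal, Real.coe_toNNReal _ h.totalVariance_nonneg]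
        push_cast
        congr 1
        ring
      simp only [ProbabilityMeasure.coe_mk]
      rw [hgauss]
      refine (h.tendsto_charFun θ).congr' ?_
      filter_upwards [eventually_ge_atTop 1] with n hn
      rw [Measure.map_congr (hae n hn), ← Measure.map_map (hm n) (hwm n hn), hwl n hn]
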